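/- Let $V^1$ be the two-sorted theory of bounded arithmetic in the language $\{0,1,+,\cdot,|\ |,=_1,=_2,\le,\in\}$ (numbers $x$, and finite sets $X$ with length $|X|$) axiomatized by $2$-BASIC, comprehension for $\Sigma^{1,b}_0$-formulas and number induction for $\Sigma^{1,b}_1$-formulas. Let $\langle x,y\rangle=\frac{(x+y)(x+y+1)}2+y$, iterated by $\langle x_1,\dots,x_k\rangle=\langle\langle x_1,\dots,x_{k-1}\rangle,x_k\rangle$, write $X(x_1,\dots,x_k)$ for $\langle x_1,\dots,x_k\rangle\in X$, and $F(x_1,\dots,x_k)=y$ for $F(x_1,\dots,x_k,y)$. The following notions are expressed by formulas of this language; $m\ge 2$ is a fixed standard number. * *Algebra.* $A=\{0,\dots,l-1\}$, $l=|A|$, and $\Omega$ is an $m$-ary special weak near-unanimity operation on $A$: it is an operation on $A$, $\Omega(a,\dots,a)=a$, $\Omega(a,b,\dots,b)=\Omega(b,a,b,\dots,b)=\dots=\Omega(b,\dots,b,a)$ and $\Omega(a,\dots,a,\Omega(a,\dots,a,b))=\Omega(a,\dots,a,b)$ for all $a,b\in A$. * *Constraint language.* $\Gamma=(\Gamma^1,\Gamma^2)$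 lists unary relations $\Gamma^1(s,\cdot)$, $s<|\Gamma^1|$, and binary relations $\Gamma^2(s,\cdot,\cdot)$, $s<|\Gamma^2|$, all preserved by $\Omega$ on $A$. * *Instance* $\Theta=(\mathcal X,\ddot{\mathcal A})$ *over* $\Gamma$. An input digraph $\mathcal X=(V_{\mathcal X},E_{\mathcal X})$ with $V_{\mathcal X}=\{0,\dots,n-1\}$ (the variables), and a target digraph with domains $\ddot{\mathcal A}=(V_{\ddot{\mathcal A}},E_{\ddot{\mathcal A}})$, whose vertices are the pairs $\langle i,a\rangle$ with $i<n$ and $a\in D_i\subseteq A$; put $E^{ij}=\{(a,b): E_{\ddot{\mathcal A}}(\langle i,a\rangle,\langle j,b\rangle)\}$. Every $D_i$ is one of the unary, and every $E^{ij}$ one of the binary, relations of $\Gamma$. * *Paths and cycles.* An undirected path of length $t\ge 0$ is a digraph on $\{0,\dots,t\}$ in which $p$ and $p+1$ are joined, in at least one direction, for every $p<t$, without other edges. An undirected cycle of length $t\ge1$ is a digraph on $\{0,\dots,t-1\}$ in which consecutive vertices, as well as $t-1$ and $0$, are joined in at least one direction, without other edges. For a homomorphism $H$ from a path or cycle to $\mathcal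 X$, a homomorphism $H'$ from it to $\ddot{\mathcal A}$ is *over $H$* if for every vertex $p$ there is $c\in D_{H(p)}$ with $H'(p)=\langle H(p),c\rangle$. * *Cycle-consistency.* $\Theta$ is $1$-consistent if whenever $E_{\mathcal X}(i,j)$, every $a\in D_i$ has some $b\in D_j$ with $(a,b)\in E^{ij}$, and every $b\in D_j$ has some $a\in D_i$ with $(a,b)\in E^{ij}$. $\Theta$ is cycle-consistent if it is $1$-consistent and for every $k<n$, $a\in D_k$, every undirected cycle of length $t<nl$ and every homomorphism $H$ from it to $\mathcal X$ with $H(0)=k$, there is a homomorphism $H'$ from it to $\ddot{\mathcal A}$ over $H$ with $H'(0)=\langle k,a\rangle$. * *Linked.* $Linked(a,b,i,j,\Theta)$ holds if for some $t<nl$ there are an undirected path of length $t$, a homomorphism $H$ from it to $\mathcal X$ with $H(0)=i$, $H(t)=j$, and a homomorphism $H'$ from it to $\ddot{\mathcal A}$ over $H$ with $H'(0)=\langle i,a\rangle$, $H'(t)=\langle j,b\rangle$. **Lemma.** For every $m\ge2$, $V^1$ proves: for every algebra $(A,\Omega)$ with an $m$-ary special weak near-unanimity operation, every constraint language $\Gamma$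 of unary and binary relations preserved by $\Omega$, every cycle-consistent instance $\Theta=(\mathcal X,\ddot{\mathcal A})$ over $\Gamma$ and every variable $i<n$, the relation $Linked(a,b,i,i,\Theta)$ is a congruence on $D_i$. That is, $\Omega$ is an $m$-ary operation on $D_i$ which preserves this relation, and the relation is reflexive, symmetric and transitive on $D_i$. -/

import Mathlib

universe u

namespace BA

/-! ## Two-sorted first-order logic over the language `{0, 1, +, ·, | |, =₁, =₂, ≤, ∈}`

Number variables and set variables are both named by natural numbers. -/

/-- Number terms; `var i` is the `i`-th number variable, `len i` is `|X|` for the `i`-th set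
variable `X`. -/
inductive Tm : Type
  | var (i : ℕ) : Tm
  | zero : Tm
  | one : Tm
  | add (s t : Tm) : Tm
  | mul (s t : Tm) : Tm
  | len (i : ℕ) : Tm

/-- Formulas. `mem t i` is `t ∈ X` for the `i`-th set variable `X`; the suffix `N` marks
number quantifiers, the suffix `S` set quantifiers. -/
inductive Fml : Type
  | eqN (s t : Tm) : Fml
  | eqS (i j : ℕ) : Fml
  | le (s t : Tm) : Fml
  | mem (t : Tm) (i : ℕ) : Fml
  | neg (φ : Fml) : Fml
  | and (φ ψ : Fml) : Fml
  | or (φ ψ : Fml) : Fml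
  | allN (i : ℕ) (φ : Fml) : Fml
  | exN (i : ℕ) (φ : Fml) : Fml
  | allS (i : ℕ) (φ : Fml) : Fml
  | exS (i : ℕ) (φ : Fml) : Fml

namespace Tm

instance : Add Tm := ⟨Tm.add⟩
instance : Mul Tm := ⟨Tm.mul⟩
instance : Zero Tm := ⟨Tm.zero⟩
instance : One Tm := ⟨Tm.one⟩

/-- The number variable `x` occurs in the term. -/
def OccursN (x : ℕ) : Tm → Prop
  | var i => i = x
  | zero => False
  | one => False
  | add s t => OccursN x s ∨ OccursN x t
  | mul s t => OccursN x s ∨ OccursN x t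
  | len _ => False

/-- The set variable `X` occurs in the term. -/
def OccursS (X : ℕ) : Tm → Prop
  | var _ => False
  | zero => False
  | one => False
  | add s t => OccursS X s ∨ OccursS X t
  | mul s t => OccursS X s ∨ OccursS X t
  | len i => i = X

/-- Substitution of the term `r` for the number variable `x` in a term. -/
def subst : Tm → ℕ → Tm → Tm
  | var i, x, r => if i = x then r else var i
  | zero, _, _ => zero
  | one, _, _ => one
  | add s t, x, r => add (subst s x r) (subst t x r)
  | mul s t, x, r => mul (subst s x r) (subst t x r)
  | len i, _, _ => len i

end Tm

namespace Fml

/-- `φ → ψ` -/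
def imp (φ ψ : Fml) : Fml := or (neg φ) ψ

/-- `φ ↔ ψ` -/
def iff (φ ψ : Fml) : Fml := and (imp φ ψ) (imp ψ φ)

/-- `s < t`, that is `s ≤ t ∧ s ≠ t` -/
def lt (s t : Tm) : Fml := and (le s t) (neg (eqN s t))

/-- The set variable `X` occurs free in the formula. -/
def FreeS (X : ℕ) : Fml → Prop
  | eqN s t => s.OccursS X ∨ t.OccursS X
  | eqS i j => i = X ∨ j = X
  | le s t => s.OccursS X ∨ t.OccursS X
  | mem t i => t.OccursS X ∨ i = X
  | neg φ => FreeS X φ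
  | and φ ψ => FreeS X φ ∨ FreeS X ψ
  | or φ ψ => FreeS X φ ∨ FreeS X ψ
  | allN _ φ => FreeS X φ
  | exN _ φ => FreeS X φ
  | allS i φ => i ≠ X ∧ FreeS X φ
  | exS i φ => i ≠ X ∧ FreeS X φ

/-- Substitution of the term `r` for the free occurrences of the number variable `x`. It is only
used for terms `r` without variables other than `x`, where no variable can be captured. -/
def subst : Fml → ℕ → Tm → Fml
  | eqN s t, x, r => eqN (s.subst x r) (t.subst x r)
  | eqS i j, _, _ => eqS i j
  | le s t, x, r => le (s.subst x r) (t.subst x r)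
  | mem t i, x, r => mem (t.subst x r) i
  | neg φ, x, r => neg (subst φ x r)
  | and φ ψ, x, r => and (subst φ x r) (subst ψ x r)
  | or φ ψ, x, r => or (subst φ x r) (subst ψ x r)
  | allN i φ, x, r => if i = x then allN i φ else allN i (subst φ x r)
  | exN i φ, x, r => if i = x then exN i φ else exN i (subst φ x r)
  | allS i φ, x, r => allS i (subst φ x r)
  | exS i φ, x, r => exS i (subst φ x r)

end Fml

/-- A structure for the two-sorted language. Both equality symbols are interpreted as equality;
the second sort is an arbitrary non-empty type (not necessarily the full power set). -/
structure Str : Type (u + 1) where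
  N : Type u
  S : Type u
  nonempty : Nonempty S
  zero : N
  one : N
  add : N → N → N
  mul : N → N → N
  len : S → N
  le : N → N → Prop
  mem : N → S → Prop

/-- Value of a term under an assignment. -/
def Tm.val (M : Str.{u}) (e : ℕ → M.N) (E : ℕ → M.S) : Tm → M.N
  | .var i => e i
  | .zero => M.zero
  | .one => M.one
  | .add s t => M.add (s.val M e E) (t.val M e E)
  | .mul s t => M.mul (s.val M e E) (t.val M e E)
  | .len i => M.len (E i)

/-- Tarski's truth definition. -/
def Fml.Holds (M : Str.{u}) : Fml → (ℕ → M.N) → (ℕ → M.S) → Prop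
  | .eqN s t, e, E => s.val M e E = t.val M e E
  | .eqS i j, _, E => E i = E j
  | .le s t, e, E => M.le (s.val M e E) (t.val M e E)
  | .mem t i, e, E => M.mem (t.val M e E) (E i)
  | .neg φ, e, E => ¬ φ.Holds M e E
  | .and φ ψ, e, E => φ.Holds M e E ∧ ψ.Holds M e E
  | .or φ ψ, e, E => φ.Holds M e E ∨ ψ.Holds M e E
  | .allN i φ, e, E => ∀ a : M.N, φ.Holds M (Function.update e i a) E
  | .exN i φ, e, E => ∃ a : M.N, φ.Holds M (Function.update e i a) E
  | .allS i φ, e, E => ∀ A : M.S, φ.Holds M e (Function.update E i A)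
  | .exS i φ, e, E => ∃ A : M.S, φ.Holds M e (Function.update E i A)

/-- `M ⊨ φ`: the universal closure of `φ` is true in `M`. -/
def Str.Models (M : Str.{u}) (φ : Fml) : Prop :=
  ∀ (e : ℕ → M.N) (E : ℕ → M.S), φ.Holds M e E

/-- `φ` is a theorem of the theory axiomatized by (the universal closures of the formulas in) `T`:
a theory is the set of logical consequences of its axioms, so `φ` has to be true in every
structure in which all axioms are true. -/
def Proves (T : Set Fml) (φ : Fml) : Prop :=
  ∀ M : Str.{u}, (∀ ψ ∈ T, M.Models ψ) → M.Models φ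

/-! ## The theory `V¹` -/

/-- `Σ^{1,b}_0`-formulas: all number quantifiers bounded, no set quantifiers. -/
inductive IsSigma0 : Fml → Prop
  | eqN (s t : Tm) : IsSigma0 (.eqN s t)
  | eqS (i j : ℕ) : IsSigma0 (.eqS i j)
  | le (s t : Tm) : IsSigma0 (.le s t)
  | mem (t : Tm) (i : ℕ) : IsSigma0 (.mem t i)
  | neg {φ : Fml} : IsSigma0 φ → IsSigma0 (.neg φ)
  | and {φ ψ : Fml} : IsSigma0 φ → IsSigma0 ψ → IsSigma0 (.and φ ψ)
  | or {φ ψ : Fml} : IsSigma0 φ → IsSigma0 ψ → IsSigma0 (.or φ ψ)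
  | allN {x : ℕ} {t : Tm} {φ : Fml} : ¬ t.OccursN x → IsSigma0 φ →
      IsSigma0 (.allN x (.imp (.le (.var x) t) φ))
  | exN {x : ℕ} {t : Tm} {φ : Fml} : ¬ t.OccursN x → IsSigma0 φ →
      IsSigma0 (.exN x (.and (.le (.var x) t) φ))

mutual

/-- `Σ^{1,b}_1`-formulas. -/
inductive IsSigma1 : Fml → Prop
  | sigma0 {φ : Fml} : IsSigma0 φ → IsSigma1 φ
  | and {φ ψ : Fml} : IsSigma1 φ → IsSigma1 ψ → IsSigma1 (.and φ ψ)
  | or {φ ψ : Fml} : IsSigma1 φ → IsSigma1 ψ → IsSigma1 (.or φ ψ)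
  | neg {φ : Fml} : IsPi1 φ → IsSigma1 (.neg φ)
  | exS {X : ℕ} {t : Tm} {φ : Fml} : ¬ t.OccursS X → IsSigma1 φ →
      IsSigma1 (.exS X (.and (.le (.len X) t) φ))

/-- `Π^{1,b}_1`-formulas. -/
inductive IsPi1 : Fml → Prop
  | sigma0 {φ : Fml} : IsSigma0 φ → IsPi1 φ
  | and {φ ψ : Fml} : IsPi1 φ → IsPi1 ψ → IsPi1 (.and φ ψ)
  | or {φ ψ : Fml} : IsPi1 φ → IsPi1 ψ → IsPi1 (.or φ ψ)
  | neg {φ : Fml} : IsSigma1 φ → IsPi1 (.neg φ)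
  | allS {X : ℕ} {t : Tm} {φ : Fml} : ¬ t.OccursS X → IsPi1 φ →
      IsPi1 (.allS X (.imp (.le (.len X) t) φ))

end

open Fml in
/-- The axioms `2-BASIC`, with free variables `x = var 0`, `y = var 1`, `X`, `Y` (set variables
`0` and `1`). -/
def twoBasic : List Fml :=
  let x : Tm := .var 0
  let y : Tm := .var 1
  [ neg (eqN (x + 1) 0),
    imp (eqN (x + 1) (y + 1)) (eqN x y),
    eqN (x + 0) x,
    eqN (x + (y + 1)) ((x + y) + 1),
    eqN (x * 0) 0,
    eqN (x * (y + 1)) ((x * y) + x),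
    imp (and (le x y) (le y x)) (eqN x y),
    le x (x + y),
    le 0 x,
    or (le x y) (le y x),
    iff (le x y) (lt x (y + 1)),
    imp (neg (eqN x 0)) (exN 1 (and (le y x) (eqN (y + 1) x))),
    imp (mem y 0) (lt y (.len 0)),
    imp (eqN (y + 1) (.len 0)) (mem y 0),
    iff (and (eqN (.len 0) (.len 1))
        (allN 0 (imp (lt x (.len 0)) (iff (mem x 0) (mem x 1))))) (eqS 0 1) ]

/-- The induction axiom `φ(0) ∧ ∀ x (φ(x) → φ(x+1)) → ∀ x φ(x)`. -/
def indAx (x : ℕ) (φ : Fml) : Fml :=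
  .imp (.and (φ.subst x 0) (.allN x (.imp φ (φ.subst x (.var x + 1))))) (.allN x φ)

/-- The comprehension axiom `∀ x ∃ X ≤ x ∀ y < x (y ∈ X ↔ φ(y))`. -/
def compAx (x y X : ℕ) (φ : Fml) : Fml :=
  .allN x (.exS X (.and (.le (.len X) (.var x))
    (.allN y (.imp (.lt (.var y) (.var x)) (.iff (.mem (.var y) X) φ)))))

/-- The theory `V¹`: `2-BASIC`, comprehension for `Σ^{1,b}_0`-formulas and number induction for
`Σ^{1,b}_1`-formulas (which include the `Σ^{1,b}_0`-formulas). -/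
def V1 : Set Fml :=
  {ψ | ψ ∈ twoBasic ∨
    (∃ x y X φ, IsSigma0 φ ∧ x ≠ y ∧ ¬ φ.FreeS X ∧ ψ = compAx x y X φ) ∨
    (∃ x φ, IsSigma1 φ ∧ ψ = indAx x φ)}

/-! ## Writing formulas with bound variables chosen automatically

A `Bld` is a formula that depends on the first fresh number variable and the first fresh set
variable; binders take the first fresh variable and pass it to their body. -/

/-- A formula, given the indices from which on number and set variables are fresh. -/
abbrev Bld : Type := ℕ → ℕ → Fml

namespace Bld

def eq (s t : Tm) : Bld := fun _ _ => .eqN s t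
def lt (s t : Tm) : Bld := fun _ _ => .lt s t
/-- `t ∈ X` -/
def mem (t : Tm) (X : ℕ) : Bld := fun _ _ => .mem t X
def and (φ ψ : Bld) : Bld := fun n s => .and (φ n s) (ψ n s)
def or (φ ψ : Bld) : Bld := fun n s => .or (φ n s) (ψ n s)
def imp (φ ψ : Bld) : Bld := fun n s => .imp (φ n s) (ψ n s)
def iff (φ ψ : Bld) : Bld := fun n s => .iff (φ n s) (ψ n s)

/-- `∀ x < t, f x` -/
def allLt (t : Tm) (f : Tm → Bld) : Bld := fun n s =>
  .allN n (.imp (.le (.var n) t) (.imp (.neg (.eqN (.var n) t)) (f (.var n) (n + 1) s)))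

/-- `∃ x < t, f x` -/
def exLt (t : Tm) (f : Tm → Bld) : Bld := fun n s =>
  .exN n (.and (.le (.var n) t) (.and (.neg (.eqN (.var n) t)) (f (.var n) (n + 1) s)))

/-- `∀ X, f X` -/
def allSet (f : ℕ → Bld) : Bld := fun n s => .allS s (f s n (s + 1))

/-- `∀ X ≤ t, f X` (the bound is on the length of `X`) -/
def allSetLe (t : Tm) (f : ℕ → Bld) : Bld := fun n s =>
  .allS s (.imp (.le (.len s) t) (f s n (s + 1)))

/-- `∃ X ≤ t, f X` (the bound is on the length of `X`) -/
def exSetLe (t : Tm) (f : ℕ → Bld) : Bld := fun n s =>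
  .exS s (.and (.le (.len s) t) (f s n (s + 1)))

/-- Conjunction of `f 0, …, f (m - 1)`. -/
def conj (m : ℕ) (f : Fin m → Bld) : Bld := (List.ofFn f).foldr and (eq 0 0)

end Bld

infixr:35 " ⩓ " => Bld.and
infixr:30 " ⩔ " => Bld.or
infixr:25 " ⇾ " => Bld.imp
infix:20 " ⇿ " => Bld.iff

open Bld

/-! ## Pairs and tuples -/

/-- The term `2⟨x, y⟩`, where `⟨x, y⟩ = (x + y)(x + y + 1)/2 + y`. -/
def dblPair (x y : Tm) : Tm := (x + y) * (x + y + 1) + (y + y)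

/-- `z = ⟨x, y⟩` -/
def isPair (z x y : Tm) : Bld := eq (z + z) (dblPair x y)

/-- `⟨z, x₁, …, x_k⟩ ∈ X` for the list of the `x_i`, where
`⟨z, x₁, …, x_k⟩ = ⟨…⟨⟨z, x₁⟩, x₂⟩ …, x_k⟩`. Components of an element of `X` are less than `|X|`. -/
def memTuple (X : ℕ) : Tm → List Tm → Bld
  | z, [] => mem z X
  | z, x :: xs => exLt (.len X) fun w => isPair w z x ⩓ memTuple X w xs

/-- `X(x, y)` -/
def mem2 (X : ℕ) (x y : Tm) : Bld := memTuple X x [y]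

/-- `X(x, y, z)` -/
def mem3 (X : ℕ) (x y z : Tm) : Bld := memTuple X x [y, z]

/-- `X(x, ⟨y, z⟩)`, also written `X(x) = ⟨y, z⟩`. -/
def memAt (X : ℕ) (x y z : Tm) : Bld :=
  exLt (.len X) fun u => isPair u y z ⩓ mem2 X x u

/-- `F(x₀, …, x_{m-1}) = y`, that is `⟨x₀, …, x_{m-1}, y⟩ ∈ F`. -/
def app {m : ℕ} (F : ℕ) (xs : Fin m → Tm) (y : Tm) : Bld :=
  match List.ofFn xs ++ [y] with
  | [] => mem y F
  | z :: zs => memTuple F z zs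

/-! ## Domains, operations, congruences -/

/-- A definable set of numbers below a bound. -/
structure Dom : Type where
  bound : Tm
  mem : Tm → Bld

/-- The domain given by a set variable. -/
def setDom (A : ℕ) : Dom := ⟨.len A, fun x => mem x A⟩

/-- The domain `{0, …, t - 1}`. -/
def below (t : Tm) : Dom := ⟨t, fun x => lt x t⟩

/-- `∀ x ∈ D, f x` -/
def allIn (D : Dom) (f : Tm → Bld) : Bld := allLt D.bound fun x => D.mem x ⇾ f x

/-- `∃ x ∈ D, f x` -/
def exIn (D : Dom) (f : Tm → Bld) : Bld := exLt D.bound fun x => D.mem x ⩓ f x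

/-- `∀ x₀, …, x_{m-1} ∈ D, f (x₀, …, x_{m-1})` -/
def allVec (D : Dom) : (m : ℕ) → ((Fin m → Tm) → Bld) → Bld
  | 0, f => f Fin.elim0
  | m + 1, f => allIn D fun x => allVec D m fun xs => f (Fin.cons x xs)

/-- `F` is an `m`-ary operation on `A`. -/
def isOp (m : ℕ) (F : ℕ) (A : Dom) : Bld :=
  allVec A m fun xs =>
    (exIn A fun y => app F xs y) ⩓
    (allIn A fun y₁ => allIn A fun y₂ => (app F xs y₁ ⩓ app F xs y₂) ⇾ eq y₁ y₂)

/-- `F` is an idempotent `m`-ary operation on `A`. -/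
def isIdem (m : ℕ) (F : ℕ) (A : Dom) : Bld :=
  isOp m F A ⩓ allIn A fun a => app (m := m) F (fun _ => a) a

/-- `F` is a weak near-unanimity operation on `A`:
`F(a,b,…,b) = F(b,a,b,…,b) = … = F(b,…,b,a)`. -/
def isWNU (m : ℕ) (F : ℕ) (A : Dom) : Bld :=
  isOp m F A ⩓ allIn A fun a => allIn A fun b => exIn A fun c =>
    conj m fun t => app F (Function.update (fun _ => b) t a) c

/-- `F` is a special (idempotent) weak near-unanimity operation on `A`:
`F(a,…,a,F(a,…,a,b)) = F(a,…,a,b)`. -/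
def isSpecialWNU (m : ℕ) (F : ℕ) (A : Dom) : Bld :=
  isWNU m F A ⩓ isIdem m F A ⩓ allIn A fun a => allIn A fun b => exIn A fun c =>
    app (m := m) F (fun k => if k.val + 1 = m then b else a) c ⩓
    app (m := m) F (fun k => if k.val + 1 = m then c else a) c

/-- `F` is an `m`-ary operation on `A` that preserves the unary relation `R`. -/
def pol1 (m : ℕ) (F : ℕ) (A : Dom) (R : Tm → Bld) : Bld :=
  isOp m F A ⩓ allVec A m fun as => allIn A fun b =>
    ((conj m fun k => R (as k)) ⩓ app F as b) ⇾ R b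

/-- `F` is an `m`-ary operation on `A` that preserves the binary relation `R`. -/
def pol2 (m : ℕ) (F : ℕ) (A : Dom) (R : Tm → Tm → Bld) : Bld :=
  isOp m F A ⩓ allVec A m fun as => allVec A m fun as' => allIn A fun b => allIn A fun b' =>
    ((conj m fun k => R (as k) (as' k)) ⩓ app F as b ⩓ app F as' b') ⇾ R b b'

/-- The binary relation `σ` is a congruence of the algebra `(A, Ω)` with `m`-ary `Ω`. -/
def isCong (m : ℕ) (A : Dom) (Ω : ℕ) (σ : Tm → Tm → Bld) : Bld :=
  pol2 m Ω A σ ⩓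
  (allIn A fun a => σ a a) ⩓
  (allIn A fun a => allIn A fun b => σ a b ⇿ σ b a) ⩓
  (allIn A fun a => allIn A fun b => allIn A fun c => (σ a b ⩓ σ b c) ⇾ σ a c)

/-- `(A, Ω)` is an algebra on `A = {0, …, |A| - 1}` whose operation is an `m`-ary special weak
near-unanimity operation. -/
def isAlgebra (m : ℕ) (A Ω : ℕ) : Bld :=
  (allLt (.len A) fun i => mem i A) ⩓ isSpecialWNU m Ω (setDom A)

/-- `(Γ₁, Γ₂)` encodes a list of unary relations `Γ₁(s, ·)` and a list of binary relations
`Γ₂(s, ·, ·)`, all preserved by the `m`-ary operation `Ω` on `A`. -/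
def isLanguage (m : ℕ) (A Ω Γ₁ Γ₂ : ℕ) : Bld :=
  (allLt (.len Γ₁) fun s => pol1 m Ω (setDom A) fun a => mem2 Γ₁ s a) ⩓
  (allLt (.len Γ₂) fun s => pol2 m Ω (setDom A) fun a b => mem3 Γ₂ s a b)

/-! ## Instances -/

/-- The data of an instance `Θ = (𝒳, 𝒜)` over a universe `A` (set variables):
the vertices and edges of the input digraph `𝒳`, and the vertices and edges of the target digraph
with domains, where `⟨i, a⟩` is a target vertex iff `a ∈ D_i`, and where the pair of `⟨i, a⟩` and
`⟨j, b⟩` is a target edge iff `(a, b) ∈ E^{ij}`. -/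
structure Inst : Type where
  A : ℕ
  VX : ℕ
  EX : ℕ
  VA : ℕ
  EA : ℕ

namespace Inst

variable (Θ : Inst)

/-- The number of variables. -/
def n : Tm := .len Θ.VX

/-- The size of the universe. -/
def l : Tm := .len Θ.A

/-- The domain `D_i = {a < l : ⟨i, a⟩ ∈ VA}`. -/
def D (i : Tm) : Dom := ⟨Θ.l, fun a => mem2 Θ.VA i a⟩

/-- `(a, b) ∈ E^{ij}` -/
def edge (i j a b : Tm) : Bld :=
  exLt (.len Θ.EA) fun u => exLt (.len Θ.EA) fun v =>
    isPair u i a ⩓ isPair v j b ⩓ mem2 Θ.EA u v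

/-- `Θ` is an input digraph with vertices `0, …, n - 1`, together with a target digraph with
domains `D_0, …, D_{n-1} ⊆ {0, …, l - 1}`. -/
def isDG : Bld :=
  (allLt Θ.n fun i => mem i Θ.VX) ⩓
  (allIn (setDom Θ.EX) fun w => exLt Θ.n fun i => exLt Θ.n fun j => isPair w i j) ⩓
  (allIn (setDom Θ.VA) fun u => exLt Θ.n fun i => exLt Θ.l fun a => isPair u i a) ⩓
  (allIn (setDom Θ.EA) fun w => exIn (setDom Θ.VA) fun u => exIn (setDom Θ.VA) fun v =>
    isPair w u v)

/-- `Θ` is an instance over the constraint language `(Γ₁, Γ₂)`: every domain `D_i` is one of the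
unary relations, and every `E^{ij}` one of the binary relations, of the language. -/
def isInstance (Γ₁ Γ₂ : ℕ) : Bld :=
  Θ.isDG ⩓
  (allLt Θ.n fun i => allLt Θ.n fun j => exLt (.len Γ₂) fun s =>
    allLt Θ.l fun a => allLt Θ.l fun b => Θ.edge i j a b ⇿ mem3 Γ₂ s a b) ⩓
  (allLt Θ.n fun i => exLt (.len Γ₁) fun s =>
    allLt Θ.l fun a => mem2 Θ.VA i a ⇿ mem2 Γ₁ s a)

end Inst

/-- `H` is a well-defined map from `A` to `B`. -/
def isMap (A B : Dom) (H : ℕ) : Bld :=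
  (allIn A fun i => exIn B fun j => mem2 H i j) ⩓
  (allIn A fun i => allIn B fun j₁ => allIn B fun j₂ => (mem2 H i j₁ ⩓ mem2 H i j₂) ⇾ eq j₁ j₂)

/-- `H` is a homomorphism from the digraph `(V, E)` to the digraph `(W, F)`. -/
def isHom (V : Dom) (E : ℕ) (W : Dom) (F : ℕ) (H : ℕ) : Bld :=
  isMap V W H ⩓
  allIn V fun i₁ => allIn V fun i₂ => allIn W fun j₁ => allIn W fun j₂ =>
    (mem2 E i₁ i₂ ⩓ mem2 H i₁ j₁ ⩓ mem2 H i₂ j₂) ⇾ mem2 F j₁ j₂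

/-- `({0, …, t}, E)` is an undirected path of length `t`. -/
def isPath (t : Tm) (E : ℕ) : Bld :=
  (allLt t fun i => mem2 E i (i + 1) ⩔ mem2 E (i + 1) i) ⩓
  allLt (t + 1) fun i => allLt (t + 1) fun j => mem2 E i j ⇾ (eq j (i + 1) ⩔ eq i (j + 1))

/-- `({0, …, s}, E)` is an undirected cycle (of length `s + 1`). -/
def isCycle (s : Tm) (E : ℕ) : Bld :=
  (mem2 E 0 s ⩔ mem2 E s 0) ⩓
  (allLt s fun i => mem2 E i (i + 1) ⩔ mem2 E (i + 1) i) ⩓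
  allLt (s + 1) fun i => allLt (s + 1) fun j =>
    mem2 E i j ⇾ (eq j (i + 1) ⩔ eq i (j + 1) ⩔ (eq i 0 ⩓ eq j s) ⩔ (eq i s ⩓ eq j 0))

/-- The term `4t²`. -/
def fourSq (t : Tm) : Tm := (1 + 1 + 1 + 1) * (t * t)

namespace Inst

variable (Θ : Inst)

/-- `H` is a homomorphism from the digraph `({0, …, t - 1}, E)` to the input digraph. -/
def homX (t : Tm) (E H : ℕ) : Bld := isHom (below t) E (setDom Θ.VX) Θ.EX H

/-- `H'` is a homomorphism from the digraph `({0, …, t - 1}, E)` to the target digraph which sends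
every vertex `p` to an element `⟨k, c⟩` with `k = H(p)` and `c ∈ D_k`. -/
def homA (t : Tm) (E H H' : ℕ) : Bld :=
  isHom (below t) E (setDom Θ.VA) Θ.EA H' ⩓
  allLt Θ.n fun k => allLt t fun p => mem2 H p k ⇾ exIn (Θ.D k) fun c => memAt H' p k c

/-- `Θ` is `1`-consistent. -/
def oneConsistent : Bld :=
  allLt Θ.n fun i => allIn (Θ.D i) fun a => allLt Θ.n fun j =>
    (mem2 Θ.EX i j ⇾ exIn (Θ.D j) fun b => Θ.edge i j a b) ⩓
    (mem2 Θ.EX j i ⇾ exIn (Θ.D j) fun b => Θ.edge j i b a)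

/-- `Θ` is cycle-consistent: it is `1`-consistent and, for every `k < n`, every `a ∈ D_k` and every
undirected cycle of length `t < n l` with a homomorphism `H` to the input digraph such that
`H(0) = k`, there is a homomorphism `H'` to the target digraph over `H` with `H'(0) = ⟨k, a⟩`. -/
def cycleConsistent : Bld :=
  Θ.oneConsistent ⩓
  allLt Θ.n fun k => allIn (Θ.D k) fun a => allLt (Θ.n * Θ.l) fun t => allLt t fun s =>
    eq (s + 1) t ⇾ allSetLe (fourSq t) fun E => allSetLe (dblPair t Θ.n) fun H =>
      (isCycle s E ⩓ Θ.homX t E H ⩓ mem2 H 0 k) ⇾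
        exSetLe (dblPair t (dblPair Θ.n Θ.l)) fun H' => Θ.homA t E H H' ⩓ memAt H' 0 k a

/-- `Linked(a, b, i, j, Θ)`: for some `t < n l` there are an undirected path of length `t`, a
homomorphism `H` from it to the input digraph with `H(0) = i`, `H(t) = j`, and a homomorphism `H'`
to the target digraph over `H` with `H'(0) = ⟨i, a⟩`, `H'(t) = ⟨j, b⟩`. -/
def linked (a b i j : Tm) : Bld :=
  exLt (Θ.n * Θ.l) fun t => exSetLe (fourSq t) fun E => exSetLe (dblPair t Θ.n) fun H =>
    isPath t E ⩓ Θ.homX (t + 1) E H ⩓ mem2 H 0 i ⩓ mem2 H t j ⩓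
      exSetLe (dblPair t (dblPair Θ.n Θ.l)) fun H' =>
        Θ.homA (t + 1) E H H' ⩓ memAt H' 0 i a ⩓ memAt H' t j b

end Inst

/-- The sentence: for every algebra `(A, Ω)` with an `m`-ary special weak near-unanimity operation,
every list of unary and binary relations preserved by `Ω`, every cycle-consistent instance `Θ` over
these relations and every variable `i` of `Θ`, the relation `Linked(a, b, i, i, Θ)` is a
congruence on `D_i`. -/
def linkedCongruence (m : ℕ) : Fml :=
  (allSet fun A => allSet fun Ω => allSet fun Γ₁ => allSet fun Γ₂ =>
    allSet fun VX => allSet fun EX => allSet fun VA => allSet fun EA =>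
      let Θ : Inst := ⟨A, VX, EX, VA, EA⟩
      (isAlgebra m A Ω ⩓ isLanguage m A Ω Γ₁ Γ₂ ⩓ Θ.isInstance Γ₁ Γ₂ ⩓ Θ.cycleConsistent) ⇾
        allLt Θ.n fun i => isCong m (Θ.D i) Ω fun a b => Θ.linked a b i i) 0 0

end BA

namespace BA

/-! ## Denotation of terms and formulas built with fresh variables -/

-- Provability is defined as truth in all structures satisfying the axioms, so the argument takes
-- place inside an arbitrary, possibly nonstandard, model `M` of `V1`. Everything about finite
-- sequences must come from comprehension for Σ₀ relations with parameters (`exists_set_of_def`) and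
-- induction for Σ₁ relations (`induction_of_def`). The predicates `Def`, `DefT`, `DefS` and `DefF`
-- certify definability compositionally, so that no explicit formula has to be written. In the other
-- direction `Den` translates the formulas of the statement into ordinary propositions about `M`
-- (`models_linkedCongruence`).
--
-- Linked elements are the ends of a walk with fewer than `n l` steps in the target digraph.
-- Reflexivity is the walk of length 0 and symmetry is reversal. For transitivity two walks are
-- concatenated (`Conn.trans`), which may make the result too long. A walk with at least `n l` steps
-- repeats a target vertex by the pigeonhole principle (`exists_ne_ev_eq`), and the segment between
-- the two visits can be cut out. Repeating this by Σ₁ induction on the number of steps saved brings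
-- the length below `n l` (`Conn.exists_lt_mul`).
--
-- For compatibility with `Ω` it suffices, by transitivity, to change one argument at a time; as the
-- arity is standard, this is an ordinary finite iteration (`linked_app`). Suppose the `j`-th
-- argument is linked to `b`. The linking path lies over a closed walk in the input digraph from `i`
-- to `i`. Gluing its ends gives a cycle of the same length, still below `n l`, so cycle-consistency
-- lifts this walk to a closed walk at each of the other arguments (`Path.exists_closed_lift`). All
-- `m` lifts lie over the same oriented walk, and domains and edge relations are preserved by `Ω`,
-- so applying `Ω` position by position gives another lift (`exists_lift_app`). Its ends are the two
-- values of `Ω`, and its length is unchanged (`linked_app_update`).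

instance (M : Str.{u}) : Add M.N := ⟨M.add⟩
instance (M : Str.{u}) : Mul M.N := ⟨M.mul⟩
instance (M : Str.{u}) : Zero M.N := ⟨M.zero⟩
instance (M : Str.{u}) : One M.N := ⟨M.one⟩
instance (M : Str.{u}) : LE M.N := ⟨M.le⟩
instance (M : Str.{u}) : LT M.N := ⟨fun x y => x ≤ y ∧ x ≠ y⟩
instance (M : Str.{u}) : Membership M.N M.S := ⟨fun X x => M.mem x X⟩

/-- An assignment together with the numbers of number and set variables already in use. -/
structure World (M : Str.{u}) : Type u where
  n : ℕ
  s : ℕ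
  e : ℕ → M.N
  E : ℕ → M.S

variable {M : Str.{u}}

namespace World

/-- `w'` extends `w`: the variables in use in `w` keep their values. -/
def Ext (w w' : World M) : Prop :=
  w.n ≤ w'.n ∧ w.s ≤ w'.s ∧ (∀ i < w.n, w'.e i = w.e i) ∧ ∀ i < w.s, w'.E i = w.E i

theorem Ext.refl (w : World M) : w.Ext w :=
  ⟨le_rfl, le_rfl, fun _ _ => rfl, fun _ _ => rfl⟩

theorem Ext.trans {w₁ w₂ w₃ : World M} (h : w₁.Ext w₂) (h' : w₂.Ext w₃) : w₁.Ext w₃ :=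
  ⟨h.1.trans h'.1, h.2.1.trans h'.2.1,
    fun i hi => (h'.2.2.1 i (hi.trans_le h.1)).trans (h.2.2.1 i hi),
    fun i hi => (h'.2.2.2 i (hi.trans_le h.2.1)).trans (h.2.2.2 i hi)⟩

/-- Give the first fresh number variable the value `a`. -/
def pushN (w : World M) (a : M.N) : World M := ⟨w.n + 1, w.s, Function.update w.e w.n a, w.E⟩

/-- Give the first fresh set variable the value `A`. -/
def pushS (w : World M) (A : M.S) : World M := ⟨w.n, w.s + 1, w.e, Function.update w.E w.s A⟩

theorem ext_pushN (w : World M) (a : M.N) : w.Ext (w.pushN a) :=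
  ⟨Nat.le_succ _, le_rfl, fun _ hi => Function.update_of_ne hi.ne _ _, fun _ _ => rfl⟩

theorem ext_pushS (w : World M) (A : M.S) : w.Ext (w.pushS A) :=
  ⟨le_rfl, Nat.le_succ _, fun _ _ => rfl, fun _ hi => Function.update_of_ne hi.ne _ _⟩

end World

theorem Tm.val_congr (t : Tm) {e e' : ℕ → M.N} {E E' : ℕ → M.S}
    (h : ∀ i, t.OccursN i → e' i = e i) (h' : ∀ i, t.OccursS i → E' i = E i) :
    t.val M e' E' = t.val M e E := by
  induction t with
  | var i => exact h i rfl
  | zero => rfl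
  | one => rfl
  | add s t hs ht =>
    exact congrArg₂ M.add (hs (fun i hi => h i (.inl hi)) fun i hi => h' i (.inl hi))
      (ht (fun i hi => h i (.inr hi)) fun i hi => h' i (.inr hi))
  | mul s t hs ht =>
    exact congrArg₂ M.mul (hs (fun i hi => h i (.inl hi)) fun i hi => h' i (.inl hi))
      (ht (fun i hi => h i (.inr hi)) fun i hi => h' i (.inr hi))
  | len i => exact congrArg M.len (h' i rfl)

/-- The term `t` only uses variables of `w`, and has the value `a`. -/
def DenT (w : World M) (t : Tm) (a : M.N) : Prop :=
  (∀ i, t.OccursN i → i < w.n) ∧ (∀ i, t.OccursS i → i < w.s) ∧ t.val M w.e w.E = a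

/-- The set variable `X` is in use in `w` and has the value `A`. -/
def DenS (w : World M) (X : ℕ) (A : M.S) : Prop := X < w.s ∧ w.E X = A

/-- In every extension of `w`, the formula `φ` belongs to `K` and has the truth value `P`. -/
def Den (K : Fml → Prop) (w : World M) (φ : Bld) (P : Prop) : Prop :=
  ∀ w' : World M, w.Ext w' → K (φ w'.n w'.s) ∧ ((φ w'.n w'.s).Holds M w'.e w'.E ↔ P)

theorem DenT.mono {w w' : World M} (h : w.Ext w') {t : Tm} {a : M.N} (ht : DenT w t a) :
    DenT w' t a :=
  ⟨fun i hi => (ht.1 i hi).trans_le h.1, fun i hi => (ht.2.1 i hi).trans_le h.2.1,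
    (t.val_congr (fun i hi => h.2.2.1 i (ht.1 i hi)) fun i hi => h.2.2.2 i (ht.2.1 i hi)).trans
      ht.2.2⟩

theorem DenS.mono {w w' : World M} (h : w.Ext w') {X : ℕ} {A : M.S} (ht : DenS w X A) :
    DenS w' X A :=
  ⟨ht.1.trans_le h.2.1, (h.2.2.2 X ht.1).trans ht.2⟩

theorem Den.weaken {K K' : Fml → Prop} (hK : ∀ φ, K φ → K' φ) {w : World M} {φ : Bld} {P : Prop}
    (hφ : Den K w φ P) : Den K' w φ P :=
  fun w' hw => ⟨hK _ (hφ w' hw).1, (hφ w' hw).2⟩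

theorem Den.congr {K : Fml → Prop} {w : World M} {φ : Bld} {P Q : Prop}
    (hφ : Den K w φ P) (h : P ↔ Q) : Den K w φ Q :=
  propext h ▸ hφ

theorem denT_pushN (w : World M) (a : M.N) : DenT (w.pushN a) (.var w.n) a :=
  ⟨fun _ hi => hi ▸ Nat.lt_succ_self _, fun _ hi => hi.elim, Function.update_self ..⟩

theorem denS_pushS (w : World M) (A : M.S) : DenS (w.pushS A) w.s A :=
  ⟨Nat.lt_succ_self _, Function.update_self ..⟩

theorem DenT.zero (w : World M) : DenT w 0 0 := ⟨fun _ h => h.elim, fun _ h => h.elim, rfl⟩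
theorem DenT.one (w : World M) : DenT w 1 1 := ⟨fun _ h => h.elim, fun _ h => h.elim, rfl⟩

theorem DenT.add {w : World M} {s t : Tm} {a b : M.N} (hs : DenT w s a) (ht : DenT w t b) :
    DenT w (s + t) (a + b) :=
  ⟨fun i h => h.elim (hs.1 i) (ht.1 i), fun i h => h.elim (hs.2.1 i) (ht.2.1 i),
    congrArg₂ M.add hs.2.2 ht.2.2⟩

theorem DenT.mul {w : World M} {s t : Tm} {a b : M.N} (hs : DenT w s a) (ht : DenT w t b) :
    DenT w (s * t) (a * b) :=
  ⟨fun i h => h.elim (hs.1 i) (ht.1 i), fun i h => h.elim (hs.2.1 i) (ht.2.1 i),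
    congrArg₂ M.mul hs.2.2 ht.2.2⟩

theorem DenT.len {w : World M} {X : ℕ} {A : M.S} (h : DenS w X A) :
    DenT w (.len X) (M.len A) :=
  ⟨fun _ h => h.elim, fun _ hi => hi ▸ h.1, congrArg M.len h.2⟩

/-- A class of formulas closed under the Boolean operations and bounded number quantifiers. -/
class BoundedClosed (K : Fml → Prop) : Prop where
  eqN (s t : Tm) : K (.eqN s t)
  le (s t : Tm) : K (.le s t)
  mem (t : Tm) (i : ℕ) : K (.mem t i)
  neg {φ : Fml} : K φ → K (.neg φ)
  and {φ ψ : Fml} : K φ → K ψ → K (.and φ ψ)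
  or {φ ψ : Fml} : K φ → K ψ → K (.or φ ψ)
  allN {x : ℕ} {t : Tm} {φ : Fml} : ¬ t.OccursN x → K φ → K (.allN x (.imp (.le (.var x) t) φ))
  exN {x : ℕ} {t : Tm} {φ : Fml} : ¬ t.OccursN x → K φ → K (.exN x (.and (.le (.var x) t) φ))

instance : BoundedClosed IsSigma0 :=
  ⟨.eqN, .le, .mem, .neg, .and, .or, .allN, .exN⟩

/-- The class of all formulas. -/
def AnyFml : Fml → Prop := fun _ => True

instance : BoundedClosed AnyFml := by
  constructor <;> intros <;> trivial

theorem Fml.holds_imp {φ ψ : Fml} {e : ℕ → M.N} {E : ℕ → M.S} :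
    (Fml.imp φ ψ).Holds M e E ↔ (φ.Holds M e E → ψ.Holds M e E) :=
  imp_iff_not_or.symm

section Closed

variable {K : Fml → Prop} [BoundedClosed K] {w : World M} {φ ψ : Bld} {P Q : Prop}
  {s t : Tm} {a b : M.N}

theorem Den.eq (hs : DenT w s a) (ht : DenT w t b) : Den K w (.eq s t) (a = b) :=
  fun w' hw => ⟨BoundedClosed.eqN s t, by
    change s.val M w'.e w'.E = t.val M w'.e w'.E ↔ _
    rw [(hs.mono hw).2.2, (ht.mono hw).2.2]⟩

theorem Den.le (hs : DenT w s a) (ht : DenT w t b) : Den K w (fun _ _ => .le s t) (a ≤ b) :=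
  fun w' hw => ⟨BoundedClosed.le s t, by
    change M.le (s.val M w'.e w'.E) (t.val M w'.e w'.E) ↔ _
    rw [(hs.mono hw).2.2, (ht.mono hw).2.2]; rfl⟩

theorem Den.mem {X : ℕ} {A : M.S} (hs : DenT w s a) (hX : DenS w X A) :
    Den K w (.mem s X) (a ∈ A) :=
  fun w' hw => ⟨BoundedClosed.mem s X, by
    change M.mem (s.val M w'.e w'.E) (w'.E X) ↔ _
    rw [(hs.mono hw).2.2, (hX.mono hw).2]; rfl⟩

theorem Den.not (hφ : Den K w φ P) : Den K w (fun n s => .neg (φ n s)) (¬ P) :=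
  fun w' hw => ⟨BoundedClosed.neg (hφ w' hw).1, not_congr (hφ w' hw).2⟩

theorem Den.and (hφ : Den K w φ P) (hψ : Den K w ψ Q) : Den K w (φ ⩓ ψ) (P ∧ Q) :=
  fun w' hw => ⟨BoundedClosed.and (hφ w' hw).1 (hψ w' hw).1,
    and_congr (hφ w' hw).2 (hψ w' hw).2⟩

theorem Den.or (hφ : Den K w φ P) (hψ : Den K w ψ Q) : Den K w (φ ⩔ ψ) (P ∨ Q) :=
  fun w' hw => ⟨BoundedClosed.or (hφ w' hw).1 (hψ w' hw).1,
    or_congr (hφ w' hw).2 (hψ w' hw).2⟩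

theorem Den.imp (hφ : Den K w φ P) (hψ : Den K w ψ Q) : Den K w (φ ⇾ ψ) (P → Q) :=
  (hφ.not.or hψ).congr imp_iff_not_or.symm

theorem Den.iff (hφ : Den K w φ P) (hψ : Den K w ψ Q) : Den K w (φ ⇿ ψ) (P ↔ Q) :=
  ((hφ.imp hψ).and (hψ.imp hφ)).congr iff_def.symm

theorem Den.lt (hs : DenT w s a) (ht : DenT w t b) : Den K w (.lt s t) (a < b) :=
  (Den.le hs ht).and (Den.eq hs ht).not

/-- The bound variable is the first fresh one, and `DenT` confines `t` to variables already in use,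
so it cannot occur in its own bound. The body is required to denote correctly in every extension
because the binder enlarges the world. -/
theorem Den.allLe {f : Tm → Bld} {p : M.N → Prop} (ht : DenT w t a)
    (hf : ∀ x w' u, w.Ext w' → DenT w' u x → Den K w' (f u) (p x)) :
    Den K w (fun n s => .allN n (.imp (.le (.var n) t) (f (.var n) (n + 1) s)))
      (∀ x, x ≤ a → p x) := by
  intro w' hw
  have key : ∀ x, Den K (w'.pushN x) (f (.var w'.n)) (p x) := fun x =>
    hf x _ _ (hw.trans (w'.ext_pushN x)) (denT_pushN w' x)
  refine ⟨BoundedClosed.allN (fun h => (((ht.mono hw).1 _ h).ne rfl))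
    (key 0 _ (.refl _)).1, forall_congr' fun x => ?_⟩
  refine Fml.holds_imp.trans (imp_congr ?_ (key x _ (.refl _)).2)
  exact (Den.le (K := K) (denT_pushN w' x) (ht.mono (hw.trans (w'.ext_pushN x))) _ (.refl _)).2

theorem Den.exLe {f : Tm → Bld} {p : M.N → Prop} (ht : DenT w t a)
    (hf : ∀ x w' u, w.Ext w' → DenT w' u x → Den K w' (f u) (p x)) :
    Den K w (fun n s => .exN n (.and (.le (.var n) t) (f (.var n) (n + 1) s)))
      (∃ x, x ≤ a ∧ p x) := by
  intro w' hw
  have key : ∀ x, Den K (w'.pushN x) (f (.var w'.n)) (p x) := fun x =>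
    hf x _ _ (hw.trans (w'.ext_pushN x)) (denT_pushN w' x)
  refine ⟨BoundedClosed.exN (fun h => (((ht.mono hw).1 _ h).ne rfl))
    (key 0 _ (.refl _)).1, exists_congr fun x => ?_⟩
  refine and_congr ?_ (key x _ (.refl _)).2
  exact (Den.le (K := K) (denT_pushN w' x) (ht.mono (hw.trans (w'.ext_pushN x))) _ (.refl _)).2

theorem Den.allLt {f : Tm → Bld} {p : M.N → Prop} (ht : DenT w t a)
    (hf : ∀ x w' u, w.Ext w' → DenT w' u x → Den K w' (f u) (p x)) :
    Den K w (.allLt t f) (∀ x, x < a → p x) :=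
  (Den.allLe (f := fun u => (fun _ _ => .neg (.eqN u t)) ⇾ f u) (p := fun x => ¬ x = a → p x) ht
    fun x w' u hw hu => (Den.eq hu (ht.mono hw)).not.imp (hf x w' u hw hu)).congr
    (forall_congr' fun _ => and_imp.symm)

theorem Den.exLt {f : Tm → Bld} {p : M.N → Prop} (ht : DenT w t a)
    (hf : ∀ x w' u, w.Ext w' → DenT w' u x → Den K w' (f u) (p x)) :
    Den K w (.exLt t f) (∃ x, x < a ∧ p x) :=
  (Den.exLe (f := fun u => (fun _ _ => .neg (.eqN u t)) ⩓ f u) (p := fun x => ¬ x = a ∧ p x) ht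
    fun x w' u hw hu => (Den.eq hu (ht.mono hw)).not.and (hf x w' u hw hu)).congr
    (exists_congr fun _ => and_assoc.symm)

theorem Den.conj (m : ℕ) {f : Fin m → Bld} {p : Fin m → Prop} (hf : ∀ k, Den K w (f k) (p k)) :
    Den K w (.conj m f) (∀ k, p k) := by
  induction m with
  | zero => exact (Den.eq (.zero w) (.zero w)).congr (by simp)
  | succ m ih =>
    have h := (hf 0).and (ih fun k => hf k.succ)
    simp only [Bld.conj, List.ofFn_succ, List.foldr_cons] at h ⊢
    exact h.congr Fin.forall_fin_succ.symm

end Closed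

/-- Stated only for `AnyFml`: Σ₁ formulas are not closed under universal set quantifiers, and this
one serves only to read the final sentence. -/
theorem Den.allSetLe {w : World M} {t : Tm} {a : M.N} {f : ℕ → Bld} {p : M.S → Prop}
    (ht : DenT w t a) (hf : ∀ A w' X, w.Ext w' → DenS w' X A → Den AnyFml w' (f X) (p A)) :
    Den AnyFml w (.allSetLe t f) (∀ A, M.len A ≤ a → p A) :=
  fun w' hw => ⟨trivial, forall_congr' fun A => Fml.holds_imp.trans <| imp_congr
    (Den.le (K := AnyFml) (.len (denS_pushS w' A)) (ht.mono (hw.trans (w'.ext_pushS A)))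
      _ (.refl _)).2
    (hf A _ _ (hw.trans (w'.ext_pushS A)) (denS_pushS w' A) _ (.refl _)).2⟩

/-- A class of formulas closed under bounded existential set quantifiers. -/
class ExSetClosed (K : Fml → Prop) : Prop where
  exS {X : ℕ} {t : Tm} {φ : Fml} :
    ¬ t.OccursS X → K φ → K (.exS X (.and (.le (.len X) t) φ))

instance : ExSetClosed IsSigma1 := ⟨.exS⟩
instance : ExSetClosed AnyFml := ⟨fun _ _ => trivial⟩

theorem Den.exSetLe {K : Fml → Prop} [ExSetClosed K] {w : World M} {t : Tm} {a : M.N}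
    {f : ℕ → Bld} {p : M.S → Prop}
    (ht : DenT w t a) (hf : ∀ A w' X, w.Ext w' → DenS w' X A → Den K w' (f X) (p A)) :
    Den K w (.exSetLe t f) (∃ A, M.len A ≤ a ∧ p A) := by
  intro w' hw
  have key : ∀ A, Den K (w'.pushS A) (f w'.s) (p A) := fun A =>
    hf A _ _ (hw.trans (w'.ext_pushS A)) (denS_pushS w' A)
  -- Membership of the body in `K` is purely syntactic, but `key` yields it only after some value is
  -- supplied for the bound set.
  obtain ⟨A₀⟩ := M.nonempty
  refine ⟨ExSetClosed.exS (fun h => ((ht.mono hw).2.1 _ h).ne rfl) (key A₀ _ (.refl _)).1,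
    exists_congr fun A => and_congr ?_ (key A _ (.refl _)).2⟩
  exact (Den.le (K := AnyFml) (.len (denS_pushS w' A)) (ht.mono (hw.trans (w'.ext_pushS A)))
      _ (.refl _)).2

/-! ## Definability with parameters -/

/-- A context of number and set variables. -/
class Ctx (M : Str.{u}) (Γ : Type u) where
  Name : Type
  den : World M → Name → Γ → Prop
  mono : ∀ {w w' : World M} {r : Name} {g : Γ}, w.Ext w' → den w r g → den w' r g

instance : Ctx M PUnit.{u + 1} := ⟨Unit, fun _ _ _ => True, fun _ _ => trivial⟩

instance : Ctx M M.N := ⟨Tm, DenT, fun hw h => DenT.mono hw h⟩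

instance : Ctx M M.S := ⟨ℕ, DenS, fun hw h => DenS.mono hw h⟩

instance (Γ Δ : Type u) [Ctx M Γ] [Ctx M Δ] : Ctx M (Γ × Δ) :=
  ⟨Ctx.Name M Γ × Ctx.Name M Δ, fun w r g => Ctx.den w r.1 g.1 ∧ Ctx.den w r.2 g.2,
    fun hw h => ⟨Ctx.mono hw h.1, Ctx.mono hw h.2⟩⟩

section Def

variable {Γ : Type u} [Ctx M Γ]

/-- The function `f` is the value of a term with parameters. -/
def DefT (f : Γ → M.N) : Prop :=
  ∀ w : World M, ∃ w', w.Ext w' ∧ ∃ F : Ctx.Name M Γ → Tm,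
    ∀ w'', w'.Ext w'' → ∀ r g, Ctx.den w'' r g → DenT w'' (F r) (f g)

/-- The set-valued function `f` is the value of a set variable or a parameter. -/
def DefS (f : Γ → M.S) : Prop :=
  ∀ w : World M, ∃ w', w.Ext w' ∧ ∃ F : Ctx.Name M Γ → ℕ,
    ∀ w'', w'.Ext w'' → ∀ r g, Ctx.den w'' r g → DenS w'' (F r) (f g)

/-- The relation `P` is defined by a formula in `K` with parameters. -/
def Def (M : Str.{u}) {Γ : Type u} [Ctx M Γ] (K : Fml → Prop) (P : Γ → Prop) : Prop :=
  ∀ w : World M, ∃ w', w.Ext w' ∧ ∃ F : Ctx.Name M Γ → Bld,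
    ∀ w'', w'.Ext w'' → ∀ r g, Ctx.den w'' r g → Den K w'' (F r) (P g)

/-- An element of the model becomes a parameter by storing it in a fresh variable; this is why
definability allows the world to be extended first. -/
theorem DefT.const (c : M.N) : DefT (fun _ : Γ => c) := fun w =>
  ⟨_, w.ext_pushN c, fun _ => .var w.n, fun _ hw _ _ _ => (denT_pushN w c).mono hw⟩

theorem DefS.const (A : M.S) : DefS (fun _ : Γ => A) := fun w =>
  ⟨_, w.ext_pushS A, fun _ => w.s, fun _ hw _ _ _ => (denS_pushS w A).mono hw⟩

theorem DefT.last : DefT (fun g : Γ × M.N => g.2) := fun w =>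
  ⟨w, .refl w, fun r => r.2, fun _ _ _ _ h => h.2⟩

theorem DefS.last : DefS (fun g : Γ × M.S => g.2) := fun w =>
  ⟨w, .refl w, fun r => r.2, fun _ _ _ _ h => h.2⟩

theorem DefT.lift {Δ : Type u} [Ctx M Δ] {f : Γ → M.N} (hf : DefT f) :
    DefT (fun g : Γ × Δ => f g.1) := fun w =>
  let ⟨w', hw', F, hF⟩ := hf w
  ⟨w', hw', fun r => F r.1, fun _ hw _ _ h => hF _ hw _ _ h.1⟩

theorem DefS.lift {Δ : Type u} [Ctx M Δ] {f : Γ → M.S} (hf : DefS f) :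
    DefS (fun g : Γ × Δ => f g.1) := fun w =>
  let ⟨w', hw', F, hF⟩ := hf w
  ⟨w', hw', fun r => F r.1, fun _ hw _ _ h => hF _ hw _ _ h.1⟩

/-- Weakening and permutation of variables: the map on values must be matched by a map on names. -/
theorem Def.reindex {Δ : Type u} [Ctx M Δ] {K : Fml → Prop} {P : Γ → Prop} (hP : Def M K P)
    (σ : Δ → Γ) (ρ : Ctx.Name M Δ → Ctx.Name M Γ)
    (h : ∀ (w : World M) r g, Ctx.den w r g → Ctx.den w (ρ r) (σ g)) :
    Def M K (fun g => P (σ g)) := fun w =>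
  let ⟨w', hw', F, hF⟩ := hP w
  ⟨w', hw', fun r => F (ρ r), fun _ hw _ _ hr => hF _ hw _ _ (h _ _ _ hr)⟩

theorem DefT.len {A : Γ → M.S} (hA : DefS A) : DefT (fun g => M.len (A g)) := fun w =>
  let ⟨w', hw', F, hF⟩ := hA w
  ⟨w', hw', fun r => .len (F r), fun _ hw _ _ h => .len (hF _ hw _ _ h)⟩

theorem DefT.add {f h : Γ → M.N} (hf : DefT f) (hh : DefT h) : DefT (fun g => f g + h g) := fun w =>
  let ⟨_, hw₁, F, hF⟩ := hf w
  let ⟨w₂, hw₂, H, hH⟩ := hh _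
  ⟨w₂, hw₁.trans hw₂, fun r => F r + H r,
    fun _ hw _ _ h => (hF _ (hw₂.trans hw) _ _ h).add (hH _ hw _ _ h)⟩

theorem DefT.mul {f h : Γ → M.N} (hf : DefT f) (hh : DefT h) : DefT (fun g => f g * h g) := fun w =>
  let ⟨_, hw₁, F, hF⟩ := hf w
  let ⟨w₂, hw₂, H, hH⟩ := hh _
  ⟨w₂, hw₁.trans hw₂, fun r => F r * H r,
    fun _ hw _ _ h => (hF _ (hw₂.trans hw) _ _ h).mul (hH _ hw _ _ h)⟩

theorem Def.congr {K : Fml → Prop} {P Q : Γ → Prop} (hP : Def M K P) (h : ∀ g, P g ↔ Q g) :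
    Def M K Q :=
  (funext fun g => propext (h g) : P = Q) ▸ hP

theorem Def.weaken {K K' : Fml → Prop} (hK : ∀ φ, K φ → K' φ) {P : Γ → Prop} (hP : Def M K P) :
    Def M K' P := fun w =>
  let ⟨w', hw', F, hF⟩ := hP w
  ⟨w', hw', F, fun _ hw _ _ h => (hF _ hw _ _ h).weaken hK⟩

section Closed

variable {K : Fml → Prop} [BoundedClosed K] {P Q : Γ → Prop}

theorem Def.eqT {f h : Γ → M.N} (hf : DefT f) (hh : DefT h) : Def M K (fun g => f g = h g) :=
  fun w =>
  let ⟨_, hw₁, F, hF⟩ := hf w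
  let ⟨w₂, hw₂, H, hH⟩ := hh _
  ⟨w₂, hw₁.trans hw₂, fun r => .eq (F r) (H r),
    fun _ hw _ _ h => .eq (hF _ (hw₂.trans hw) _ _ h) (hH _ hw _ _ h)⟩

theorem Def.leT {f h : Γ → M.N} (hf : DefT f) (hh : DefT h) : Def M K (fun g => f g ≤ h g) :=
  fun w =>
  let ⟨_, hw₁, F, hF⟩ := hf w
  let ⟨w₂, hw₂, H, hH⟩ := hh _
  ⟨w₂, hw₁.trans hw₂, fun r _ _ => .le (F r) (H r),
    fun _ hw _ _ h => .le (hF _ (hw₂.trans hw) _ _ h) (hH _ hw _ _ h)⟩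

theorem Def.memT {f : Γ → M.N} {A : Γ → M.S} (hf : DefT f) (hA : DefS A) :
    Def M K (fun g => f g ∈ A g) := fun w =>
  let ⟨_, hw₁, F, hF⟩ := hf w
  let ⟨w₂, hw₂, H, hH⟩ := hA _
  ⟨w₂, hw₁.trans hw₂, fun r => .mem (F r) (H r),
    fun _ hw _ _ h => .mem (hF _ (hw₂.trans hw) _ _ h) (hH _ hw _ _ h)⟩

theorem Def.not (hP : Def M K P) : Def M K (fun g => ¬ P g) := fun w =>
  let ⟨w', hw', F, hF⟩ := hP w
  ⟨w', hw', fun r n s => .neg (F r n s), fun _ hw _ _ h => (hF _ hw _ _ h).not⟩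

theorem Def.and (hP : Def M K P) (hQ : Def M K Q) : Def M K (fun g => P g ∧ Q g) := fun w =>
  let ⟨_, hw₁, F, hF⟩ := hP w
  let ⟨w₂, hw₂, H, hH⟩ := hQ _
  ⟨w₂, hw₁.trans hw₂, fun r => F r ⩓ H r,
    fun _ hw _ _ h => (hF _ (hw₂.trans hw) _ _ h).and (hH _ hw _ _ h)⟩

theorem Def.or (hP : Def M K P) (hQ : Def M K Q) : Def M K (fun g => P g ∨ Q g) :=
  (hP.not.and hQ.not).not.congr fun _ => by tauto

theorem Def.imp (hP : Def M K P) (hQ : Def M K Q) : Def M K (fun g => P g → Q g) :=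
  (hP.not.or hQ).congr fun _ => by tauto

theorem Def.const (P : Prop) : Def M K (fun _ : Γ => P) := by
  by_cases hP : P
  · exact (Def.eqT (DefT.const (0 : M.N)) (.const 0)).congr fun _ => by simp [hP]
  · exact (Def.eqT (DefT.const (0 : M.N)) (.const 0)).not.congr fun _ => by simp [hP]

theorem Def.allLeT {f : Γ → M.N} {P : Γ → M.N → Prop} (hf : DefT f)
    (hP : Def M K (fun g : Γ × M.N => P g.1 g.2)) :
    Def M K (fun g => ∀ x, x ≤ f g → P g x) := fun w =>
  let ⟨_, hw₁, F, hF⟩ := hf w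
  let ⟨w₂, hw₂, H, hH⟩ := hP _
  ⟨w₂, hw₁.trans hw₂,
    fun r n s => .allN n (.imp (.le (.var n) (F r)) (H (r, .var n) (n + 1) s)),
    fun _ hw r g h => Den.allLe (f := fun u => H (r, u)) (hF _ (hw₂.trans hw) _ _ h)
      fun x _ u hw' hu => hH _ (hw.trans hw') (r, u) (g, x) ⟨Ctx.mono hw' h, hu⟩⟩

theorem Def.exLeT {f : Γ → M.N} {P : Γ → M.N → Prop} (hf : DefT f)
    (hP : Def M K (fun g : Γ × M.N => P g.1 g.2)) :
    Def M K (fun g => ∃ x, x ≤ f g ∧ P g x) := fun w =>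
  let ⟨_, hw₁, F, hF⟩ := hf w
  let ⟨w₂, hw₂, H, hH⟩ := hP _
  ⟨w₂, hw₁.trans hw₂,
    fun r n s => .exN n (.and (.le (.var n) (F r)) (H (r, .var n) (n + 1) s)),
    fun _ hw r g h => Den.exLe (f := fun u => H (r, u)) (hF _ (hw₂.trans hw) _ _ h)
      fun x _ u hw' hu => hH _ (hw.trans hw') (r, u) (g, x) ⟨Ctx.mono hw' h, hu⟩⟩

end Closed

theorem Def.exSetLeT {f : Γ → M.N} {P : Γ → M.S → Prop} (hf : DefT f)
    (hP : Def M IsSigma1 (fun g : Γ × M.S => P g.1 g.2)) :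
    Def M IsSigma1 (fun g => ∃ A, M.len A ≤ f g ∧ P g A) := fun w =>
  let ⟨_, hw₁, F, hF⟩ := hf w
  let ⟨w₂, hw₂, H, hH⟩ := hP _
  ⟨w₂, hw₁.trans hw₂, fun r => .exSetLe (F r) fun X => H (r, X),
    fun _ hw r g h => Den.exSetLe (hF _ (hw₂.trans hw) _ _ h)
      fun A _ u hw' hu => hH _ (hw.trans hw') (r, u) (g, A) ⟨Ctx.mono hw' h, hu⟩⟩

theorem Def.sigma1 {P : Γ → Prop} (hP : Def M IsSigma0 P) : Def M IsSigma1 P :=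
  hP.weaken fun _ => .sigma0

end Def

/-! ## Comprehension and induction in models of `V¹` -/

/-- `M` is a model of `V¹`. -/
class IsV1Model (M : Str.{u}) : Prop where
  models : ∀ ψ ∈ V1, M.Models ψ

-- Free variables, substitution, and the semantic form of the axiom schemes

/-- Comprehension forbids the new set variable in the defining formula; a bound on the free set
variables supplies a permitted index. -/
theorem Fml.exists_freeS_lt (φ : Fml) : ∃ B : ℕ, ∀ X, φ.FreeS X → X < B := by
  have tm : ∀ t : Tm, ∃ B : ℕ, ∀ X, t.OccursS X → X < B := by
    intro t
    induction t with
    | var i => exact ⟨0, fun _ h => h.elim⟩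
    | zero => exact ⟨0, fun _ h => h.elim⟩
    | one => exact ⟨0, fun _ h => h.elim⟩
    | add s t hs ht =>
      obtain ⟨B, hB⟩ := hs
      obtain ⟨C, hC⟩ := ht
      exact ⟨max B C, fun X h => lt_max_iff.2 (h.imp (hB X) (hC X))⟩
    | mul s t hs ht =>
      obtain ⟨B, hB⟩ := hs
      obtain ⟨C, hC⟩ := ht
      exact ⟨max B C, fun X h => lt_max_iff.2 (h.imp (hB X) (hC X))⟩
    | len i => exact ⟨i + 1, fun X h => h ▸ Nat.lt_succ_self _⟩
  induction φ with
  | eqN s t | le s t =>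
    obtain ⟨B, hB⟩ := tm s
    obtain ⟨C, hC⟩ := tm t
    exact ⟨max B C, fun X h => lt_max_iff.2 (h.imp (hB X) (hC X))⟩
  | eqS i j => exact ⟨i + j + 1, fun X h => by rcases h with h | h <;> omega⟩
  | mem t i =>
    obtain ⟨B, hB⟩ := tm t
    exact ⟨max B (i + 1), fun X h => lt_max_iff.2 (h.imp (hB X) fun h => by omega)⟩
  | neg φ h => exact h
  | and φ ψ hφ hψ | or φ ψ hφ hψ =>
    obtain ⟨B, hB⟩ := hφ
    obtain ⟨C, hC⟩ := hψ
    exact ⟨max B C, fun X h => lt_max_iff.2 (h.imp (hB X) (hC X))⟩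
  | allN i φ h | exN i φ h => exact h
  | allS i φ h | exS i φ h =>
    obtain ⟨B, hB⟩ := h
    exact ⟨B, fun X h => hB X h.2⟩

theorem Tm.val_subst (t : Tm) (x : ℕ) (r : Tm) (e : ℕ → M.N) (E : ℕ → M.S) :
    (t.subst x r).val M e E = t.val M (Function.update e x (r.val M e E)) E := by
  induction t with
  | var i =>
    by_cases h : i = x
    · subst h; simp [Tm.subst, Tm.val]
    · simp [Tm.subst, Tm.val, h]
  | zero | one | len => rfl
  | add s t hs ht => exact congrArg₂ M.add hs ht
  | mul s t hs ht => exact congrArg₂ M.mul hs ht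

/-- The hypothesis `hr` says that the value of `r` depends on `x` alone, so quantifiers over other
variables cannot capture anything in `r`. -/
theorem Fml.holds_subst (φ : Fml) (x : ℕ) (r : Tm)
    (hr : ∀ (e e' : ℕ → M.N) (E E' : ℕ → M.S), e x = e' x → r.val M e E = r.val M e' E')
    (e : ℕ → M.N) (E : ℕ → M.S) :
    (φ.subst x r).Holds M e E ↔ φ.Holds M (Function.update e x (r.val M e E)) E := by
  induction φ generalizing e E with
  | eqN s t | le s t | mem s i => simp only [Fml.subst, Fml.Holds, Tm.val_subst]
  | eqS i j => rfl
  | neg φ h => exact not_congr (h e E)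
  | and φ ψ hφ hψ => exact and_congr (hφ e E) (hψ e E)
  | or φ ψ hφ hψ => exact or_congr (hφ e E) (hψ e E)
  | allN i φ h | exN i φ h =>
    by_cases hi : i = x
    · subst hi; simp [Fml.subst, Fml.Holds]
    · simp only [Fml.subst, if_neg hi, Fml.Holds, h]
      first | apply forall_congr' | apply exists_congr
      intro a
      rw [hr _ e E E (Function.update_of_ne (Ne.symm hi) _ _), Function.update_comm hi]
  | allS i φ h | exS i φ h =>
    simp only [Fml.subst, Fml.Holds, h]
    first | apply forall_congr' | apply exists_congr
    intro A
    rw [hr e e _ E rfl]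

section Model

variable [IsV1Model M]

/-- Comprehension for arbitrary Σ₀-definable predicates, with parameters held in the variables of
the world. -/
theorem exists_set_of_def {Q : M.N → Prop}
    (hQ : Def M IsSigma0 (fun g : PUnit.{u + 1} × M.N => Q g.2)) (c : M.N) :
    ∃ X, M.len X ≤ c ∧ ∀ y, y < c → (y ∈ X ↔ Q y) := by
  obtain ⟨A₀⟩ := M.nonempty
  obtain ⟨w, -, F, hF⟩ := hQ ⟨0, 0, fun _ => 0, fun _ => A₀⟩
  -- Variable `w.n` is reserved for the length bound and `w.n + 1` for the candidate element, so
  -- bound variables inside `φ` start at `w.n + 2`.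
  set φ : Fml := F ((), .var (w.n + 1)) (w.n + 2) w.s
  have ext : ∀ (y : M.N) (B : ℕ → M.S), (∀ i < w.s, B i = w.E i) →
      w.Ext ⟨w.n + 2, w.s, Function.update (Function.update w.e w.n c) (w.n + 1) y, B⟩ := by
    refine fun y B hB => ⟨by simp, le_rfl, fun i hi => ?_, hB⟩
    exact (Function.update_of_ne (by omega) _ _).trans (Function.update_of_ne (by omega) _ _)
  have key : ∀ (y : M.N) (B : ℕ → M.S), (∀ i < w.s, B i = w.E i) → IsSigma0 φ ∧
      (φ.Holds M (Function.update (Function.update w.e w.n c) (w.n + 1) y) B ↔ Q y) := by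
    intro y B hB
    refine hF _ (ext y B hB) ((), .var (w.n + 1)) (⟨⟩, y) ⟨trivial, ?_⟩ _ (.refl _)
    refine ⟨fun i hi => ?_, fun _ h => h.elim, Function.update_self ..⟩
    have : w.n + 1 = i := hi
    simp [← this]
  obtain ⟨B, hB⟩ := φ.exists_freeS_lt
  -- The index `max w.s B` avoids both the set parameters, which lie below `w.s`, and the free set
  -- variables of `φ`.
  have h := IsV1Model.models (M := M) (compAx w.n (w.n + 1) (max w.s B) φ)
    (.inr (.inl ⟨_, _, _, φ, (key 0 w.E fun _ _ => rfl).1, by omega,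
      fun h => absurd (hB _ h) (by simp), rfl⟩)) w.e w.E c
  obtain ⟨X, hX, hXφ⟩ := h
  refine ⟨X, ?_, fun y hy => ?_⟩
  · have h1 : M.len (Function.update w.E (max w.s B) X (max w.s B)) ≤
        Function.update w.e w.n c w.n := hX
    rwa [Function.update_self, Function.update_self] at h1
  · have h1 := Fml.holds_imp.1 (hXφ y) (by
      set e := Function.update (Function.update w.e w.n c) (w.n + 1) y with he
      have h1 : e (w.n + 1) = y := Function.update_self ..
      have h2 : e w.n = c :=
        (Function.update_of_ne (by omega) _ _).trans (Function.update_self ..)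
      change e (w.n + 1) ≤ e w.n ∧ e (w.n + 1) ≠ e w.n
      rwa [h1, h2])
    have h2 := (and_congr Fml.holds_imp Fml.holds_imp).1 h1
    have h3 := (key y (Function.update w.E (max w.s B) X) fun i hi =>
      Function.update_of_ne (by omega) _ _).2
    refine Iff.trans ?_ ((iff_def.2 h2).trans h3)
    simp [Fml.Holds, Tm.val]
    rfl

theorem induction_of_def {Q : M.N → Prop}
    (hQ : Def M IsSigma1 (fun g : PUnit.{u + 1} × M.N => Q g.2)) (h0 : Q 0)
    (hs : ∀ x, Q x → Q (x + 1)) (x : M.N) : Q x := by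
  obtain ⟨A₀⟩ := M.nonempty
  obtain ⟨w, -, F, hF⟩ := hQ ⟨0, 0, fun _ => 0, fun _ => A₀⟩
  set φ : Fml := F ((), .var w.n) (w.n + 1) w.s
  have key : ∀ y : M.N, IsSigma1 φ ∧ (φ.Holds M (Function.update w.e w.n y) w.E ↔ Q y) := by
    intro y
    exact hF _ (w.ext_pushN y) ((), .var w.n) (⟨⟩, y) ⟨trivial, denT_pushN w y⟩ _ (.refl _)
  have h := Fml.holds_imp.1 (IsV1Model.models (M := M) (indAx w.n φ)
    (.inr (.inr ⟨_, φ, (key 0).1, rfl⟩)) w.e w.E)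
  refine (key x).2.1 (h ⟨?_, fun y => Fml.holds_imp.2 fun hy => ?_⟩ x)
  · rw [Fml.holds_subst _ _ _ fun _ _ _ _ _ => rfl]
    exact (key 0).2.2 h0
  · rw [Fml.holds_subst]
    · have h2 : (Tm.var w.n + 1).val M (Function.update w.e w.n y) w.E = y + 1 :=
        congrArg (M.add · M.one) (Function.update_self ..)
      rw [h2, Function.update_idem]
      exact (key (y + 1)).2.2 (hs y ((key y).2.1 hy))
    · intro e e' E E' he
      exact congrArg (M.add · M.one) he

end Model


/-! ## Arithmetic in models of `V¹` -/

section Arithmetic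

variable [IsV1Model M]

/-- Each axiom is obtained by its position in the list `twoBasic`; evaluating the formula at this
assignment reduces definitionally. -/
theorem twoBasic_holds (i : ℕ) (hi : i < twoBasic.length) (x y : M.N) (X Y : M.S) :
    twoBasic[i].Holds M (fun k => if k = 0 then x else y) (fun k => if k = 0 then X else Y) :=
  IsV1Model.models _ (.inl (List.getElem_mem _)) _ _

variable (M) in
/-- Some element of the set sort. -/
noncomputable def Str.someSet : M.S := M.nonempty.some

theorem add_one_ne_zero' (x : M.N) : x + 1 ≠ 0 :=
  twoBasic_holds 0 (by decide) x 0 M.someSet M.someSet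

theorem add_one_inj' {x y : M.N} : x + 1 = y + 1 → x = y :=
  Fml.holds_imp.1 (twoBasic_holds 1 (by decide) x y M.someSet M.someSet)

theorem add_zero' (x : M.N) : x + 0 = x :=
  twoBasic_holds 2 (by decide) x 0 M.someSet M.someSet

theorem add_add_one' (x y : M.N) : x + (y + 1) = x + y + 1 :=
  twoBasic_holds 3 (by decide) x y M.someSet M.someSet

theorem mul_zero' (x : M.N) : x * 0 = 0 :=
  twoBasic_holds 4 (by decide) x 0 M.someSet M.someSet

theorem mul_add_one' (x y : M.N) : x * (y + 1) = x * y + x :=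
  twoBasic_holds 5 (by decide) x y M.someSet M.someSet

theorem le_antisymm' {x y : M.N} (h : x ≤ y) (h' : y ≤ x) : x = y :=
  Fml.holds_imp.1 (twoBasic_holds 6 (by decide) x y M.someSet M.someSet) ⟨h, h'⟩

theorem le_add_right' (x y : M.N) : x ≤ x + y :=
  twoBasic_holds 7 (by decide) x y M.someSet M.someSet

theorem zero_le' (x : M.N) : 0 ≤ x :=
  twoBasic_holds 8 (by decide) x 0 M.someSet M.someSet

theorem le_total' (x y : M.N) : x ≤ y ∨ y ≤ x :=
  twoBasic_holds 9 (by decide) x y M.someSet M.someSet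

theorem le_iff_lt_add_one' {x y : M.N} : x ≤ y ↔ x < y + 1 :=
  have h := twoBasic_holds 10 (by decide) x y M.someSet M.someSet
  ⟨Fml.holds_imp.1 h.1, Fml.holds_imp.1 h.2⟩

theorem exists_add_one_eq' {x : M.N} (hx : x ≠ 0) : ∃ y, M.add y M.one = x := by
  obtain ⟨y, hy⟩ := Fml.holds_imp.1 (twoBasic_holds 11 (by decide) x 0 M.someSet M.someSet) hx
  exact ⟨y, by simpa [Fml.Holds, Tm.val] using hy.2⟩

theorem lt_len_of_mem {y : M.N} {X : M.S} : y ∈ X → y < M.len X :=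
  Fml.holds_imp.1 (twoBasic_holds 12 (by decide) 0 y X X)

theorem induction_sigma0 {Q : M.N → Prop}
    (hQ : Def M IsSigma0 (fun g : PUnit.{u + 1} × M.N => Q g.2)) (h0 : Q 0)
    (hs : ∀ x, Q x → Q (x + 1)) (x : M.N) : Q x :=
  induction_of_def hQ.sigma1 h0 hs x

-- Semiring laws by Σ₀ induction

theorem zero_add' (x : M.N) : 0 + x = x := by
  refine induction_sigma0 (Q := fun x => 0 + x = x) (.eqT (.add (.const _) .last) .last)
    (add_zero' _) (fun x ih => ?_) x
  rw [add_add_one', ih]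

theorem add_assoc' (x y z : M.N) : x + y + z = x + (y + z) := by
  refine induction_sigma0 (Q := fun z => x + y + z = x + (y + z))
    (.eqT (.add (.const _) .last) (.add (.const _) (.add (.const _) .last))) ?_
    (fun z ih => ?_) z
  · rw [add_zero', add_zero']
  · rw [add_add_one', ih, add_add_one', add_add_one']

theorem one_add' (x : M.N) : 1 + x = x + 1 := by
  refine induction_sigma0 (Q := fun x => 1 + x = x + 1)
    (.eqT (.add (.const _) .last) (.add .last (.const _))) ?_ (fun x ih => ?_) x
  · rw [add_zero', zero_add']
  · rw [add_add_one', ih]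

theorem add_comm' (x y : M.N) : x + y = y + x := by
  refine induction_sigma0 (Q := fun y => x + y = y + x)
    (.eqT (.add (.const _) .last) (.add .last (.const _))) ?_ (fun y ih => ?_) y
  · rw [add_zero', zero_add']
  · rw [add_add_one', ih, add_assoc', ← one_add' x, ← add_assoc']

theorem zero_mul' (x : M.N) : 0 * x = 0 := by
  refine induction_sigma0 (Q := fun x => 0 * x = 0)
    (.eqT (.mul (.const _) .last) (.const _)) (mul_zero' _) (fun x ih => ?_) x
  rw [mul_add_one', ih, add_zero']

theorem add_one_mul' (x y : M.N) : (x + 1) * y = x * y + y := by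
  refine induction_sigma0 (Q := fun y => (x + 1) * y = x * y + y)
    (.eqT (.mul (.const _) .last) (.add (.mul (.const _) .last) .last)) ?_ (fun y ih => ?_) y
  · rw [mul_zero', mul_zero', add_zero']
  · rw [mul_add_one', mul_add_one', ih, add_assoc', add_assoc', ← add_assoc' y, ← add_assoc' x,
      add_comm' x y]

theorem mul_comm' (x y : M.N) : x * y = y * x := by
  refine induction_sigma0 (Q := fun y => x * y = y * x)
    (.eqT (.mul (.const _) .last) (.mul .last (.const _))) ?_ (fun y ih => ?_) y
  · rw [mul_zero', zero_mul']
  · rw [mul_add_one', ih, add_one_mul']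

theorem mul_add' (x y z : M.N) : x * (y + z) = x * y + x * z := by
  refine induction_sigma0 (Q := fun z => x * (y + z) = x * y + x * z)
    (.eqT (.mul (.const _) (.add (.const _) .last)) (.add (.const _) (.mul (.const _) .last))) ?_
    (fun z ih => ?_) z
  · rw [mul_zero', add_zero', add_zero']
  · rw [add_add_one', mul_add_one', mul_add_one', ih, add_assoc']

theorem mul_assoc' (x y z : M.N) : x * y * z = x * (y * z) := by
  refine induction_sigma0 (Q := fun z => x * y * z = x * (y * z))
    (.eqT (.mul (.const _) .last) (.mul (.const _) (.mul (.const _) .last))) ?_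
    (fun z ih => ?_) z
  · rw [mul_zero', mul_zero', mul_zero']
  · rw [mul_add_one', mul_add_one', ih, mul_add']

instance : CommSemiring M.N where
  add_assoc := add_assoc'
  zero_add := zero_add'
  add_zero := add_zero'
  add_comm := add_comm'
  left_distrib := mul_add'
  right_distrib x y z := by rw [mul_comm', mul_add', mul_comm' z x, mul_comm' z y]
  zero_mul := zero_mul'
  mul_zero := mul_zero'
  mul_assoc := mul_assoc'
  one_mul x := by
    have h := add_one_mul' (0 : M.N) x
    rwa [zero_add', zero_mul', zero_add'] at h
  mul_one x := by
    have h := mul_add_one' x (0 : M.N)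
    rwa [zero_add', mul_zero', zero_add'] at h
  mul_comm := mul_comm'
  nsmul := nsmulRec

-- Cancellation, order and truncated subtraction

theorem add_right_cancel_nat {x y z : M.N} : x + z = y + z → x = y := by
  refine induction_sigma0 (Q := fun z => x + z = y + z → x = y)
    (.imp (.eqT (.add (.const _) .last) (.add (.const _) .last)) (.const _)) ?_
    (fun z ih h => ?_) z
  · simp
  · rw [← add_assoc, ← add_assoc] at h
    exact ih (add_one_inj' h)

theorem exists_add_of_le' {x y : M.N} (h : x ≤ y) : ∃ z, y = x + z := by
  -- The redundant bound `z ≤ y` keeps the induction predicate Σ₀.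
  have key : x ≤ y → ∃ z, z ≤ y ∧ y = x + z := by
    refine induction_sigma0 (Q := fun y => x ≤ y → ∃ z, z ≤ y ∧ y = x + z)
      (.imp (.leT (.const _) .last) (.exLeT .last (.eqT (.lift .last)
        (.add (.const _) .last)))) ?_ (fun y ih h => ?_) y
    · exact fun h => ⟨0, zero_le' _, by rw [add_zero]; exact le_antisymm' (zero_le' _) h⟩
    · by_cases hxy : x = y + 1
      · exact ⟨0, zero_le' _, by rw [hxy, add_zero]⟩
      · obtain ⟨z, -, hz⟩ := ih (le_iff_lt_add_one'.2 ⟨h, hxy⟩)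
        have h1 : y + 1 = x + (z + 1) := by rw [hz, add_assoc]
        exact ⟨z + 1, by rw [h1, add_comm x]; exact le_add_right' _ _, h1⟩
  obtain ⟨z, -, hz⟩ := key h
  exact ⟨z, hz⟩

noncomputable instance : LinearOrder M.N where
  le_refl x := by simpa using le_add_right' x 0
  le_trans x y z h h' := by
    obtain ⟨a, rfl⟩ := exists_add_of_le' h
    obtain ⟨b, rfl⟩ := exists_add_of_le' h'
    rw [add_assoc]
    exact le_add_right' _ _
  le_antisymm x y := le_antisymm'
  le_total := le_total'
  lt_iff_le_not_ge x y :=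
    ⟨fun h => ⟨h.1, fun h' => h.2 (le_antisymm' h.1 h')⟩,
      fun h => ⟨h.1, fun h' => h.2 (by simpa [h'] using le_add_right' y 0)⟩⟩
  toDecidableLE := Classical.decRel _

theorem lt_add_one_iff' {x y : M.N} : x < y + 1 ↔ x ≤ y := le_iff_lt_add_one'.symm

theorem add_one_le_iff' {x y : M.N} : x + 1 ≤ y ↔ x < y := by
  rw [← not_lt, lt_add_one_iff', not_le]

theorem eq_zero_or_eq_add_one (x : M.N) : x = 0 ∨ ∃ y, x = y + 1 :=
  or_iff_not_imp_left.2 fun h => (exists_add_one_eq' h).imp fun _ => Eq.symm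

theorem mul_lt_mul_left_nat {a b c : M.N} (ha : 0 < a) (hbc : b < c) : a * b < a * c := by
  obtain ⟨d, rfl⟩ := exists_add_of_le' hbc.le
  refine lt_of_le_of_ne (mul_add a b d ▸ le_add_right' _ _) fun h => ?_
  rcases eq_zero_or_eq_add_one d with rfl | ⟨d, rfl⟩
  · exact hbc.ne (add_zero b).symm
  rcases eq_zero_or_eq_add_one a with rfl | ⟨a, rfl⟩
  · exact ha.ne rfl
  rw [mul_add, mul_add (a + 1) d, mul_one, ← add_assoc ((a + 1) * d)] at h
  refine add_one_ne_zero' ((a + 1) * d + a) (add_right_cancel_nat (z := (a + 1) * b) ?_).symm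
  rw [zero_add, add_comm _ ((a + 1) * b)]
  exact h

instance : IsStrictOrderedRing M.N where
  add_le_add_left a b h c := by
    obtain ⟨d, rfl⟩ := exists_add_of_le' h
    rw [add_right_comm]
    exact le_add_right' _ _
  le_of_add_le_add_left a b c h := by
    obtain ⟨d, hd⟩ := exists_add_of_le' h
    rw [add_assoc, add_comm a, add_comm a] at hd
    exact add_right_cancel_nat hd ▸ le_add_right' _ _
  zero_le_one := zero_le' 1
  exists_pair_ne := ⟨0 + 1, 0, add_one_ne_zero' 0⟩
  mul_lt_mul_of_pos_left a ha b c h := mul_lt_mul_left_nat ha h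
  mul_lt_mul_of_pos_right a ha b c h := by
    simpa only [mul_comm _ a] using mul_lt_mul_left_nat ha h

instance : CanonicallyOrderedAdd M.N where
  exists_add_of_le := exists_add_of_le'
  le_add_self a b := add_comm a b ▸ le_add_right' a b
  le_self_add := le_add_right'

/-- Truncated subtraction: the default value 0 is what `OrderedSub` requires when `b ≤ a` fails. -/
noncomputable instance : Sub M.N :=
  ⟨fun a b => if h : b ≤ a then (exists_add_of_le' h).choose else 0⟩

theorem add_sub_of_le' {a b : M.N} (h : b ≤ a) : b + (a - b) = a := by
  change b + (if h : b ≤ a then (exists_add_of_le' h).choose else 0) = a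
  rw [dif_pos h]
  exact (exists_add_of_le' h).choose_spec.symm

theorem sub_of_not_le' {a b : M.N} (h : ¬ b ≤ a) : a - b = 0 := dif_neg h

instance : OrderedSub M.N where
  tsub_le_iff_right a b c := by
    by_cases h : b ≤ a
    · conv_rhs => rw [← add_sub_of_le' h, add_comm]
      exact (add_le_add_iff_right b).symm
    · rw [sub_of_not_le' h]
      exact ⟨fun _ => (not_le.1 h).le.trans le_add_self, fun _ => zero_le⟩

/-! ## Pairs -/

/-- Product of consecutive numbers is even: passing from `x` to `x + 1` adds `2 (x + 1)`. This
provides the division by 2 in the pairing function. -/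
theorem exists_add_self_eq (x : M.N) : ∃ z, z + z = x * (x + 1) := by
  have key : ∃ z, z ≤ x * (x + 1) ∧ z + z = x * (x + 1) := by
    refine induction_sigma0 (Q := fun x => ∃ z, z ≤ x * (x + 1) ∧ z + z = x * (x + 1))
      (.exLeT (.mul .last (.add .last (.const _))) (.eqT (.add .last .last)
        (.mul (.lift .last) (.add (.lift .last) (.const _))))) ?_ (fun x ih => ?_) x
    · exact ⟨0, zero_le, by simp⟩
    · obtain ⟨z, -, hz⟩ := ih
      have h : z + (x + 1) + (z + (x + 1)) = (x + 1) * (x + 1 + 1) := by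
        calc _ = z + z + (x + 1) + (x + 1) := by ring
          _ = _ := by rw [hz]; ring
      exact ⟨_, h ▸ le_add_self, h⟩
  exact key.imp fun _ => And.right

/-- The value `2⟨x, y⟩`. -/
def dbl (x y : M.N) : M.N := (x + y) * (x + y + 1) + (y + y)

/-- The pairing function. -/
noncomputable def pair (x y : M.N) : M.N := (exists_add_self_eq (x + y)).choose + y

theorem pair_add_pair (x y : M.N) : pair x y + pair x y = dbl x y := by
  have h := (exists_add_self_eq (x + y)).choose_spec
  rw [dbl, ← h, pair]
  ring

theorem add_self_inj {x y : M.N} : x + x = y + y ↔ x = y := by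
  constructor
  · grind
  · rintro rfl; rfl

theorem eq_pair_iff {x y z : M.N} : z + z = dbl x y ↔ z = pair x y := by
  rw [← pair_add_pair, add_self_inj]

/-- On the diagonal of sum `s`, doubled codes lie in the interval from `s (s + 1)` up to but
excluding `(s + 1) (s + 2)`; these intervals are disjoint and increasing. -/
theorem dbl_lt_of_add_lt {x y x' y' : M.N} (h : x + y < x' + y') : dbl x y < dbl x' y' := by
  have h1 : dbl x y < (x + y + 1) * (x + y + 1 + 1) := by
    have e1 : (x + y + 1) * (x + y + 1 + 1) = dbl x y + ((x + x) + 1 + 1) := by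
      unfold dbl; ring
    rw [e1, ← add_assoc, lt_add_one_iff', add_assoc]
    exact le_self_add
  have h2 : (x + y + 1) * (x + y + 1 + 1) ≤ (x' + y') * (x' + y' + 1) := by
    have := add_one_le_iff'.2 h
    gcongr
  exact h1.trans_le (h2.trans le_self_add)

/-- The code determines the diagonal, and the position on the diagonal is the second component. -/
theorem pair_inj {x y x' y' : M.N} (h : pair x y = pair x' y') : x = x' ∧ y = y' := by
  have h1 : dbl x y = dbl x' y' := by rw [← pair_add_pair, ← pair_add_pair, h]
  have h2 : x + y = x' + y' := by
    by_contra hne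
    rcases lt_or_gt_of_ne hne with h' | h'
    · exact (dbl_lt_of_add_lt h').ne h1
    · exact (dbl_lt_of_add_lt h').ne h1.symm
  have h3 : y = y' := by
    rw [dbl, dbl, h2] at h1
    exact add_self_inj.1 (add_left_cancel h1)
  subst h3
  exact ⟨add_right_cancel h2, rfl⟩

theorem le_mul_self (x : M.N) : x ≤ x * x := by
  rcases eq_zero_or_eq_add_one x with rfl | ⟨y, rfl⟩
  · simp
  · calc y + 1 = (y + 1) * 1 := (mul_one _).symm
      _ ≤ _ := by gcongr; exact le_add_self

theorem le_pair_left (x y : M.N) : x ≤ pair x y := by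
  have h := pair_add_pair x y
  have h1 : dbl x y = x * x + x + ((x + x) * y + y * y + y + y + y) := by unfold dbl; ring
  have h2 := le_mul_self x
  have h3 : x + x ≤ dbl x y := by
    rw [h1]
    exact (add_le_add_left h2 x).trans le_self_add
  grind

theorem le_pair_right (x y : M.N) : y ≤ pair x y := le_add_self

theorem dbl_mono {x y x' y' : M.N} (hx : x ≤ x') (hy : y ≤ y') : dbl x y ≤ dbl x' y' := by
  unfold dbl
  gcongr

/-- Justifies the length bounds of the form `dblPair`: the doubled code is at most `dbl x' y'`,
which is positive because `y < y'`. -/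
theorem pair_lt_dbl {x y x' y' : M.N} (hx : x ≤ x') (hy : y < y') : pair x y < dbl x' y' := by
  have h1 := dbl_mono hx hy.le
  have h2 := pair_add_pair x y
  have h3 : y' ≤ dbl x' y' := le_add_self.trans le_add_self
  have h4 : 0 ≤ pair x y := zero_le
  have h5 : 0 ≤ y := zero_le
  grind

/-- Shows that the bound `fourSq` leaves room for all edges of a path or cycle. With `t = s + 1` the
sum is at most `2 s + 1`, since one component is strictly below `t`; hence the doubled code is at
most `4 t²`. -/
theorem pair_lt_fourSq {x y t : M.N} (hx : x ≤ t) (hy : y ≤ t) (hxy : x < t ∨ y < t) :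
    pair x y < (1 + 1 + 1 + 1) * (t * t) := by
  rcases eq_zero_or_eq_add_one t with rfl | ⟨s, rfl⟩
  · exact (hxy.elim not_lt_zero not_lt_zero).elim
  have h1 : x + y ≤ s + s + 1 := by
    rcases hxy with h | h <;> rw [lt_add_one_iff'] at h <;> grind
  have h2 : dbl x y ≤ (s + s + 1) * (s + s + 1 + 1) + (s + 1 + (s + 1)) := by
    unfold dbl; gcongr
  have h3 := pair_add_pair x y
  have h4 : (0 : M.N) < (s + 1) * (s + 1) :=
    mul_pos (lt_add_one_iff'.2 zero_le) (lt_add_one_iff'.2 zero_le)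
  have h5 : (s + s + 1) * (s + s + 1 + 1) + (s + 1 + (s + 1)) =
      (1 + 1 + 1 + 1) * ((s + 1) * (s + 1)) := by ring
  have h6 : (1 + 1 + 1 + 1) * ((s + 1) * (s + 1)) = (s + 1) * (s + 1) + (s + 1) * (s + 1) +
      (s + 1) * (s + 1) + (s + 1) * (s + 1) := by ring
  rw [h5, h6, ← h3] at h2
  rw [h6]
  clear h5 h6 h3
  generalize (s + 1) * (s + 1) = T at *
  grind

end Arithmetic


/-! ## Definable functions -/

section DefF

variable {Γ Δ : Type u} [Ctx M Γ] [Ctx M Δ]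

/-- The relation `P` is `Σ^{1,b}_0`-definable with parameters. -/
abbrev Def0 (M : Str.{u}) {Γ : Type u} [Ctx M Γ] (P : Γ → Prop) : Prop := Def M IsSigma0 P

/-- The function `f` is bounded by a term and has a `Σ^{1,b}_0`-definable graph. -/
def DefF (f : Γ → M.N) : Prop :=
  Def0 M (fun g : Γ × M.N => g.2 = f g.1) ∧ ∃ b : Γ → M.N, DefT b ∧ ∀ g, f g ≤ b g

theorem DefT.defF [IsV1Model M] {f : Γ → M.N} (hf : DefT f) : DefF f :=
  ⟨.eqT .last hf.lift, f, hf, fun _ => le_rfl⟩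

theorem DefF.const [IsV1Model M] (c : M.N) : DefF (fun _ : Γ => c) := (DefT.const c).defF

theorem DefF.last [IsV1Model M] : DefF (fun g : Γ × M.N => g.2) := DefT.last.defF

theorem DefF.lift {f : Γ → M.N} (hf : DefF f) : DefF (fun g : Γ × Δ => f g.1) :=
  ⟨hf.1.reindex (fun g : (Γ × Δ) × M.N => (g.1.1, g.2)) (fun r => (r.1.1, r.2))
    fun _ _ _ h => ⟨h.1.1, h.2⟩, _, hf.2.choose_spec.1.lift, fun g => hf.2.choose_spec.2 g.1⟩

theorem DefF.len [IsV1Model M] {A : Γ → M.S} (hA : DefS A) : DefF (fun g => M.len (A g)) :=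
  (DefT.len hA).defF

/-- A function value is replaced by a quantifier over its graph, and the bounding term makes that
quantifier bounded. Non-term functions such as `pair` and `ev` can thus be used inside Σ₀ relations.
-/
theorem Def.comp {P : Γ → M.N → Prop} {f : Γ → M.N}
    (hP : Def0 M (fun g : Γ × M.N => P g.1 g.2)) (hf : DefF f) :
    Def0 M (fun g => P g (f g)) := by
  obtain ⟨h1, b, hb, hfb⟩ := hf
  refine (Def.exLeT (P := fun g x => x = f g ∧ P g x) hb (h1.and hP)).congr fun g => ?_
  exact ⟨fun ⟨x, _, hx, h⟩ => hx ▸ h, fun h => ⟨_, hfb g, rfl, h⟩⟩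

theorem Def.eq {f h : Γ → M.N} (hf : DefF f) (hh : DefF h) : Def0 M (fun g => f g = h g) :=
  Def.comp (P := fun g x => x = h g) hh.1 hf

theorem Def.swapLast {P : Γ → M.N → Prop} (hP : Def0 M (fun g : Γ × M.N => P g.1 g.2)) :
    Def0 M (fun g : (Γ × M.N) × M.N => P g.1.1 g.2) :=
  hP.reindex (fun g : (Γ × M.N) × M.N => (g.1.1, g.2)) (fun r => (r.1.1, r.2))
    fun _ _ _ h => ⟨h.1.1, h.2⟩

theorem Def.lift {P : Γ → Prop} (hP : Def0 M P) : Def0 M (fun g : Γ × Δ => P g.1) :=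
  hP.reindex (fun g : Γ × Δ => g.1) (fun r => r.1) fun _ _ _ h => h.1

theorem Def.le {f h : Γ → M.N} (hf : DefF f) (hh : DefF h) : Def0 M (fun g => f g ≤ h g) :=
  Def.comp (P := fun g x => x ≤ h g)
    (Def.comp (P := fun (g : Γ × M.N) y => g.2 ≤ y) (.leT (DefT.last.lift) .last) hh.lift) hf

theorem Def.allLe {f : Γ → M.N} {P : Γ → M.N → Prop} (hf : DefF f)
    (hP : Def0 M (fun g : Γ × M.N => P g.1 g.2)) :
    Def0 M (fun g => ∀ x, x ≤ f g → P g x) :=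
  Def.comp (P := fun g y => ∀ x, x ≤ y → P g x)
    (.allLeT (P := fun (g : Γ × M.N) x => P g.1 x) .last hP.swapLast) hf

theorem Def.exLe {f : Γ → M.N} {P : Γ → M.N → Prop} (hf : DefF f)
    (hP : Def0 M (fun g : Γ × M.N => P g.1 g.2)) :
    Def0 M (fun g => ∃ x, x ≤ f g ∧ P g x) :=
  Def.comp (P := fun g y => ∃ x, x ≤ y ∧ P g x)
    (.exLeT (P := fun (g : Γ × M.N) x => P g.1 x) .last hP.swapLast) hf

theorem Def.mem {f : Γ → M.N} {A : Γ → M.S} (hf : DefF f) (hA : DefS A) :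
    Def0 M (fun g => f g ∈ A g) :=
  Def.comp (P := fun g x => x ∈ A g) (.memT .last hA.lift) hf

section SetVariables

variable {Γ₁ Γ₂ Γ₃ : Type u} [Ctx M Γ₁] [Ctx M Γ₂] [Ctx M Γ₃]

/-- De Bruijn access to a context: `vk` is the variable with `k` later binders above it. -/
theorem DefS.v0 : DefS (fun g : Γ × M.S => g.2) := .last
theorem DefS.v1 : DefS (fun g : (Γ × M.S) × Γ₁ => g.1.2) := v0.lift
theorem DefS.v2 : DefS (fun g : ((Γ × M.S) × Γ₁) × Γ₂ => g.1.1.2) := v1.lift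
theorem DefS.v3 : DefS (fun g : (((Γ × M.S) × Γ₁) × Γ₂) × Γ₃ => g.1.1.1.2) := v2.lift

end SetVariables

variable [IsV1Model M]

theorem Def.lt {f h : Γ → M.N} (hf : DefF f) (hh : DefF h) : Def0 M (fun g => f g < h g) :=
  ((Def.le hf hh).and (Def.eq hf hh).not).congr fun _ => lt_iff_le_and_ne.symm

theorem Def.allLt {f : Γ → M.N} {P : Γ → M.N → Prop} (hf : DefF f)
    (hP : Def0 M (fun g : Γ × M.N => P g.1 g.2)) :
    Def0 M (fun g => ∀ x, x < f g → P g x) :=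
  (Def.allLe (P := fun g x => x < f g → P g x) hf ((Def.lt .last hf.lift).imp hP)).congr
    fun _ => ⟨fun h x hx => h x hx.le hx, fun h x _ hx => h x hx⟩

theorem Def.exLt {f : Γ → M.N} {P : Γ → M.N → Prop} (hf : DefF f)
    (hP : Def0 M (fun g : Γ × M.N => P g.1 g.2)) :
    Def0 M (fun g => ∃ x, x < f g ∧ P g x) :=
  (Def.exLe (P := fun g x => x < f g ∧ P g x) hf ((Def.lt .last hf.lift).and hP)).congr
    fun _ => ⟨fun ⟨x, _, h⟩ => ⟨x, h⟩, fun ⟨x, h⟩ => ⟨x, h.1.le, h⟩⟩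

theorem DefF.add {f h : Γ → M.N} (hf : DefF f) (hh : DefF h) : DefF (fun g => f g + h g) :=
  ⟨Def.comp (P := fun (g : Γ × M.N) x => g.2 = x + h g.1)
    (Def.comp (P := fun (g : (Γ × M.N) × M.N) y => g.1.2 = g.2 + y)
      (.eqT DefT.last.lift.lift (.add DefT.last.lift .last)) hh.lift.lift) hf.lift,
    _, hf.2.choose_spec.1.add hh.2.choose_spec.1,
    fun g => add_le_add (hf.2.choose_spec.2 g) (hh.2.choose_spec.2 g)⟩

theorem DefF.mul {f h : Γ → M.N} (hf : DefF f) (hh : DefF h) : DefF (fun g => f g * h g) :=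
  ⟨Def.comp (P := fun (g : Γ × M.N) x => g.2 = x * h g.1)
    (Def.comp (P := fun (g : (Γ × M.N) × M.N) y => g.1.2 = g.2 * y)
      (.eqT DefT.last.lift.lift (.mul DefT.last.lift .last)) hh.lift.lift) hf.lift,
    _, hf.2.choose_spec.1.mul hh.2.choose_spec.1,
    fun g => mul_le_mul' (hf.2.choose_spec.2 g) (hh.2.choose_spec.2 g)⟩

/-- A function is definable if it has a definable graph and is bounded by a definable function. -/
theorem DefF.of_graph {f h : Γ → M.N} {G : Γ → M.N → Prop}
    (hG : Def0 M (fun g : Γ × M.N => G g.1 g.2)) (hf : ∀ g y, G g y ↔ y = f g)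
    (hh : DefF h) (hle : ∀ g, f g ≤ h g) : DefF f :=
  ⟨hG.congr fun g => hf g.1 g.2, _, hh.2.choose_spec.1,
    fun g => (hle g).trans (hh.2.choose_spec.2 g)⟩

theorem DefF.pair {f h : Γ → M.N} (hf : DefF f) (hh : DefF h) : DefF (fun g => pair (f g) (h g)) :=
  .of_graph (G := fun g y => y + y = (f g + h g) * (f g + h g + 1) + (h g + h g))
    (h := fun g => (f g + h g) * (f g + h g + 1) + (h g + h g))
    (.eq (.add .last .last) (.lift
      (f := fun g => (f g + h g) * (f g + h g + 1) + (h g + h g)) (.add (.mul (.add hf hh) (.add (.add hf hh) (.const 1)))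
      (.add hh hh)))) (fun _ _ => eq_pair_iff)
    (.add (.mul (.add hf hh) (.add (.add hf hh) (.const 1))) (.add hh hh))
    fun g => (le_self_add (b := BA.pair (f g) (h g))).trans (pair_add_pair _ _).le

theorem DefF.sub {f h : Γ → M.N} (hf : DefF f) (hh : DefF h) : DefF (fun g => f g - h g) :=
  .of_graph (G := fun g y => (h g ≤ f g ∧ h g + y = f g) ∨ (¬ h g ≤ f g ∧ y = 0))
    (((Def.le hh hf).lift.and (.eq (.add hh.lift .last) hf.lift)).or
      ((Def.le hh hf).lift.not.and (.eq .last (.const 0))))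
    (fun g y => by
      by_cases hle : h g ≤ f g
      · simp only [hle, true_and, not_true, false_and, or_false]
        exact ⟨fun e => add_left_cancel (e.trans (add_sub_of_le' hle).symm),
          fun e => e ▸ add_sub_of_le' hle⟩
      · simp [hle, sub_of_not_le' hle]) hf fun g => tsub_le_self

theorem DefF.ite {P : Γ → Prop} [∀ g, Decidable (P g)] {f h : Γ → M.N} (hP : Def0 M P)
    (hf : DefF f) (hh : DefF h) : DefF (fun g => if P g then f g else h g) :=
  .of_graph (G := fun g y => (P g ∧ y = f g) ∨ (¬ P g ∧ y = h g)) (h := fun g => f g + h g)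
    ((hP.lift.and (.eq .last hf.lift)).or (hP.lift.not.and (.eq .last hh.lift)))
    (fun g y => by by_cases h : P g <;> simp [h]) (hf.add hh)
    fun _ => by split <;> simp

open Classical in
/-- The value at `p` of the function with graph `G`. -/
noncomputable def ev (G : M.S) (p : M.N) : M.N :=
  if h : ∃ y, pair p y ∈ G ∧ ∀ y', pair p y' ∈ G → y' = y then h.choose else 0

theorem ev_eq {G : M.S} {p y : M.N} (h : pair p y ∈ G) (h' : ∀ y', pair p y' ∈ G → y' = y) :
    ev G p = y := by
  have hex : ∃ y, pair p y ∈ G ∧ ∀ y', pair p y' ∈ G → y' = y := ⟨y, h, h'⟩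
  rw [ev, dif_pos hex]
  exact h' _ hex.choose_spec.1

theorem lt_len_of_pair_mem {G : M.S} {p y : M.N} (h : pair p y ∈ G) : y < M.len G :=
  (le_pair_right p y).trans_lt (lt_len_of_mem h)

theorem ev_le (G : M.S) (p : M.N) : ev G p ≤ M.len G := by
  rw [ev]
  split
  · next h => exact (lt_len_of_pair_mem h.choose_spec.1).le
  · exact zero_le

/-- Both cases in the definition of `ev` can be tested with quantifiers bounded by the length of
`G`, because every second component is below it. This makes the graph of `ev` Σ₀. -/
theorem eq_ev_iff (G : M.S) (p y : M.N) :
    (pair p y ∈ G ∧ ∀ y' < M.len G, pair p y' ∈ G → y' = y) ∨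
      (¬ (∃ z < M.len G, pair p z ∈ G ∧ ∀ y' < M.len G, pair p y' ∈ G → y' = z) ∧ y = 0) ↔
      y = ev G p := by
  have key : ∀ z, (∀ y' < M.len G, pair p y' ∈ G → y' = z) ↔ ∀ y', pair p y' ∈ G → y' = z :=
    fun z => ⟨fun h y' hy => h y' (lt_len_of_pair_mem hy) hy, fun h y' _ hy => h y' hy⟩
  simp only [key]
  by_cases hex : ∃ z, pair p z ∈ G ∧ ∀ y', pair p y' ∈ G → y' = z
  · obtain ⟨z, hz, hz'⟩ := hex
    rw [ev_eq hz hz']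
    constructor
    · rintro (h | h)
      · exact hz' _ h.1
      · exact absurd ⟨z, lt_len_of_pair_mem hz, hz, hz'⟩ h.1
    · rintro rfl
      exact .inl ⟨hz, hz'⟩
  · rw [ev, dif_neg hex]
    constructor
    · rintro (h | h)
      · exact absurd ⟨y, h⟩ hex
      · exact h.2
    · exact fun h => .inr ⟨fun ⟨z, _, hz⟩ => hex ⟨z, hz⟩, h⟩

theorem DefF.ev {A : Γ → M.S} {f : Γ → M.N} (hA : DefS A) (hf : DefF f) :
    DefF (fun g => ev (A g) (f g)) :=
  .of_graph
    (((Def.mem (.pair hf.lift .last) hA.lift).and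
      (.allLt (.len hA.lift) (.imp (.mem (.pair hf.lift.lift .last) hA.lift.lift)
        (.eq .last (DefF.last).lift)))).or
      ((Def.exLt (.len hA.lift) (.and (.mem (.pair hf.lift.lift .last) hA.lift.lift)
        (.allLt (.len hA.lift.lift) (.imp (.mem (.pair hf.lift.lift.lift .last) hA.lift.lift.lift)
          (.eq .last (DefF.last).lift))))).not.and (.eq .last (.const 0))))
    (fun g y => eq_ev_iff (A g) (f g) y) (.len hA) fun _ => ev_le _ _

section Variables

variable {Γ₁ Γ₂ Γ₃ : Type u} [Ctx M Γ₁] [Ctx M Γ₂] [Ctx M Γ₃]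

theorem DefF.v0 : DefF (fun g : Γ × M.N => g.2) := .last
theorem DefF.v1 : DefF (fun g : (Γ × M.N) × Γ₁ => g.1.2) := v0.lift
theorem DefF.v2 : DefF (fun g : ((Γ × M.N) × Γ₁) × Γ₂ => g.1.1.2) := v1.lift
theorem DefF.v3 : DefF (fun g : (((Γ × M.N) × Γ₁) × Γ₂) × Γ₃ => g.1.1.1.2) := v2.lift
end Variables

end DefF

/-! ## Coding functions by sets -/

section Coding

variable [IsV1Model M]

/-- Below `t`, the set `G` is the graph of a function. -/
def IsGraph (G : M.S) (t : M.N) : Prop := ∀ p ≤ t, ∀ y, pair p y ∈ G ↔ y = ev G p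

/-- Uniqueness is asked only below `B`: the coding set collects only pairs with second component
below `B`, so other solutions of `Q` do no harm. -/
theorem exists_code {Q : M.N → M.N → Prop}
    (hQ : Def0 M (fun g : (PUnit.{u + 1} × M.N) × M.N => Q g.1.2 g.2)) (t B : M.N)
    (h : ∀ p ≤ t, ∃ y < B, Q p y ∧ ∀ y' < B, Q p y' → y' = y) :
    ∃ G, M.len G ≤ dbl t B ∧ IsGraph G t ∧ ∀ p ≤ t, ev G p < B ∧ Q p (ev G p) := by
  obtain ⟨G, hG, hGQ⟩ := exists_set_of_def
    (Q := fun z => ∃ p ≤ t, ∃ y < B, z = pair p y ∧ Q p y)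
    (.exLe (.const t) (.exLt (.const B) (.and (.eq .v2 (.pair .v1 .v0))
      (hQ.reindex (fun g : ((PUnit.{u + 1} × M.N) × M.N) × M.N => ((⟨⟩, g.1.2), g.2))
        (fun r => (((), r.1.2), r.2)) fun _ _ _ h => ⟨⟨trivial, h.1.2⟩, h.2⟩)))) (dbl t B)
  have key : ∀ p ≤ t, ∀ y, pair p y ∈ G ↔ y < B ∧ Q p y := by
    intro p hp y
    constructor
    · intro hy
      obtain ⟨p', hp', y', hy', he, hq⟩ := (hGQ _ ((lt_len_of_mem hy).trans_le hG)).1 hy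
      obtain ⟨rfl, rfl⟩ := pair_inj he
      exact ⟨hy', hq⟩
    · rintro ⟨hy, hq⟩
      exact (hGQ _ (pair_lt_dbl hp hy)).2 ⟨p, hp, y, hy, rfl, hq⟩
  have key' : ∀ p ≤ t, ev G p < B ∧ Q p (ev G p) ∧ ∀ y, pair p y ∈ G ↔ y = ev G p := by
    intro p hp
    obtain ⟨y, hy, hq, hy'⟩ := h p hp
    have h1 : pair p y ∈ G := (key p hp y).2 ⟨hy, hq⟩
    have h2 : ∀ y', pair p y' ∈ G → y' = y := fun y' h =>
      hy' y' ((key p hp y').1 h).1 ((key p hp y').1 h).2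
    rw [ev_eq h1 h2]
    exact ⟨hy, hq, fun y' => ⟨h2 y', fun e => e ▸ h1⟩⟩
  exact ⟨G, hG, fun p hp => (key' p hp).2.2, fun p hp => ⟨(key' p hp).1, (key' p hp).2.1⟩⟩

theorem exists_code_fun {f : M.N → M.N} (hf : DefF (fun g : PUnit.{u + 1} × M.N => f g.2))
    (t B : M.N) (h : ∀ p ≤ t, f p < B) :
    ∃ G, M.len G ≤ dbl t B ∧ IsGraph G t ∧ ∀ p ≤ t, ev G p = f p := by
  obtain ⟨G, hG, hGg, hGQ⟩ := exists_code (Q := fun p y => y = f p) hf.1 t B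
    fun p hp => ⟨_, h p hp, rfl, fun _ _ h => h⟩
  exact ⟨G, hG, hGg, fun p hp => (hGQ p hp).2⟩

/-- The pigeonhole principle. -/
theorem exists_ne_ev_eq {G : M.S} {a : M.N} (h : ∀ p ≤ a, ev G p < a) :
    ∃ p q, p < q ∧ q ≤ a ∧ ev G p = ev G q := by
  classical
  by_contra hcon
  have inj₀ : ∀ p ≤ a, ∀ q ≤ a, ev G p = ev G q → p = q := by
    intro p hp q hq he
    by_contra hne
    rcases lt_or_gt_of_ne hne with hlt | hlt
    · exact hcon ⟨p, q, hlt, hq, he⟩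
    · exact hcon ⟨q, p, hlt, hp, he.symm⟩
  obtain ⟨G₀, hG₀, -, hG₀G⟩ := exists_code_fun (f := fun p => ev G p) (.ev (.const G) .v0) a a h
  -- Descent on the size of an injection: after `x` steps there is an injection from `{0, …, k}`
  -- into `{0, …, k - 1}` with `k + x = a`. The existential over the code `F` makes this Σ₁, and `x
  -- = a + 1` is impossible.
  have key := induction_of_def (Q := fun x => ∃ F, M.len F ≤ dbl a a ∧ ∃ k ≤ a, k + x = a ∧
      (∀ p ≤ k, ev F p < k) ∧ ∀ p ≤ k, ∀ q ≤ k, ev F p = ev F q → p = q)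
    (.exSetLeT (.const _) (.sigma1 (.exLe (.const a) (.and (.eq (.add .v0 .v2) (.const a))
      (.and (.allLe .v0 (.lt (.ev .v2 .v0) .v1))
        (.allLe .v0 (.allLe .v1 (.imp (.eq (.ev .v3 .v1) (.ev .v3 .v0)) (.eq .v1 .v0))))))))) ?_ ?_
  · obtain ⟨F, -, k, -, hk, -⟩ := key (a + 1)
    have : a + 1 ≤ a := (le_add_self (b := k)).trans hk.le
    exact absurd this (not_le.2 (lt_add_one_iff'.2 le_rfl))
  · refine ⟨G₀, hG₀, a, le_rfl, add_zero a, fun p hp => by rw [hG₀G p hp]; exact h p hp,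
      fun p hp q hq he => inj₀ p hp q hq ?_⟩
    rwa [hG₀G p hp, hG₀G q hq] at he
  · rintro x ⟨F, -, k, hka, hkx, hlt, hinj⟩
    rcases eq_zero_or_eq_add_one k with rfl | ⟨k, rfl⟩
    · exact (not_lt_zero (hlt 0 le_rfl)).elim
    have hk : k ≤ k + 1 := le_self_add
    have hkk : k < k + 1 := lt_add_one_iff'.2 le_rfl
    -- Drop the argument `k + 1` and reroute its value to the argument, if any, whose value is the
    -- forbidden `k`; injectivity persists because the value at `k + 1` is used nowhere else.
    have hf : ∀ p ≤ k, (if ev F p = k then ev F (k + 1) else ev F p) < k := by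
      intro p hp
      split
      · next he =>
        refine lt_of_le_of_ne (lt_add_one_iff'.1 (hlt _ le_rfl)) fun he' => ?_
        exact (hp.trans_lt hkk).ne (hinj p (hp.trans hk) _ le_rfl (he.trans he'.symm))
      · next he => exact lt_of_le_of_ne (lt_add_one_iff'.1 (hlt _ (hp.trans hk))) he
    obtain ⟨F', hF', -, hF'F⟩ := exists_code_fun
      (f := fun p => if ev F p = k then ev F (k + 1) else ev F p)
      (.ite (.eq (.ev (.const F) .v0) (.const k)) (.const _) (.ev (.const F) .v0)) k k hf
    have hka' := hk.trans hka
    refine ⟨F', hF'.trans (dbl_mono hka' hka'), k, hka', by rw [← hkx]; ring,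
      fun p hp => by rw [hF'F p hp]; exact hf p hp, fun p hp q hq he => ?_⟩
    rw [hF'F p hp, hF'F q hq] at he
    have h1 := hp.trans hk
    have h2 := hq.trans hk
    have h3 : ∀ r ≤ k, ev F (k + 1) ≠ ev F r := fun r hr he =>
      (hr.trans_lt hkk).ne (hinj _ le_rfl r (hr.trans hk) he).symm
    split at he <;> split at he
    · next e1 e2 => exact hinj p h1 q h2 (e1.trans e2.symm)
    · exact absurd he (h3 q hq)
    · exact absurd he.symm (h3 p hp)
    · exact hinj p h1 q h2 he

end Coding


/-! ## Meaning of the formulas about operations -/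

theorem DenT.dblPair {w : World M} {s t : Tm} {a b : M.N} (hs : DenT w s a) (ht : DenT w t b) :
    DenT w (dblPair s t) (dbl a b) :=
  ((hs.add ht).mul ((hs.add ht).add (.one w))).add (ht.add ht)

theorem DenT.fourSq {w : World M} {t : Tm} {a : M.N} (ht : DenT w t a) :
    DenT w (fourSq t) ((1 + 1 + 1 + 1) * (a * a)) :=
  ((((DenT.one w).add (.one w)).add (.one w)).add (.one w)).mul (ht.mul ht)

/-- The element `⟨a₁, …, a_k⟩` for a list of elements. -/
noncomputable def tuple [IsV1Model M] : List M.N → M.N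
  | [] => 0
  | a :: as => as.foldl pair a

/-- `F(v) = y` -/
def App [IsV1Model M] {m : ℕ} (F : M.S) (v : Fin m → M.N) (y : M.N) : Prop :=
  tuple (List.ofFn v ++ [y]) ∈ F

/-- `F` is an `m`-ary operation on `R`. -/
def IsOp [IsV1Model M] (m : ℕ) (F : M.S) (R : M.N → Prop) : Prop :=
  ∀ v : Fin m → M.N, (∀ k, R (v k)) → (∃ y, R y ∧ App F v y) ∧
    ∀ y₁, R y₁ → ∀ y₂, R y₂ → App F v y₁ ∧ App F v y₂ → y₁ = y₂

/-- `F` is an `m`-ary operation on `R` that preserves the unary relation `P`. -/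
def Pol1 [IsV1Model M] (m : ℕ) (F : M.S) (R P : M.N → Prop) : Prop :=
  IsOp m F R ∧ ∀ v : Fin m → M.N, (∀ k, R (v k)) → ∀ b, R b → (∀ k, P (v k)) ∧ App F v b → P b

/-- `F` is an `m`-ary operation on `R` that preserves the binary relation `P`. -/
def Pol2 [IsV1Model M] (m : ℕ) (F : M.S) (R : M.N → Prop) (P : M.N → M.N → Prop) : Prop :=
  IsOp m F R ∧ ∀ v : Fin m → M.N, (∀ k, R (v k)) → ∀ v' : Fin m → M.N, (∀ k, R (v' k)) →
    ∀ b, R b → ∀ b', R b' → (∀ k, P (v k) (v' k)) ∧ App F v b ∧ App F v' b' → P b b'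

/-- `P` is a congruence of the algebra `(R, F)`. -/
def IsCong [IsV1Model M] (m : ℕ) (R : M.N → Prop) (F : M.S) (P : M.N → M.N → Prop) : Prop :=
  Pol2 m F R P ∧ (∀ a, R a → P a a) ∧ (∀ a, R a → ∀ b, R b → (P a b ↔ P b a)) ∧
    ∀ a, R a → ∀ b, R b → ∀ c, R c → P a b ∧ P b c → P a c

/-- The domain `D` denotes the set `R`. -/
def DenD (K : Fml → Prop) (w : World M) (D : Dom) (R : M.N → Prop) : Prop :=
  ∃ (b : M.N) (q : M.N → Prop), DenT w D.bound b ∧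
    (∀ w' u x, w.Ext w' → DenT w' u x → Den K w' (D.mem u) (q x)) ∧ ∀ x, R x ↔ x < b ∧ q x

theorem DenD.mono {K : Fml → Prop} {w w' : World M} (h : w.Ext w') {D : Dom} {R : M.N → Prop}
    (hD : DenD K w D R) : DenD K w' D R :=
  let ⟨b, q, hb, hq, hR⟩ := hD
  ⟨b, q, hb.mono h, fun _ _ _ hw hu => hq _ _ _ (h.trans hw) hu, hR⟩

section Operations

variable {K : Fml → Prop} [BoundedClosed K] {w : World M}

theorem Den.allIn {D : Dom} {R : M.N → Prop} {f : Tm → Bld} {p : M.N → Prop} (hD : DenD K w D R)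
    (hf : ∀ x w' u, w.Ext w' → DenT w' u x → Den K w' (f u) (p x)) :
    Den K w (allIn D f) (∀ x, R x → p x) :=
  let ⟨_, q, hb, hq, hR⟩ := hD
  (Den.allLt (p := fun x => q x → p x) hb
    fun x w' u hw hu => (hq w' u x hw hu).imp (hf x w' u hw hu)).congr
    (forall_congr' fun x => by rw [hR, and_imp])

theorem Den.exIn {D : Dom} {R : M.N → Prop} {f : Tm → Bld} {p : M.N → Prop} (hD : DenD K w D R)
    (hf : ∀ x w' u, w.Ext w' → DenT w' u x → Den K w' (f u) (p x)) :
    Den K w (exIn D f) (∃ x, R x ∧ p x) :=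
  let ⟨_, q, hb, hq, hR⟩ := hD
  (Den.exLt (p := fun x => q x ∧ p x) hb
    fun x w' u hw hu => (hq w' u x hw hu).and (hf x w' u hw hu)).congr
    (exists_congr fun x => by rw [hR, and_assoc])

/-- The arity is a standard number, so quantification over vectors unfolds by induction outside the
model. -/
theorem Den.allVec {D : Dom} {R : M.N → Prop} (m : ℕ) (hD : DenD K w D R)
    {f : (Fin m → Tm) → Bld} {p : (Fin m → M.N) → Prop}
    (hf : ∀ v w' us, w.Ext w' → (∀ k, DenT w' (us k) (v k)) → Den K w' (f us) (p v)) :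
    Den K w (allVec D m f) (∀ v : Fin m → M.N, (∀ k, R (v k)) → p v) := by
  induction m generalizing w with
  | zero =>
    refine (hf Fin.elim0 w Fin.elim0 (.refl w) fun k => k.elim0).congr ?_
    exact ⟨fun h v _ => Subsingleton.elim Fin.elim0 v ▸ h, fun h => h _ fun k => k.elim0⟩
  | succ m ih =>
    refine (Den.allIn (f := fun x => BA.allVec D m fun xs => f (Fin.cons x xs))
      (p := fun x => ∀ v : Fin m → M.N, (∀ k, R (v k)) → p (Fin.cons x v)) hD
      fun x w' u hw hu => ih (hD.mono hw) fun v w'' us hw' hus =>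
        hf _ _ _ (hw.trans hw') fun k => ?_).congr ?_
    · cases k using Fin.cases with
      | zero => exact hu.mono hw'
      | succ k => exact hus k
    · constructor
      · intro h v hv
        have := h (v 0) (hv 0) (fun k => v k.succ) fun k => hv k.succ
        rwa [show (Fin.cons (v 0) fun k => v k.succ) = v from Fin.cons_self_tail v] at this
      · intro h x hx v hv
        exact h _ fun k => by
          cases k using Fin.cases with
          | zero => exact hx
          | succ k => exact hv k

theorem DenD.below {t : Tm} {a : M.N} (ht : DenT w t a) : DenD K w (below t) (· < a) :=
  ⟨_, (· < a), ht, fun _ _ _ hw hu => .lt hu (ht.mono hw), fun _ => (and_self_iff).symm⟩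

variable [IsV1Model M]

theorem DenD.setDom {X : ℕ} {A : M.S} (hX : DenS w X A) : DenD K w (setDom X) (· ∈ A) :=
  ⟨_, (· ∈ A), .len hX, fun _ _ _ hw hu => .mem hu (hX.mono hw),
    fun _ => ⟨fun h => ⟨lt_len_of_mem h, h⟩, And.right⟩⟩

theorem Den.isPair {r s t : Tm} {c a b : M.N} (hr : DenT w r c) (hs : DenT w s a)
    (ht : DenT w t b) : Den K w (isPair r s t) (c = pair a b) :=
  (Den.eq (hr.add hr) (hs.dblPair ht)).congr eq_pair_iff

theorem le_foldl_pair (as : List M.N) (c : M.N) : c ≤ as.foldl pair c := by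
  induction as generalizing c with
  | nil => exact le_rfl
  | cons a as ih => exact (le_pair_left c a).trans (ih _)

/-- The bounds on the intermediate codes lose nothing: a code is at most every longer code built
from it, and the last one is an element of the set. -/
theorem Den.memTuple {X : ℕ} {A : M.S} {xs : List Tm} {as : List M.N} {z : Tm} {c : M.N}
    (hX : DenS w X A) (hxs : List.Forall₂ (DenT w) xs as) (hz : DenT w z c) :
    Den K w (memTuple X z xs) (as.foldl pair c ∈ A) := by
  induction as generalizing xs w z c with
  | nil =>
    cases hxs
    exact .mem hz hX
  | cons a as ih =>
    cases hxs with
    | @cons x _ xs _ hx hxs =>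
      refine (Den.exLt (p := fun d => d = pair c a ∧ as.foldl pair d ∈ A) (.len hX)
        fun d w' u hw hu => (Den.isPair hu (hz.mono hw) (hx.mono hw)).and
          (ih (hX.mono hw) (hxs.imp fun _ _ h => h.mono hw) hu)).congr ?_
      constructor
      · rintro ⟨d, -, rfl, h⟩
        exact h
      · exact fun h => ⟨_, (le_foldl_pair as _).trans_lt (lt_len_of_mem h), rfl, h⟩

theorem Den.mem2 {X : ℕ} {A : M.S} {s t : Tm} {a b : M.N} (hX : DenS w X A) (hs : DenT w s a)
    (ht : DenT w t b) : Den K w (mem2 X s t) (pair a b ∈ A) :=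
  .memTuple hX (.cons ht .nil) hs

theorem Den.mem3 {X : ℕ} {A : M.S} {r s t : Tm} {a b c : M.N} (hX : DenS w X A)
    (hr : DenT w r a) (hs : DenT w s b) (ht : DenT w t c) :
    Den K w (mem3 X r s t) (pair (pair a b) c ∈ A) :=
  .memTuple hX (.cons hs (.cons ht .nil)) hr

theorem Den.memAt {X : ℕ} {A : M.S} {r s t : Tm} {a b c : M.N} (hX : DenS w X A)
    (hr : DenT w r a) (hs : DenT w s b) (ht : DenT w t c) :
    Den K w (memAt X r s t) (pair a (pair b c) ∈ A) := by
  refine (Den.exLt (p := fun d => d = pair b c ∧ pair a d ∈ A) (.len hX)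
    fun d w' u hw hu => (Den.isPair hu (hs.mono hw) (ht.mono hw)).and
      (.mem2 (hX.mono hw) (hr.mono hw) hu)).congr ?_
  constructor
  · rintro ⟨d, -, rfl, h⟩
    exact h
  · exact fun h => ⟨_, lt_len_of_pair_mem h, rfl, h⟩

theorem Den.app {m : ℕ} {F : ℕ} {A : M.S} {xs : Fin m → Tm} {v : Fin m → M.N} {y : Tm} {b : M.N}
    (hF : DenS w F A) (hxs : ∀ k, DenT w (xs k) (v k)) (hy : DenT w y b) :
    Den K w (app F xs y) (App A v b) := by
  cases m with
  | zero =>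
    simp only [BA.app, App, List.ofFn_zero, List.nil_append, tuple]
    exact .memTuple hF .nil hy
  | succ m =>
    simp only [BA.app, App, List.ofFn_succ, List.cons_append, tuple]
    refine .memTuple hF (List.rel_append ?_ (.cons hy .nil)) (hxs 0)
    rw [List.forall₂_iff_get]
    simp [hxs]

theorem Den.isOp {m : ℕ} {F : ℕ} {A : M.S} {D : Dom} {R : M.N → Prop} (hF : DenS w F A)
    (hD : DenD K w D R) : Den K w (isOp m F D) (IsOp m A R) :=
  .allVec m hD fun _ _ _ hw hv =>
    .and (.exIn (hD.mono hw) fun _ _ _ hw₁ hy =>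
      .app (hF.mono (hw.trans hw₁)) (fun k => (hv k).mono hw₁) hy)
    (.allIn (hD.mono hw) fun _ _ _ hw₁ hy₁ => .allIn (hD.mono (hw.trans hw₁))
      fun _ _ _ hw₂ hy₂ => .imp (.and
        (.app (hF.mono (hw.trans (hw₁.trans hw₂))) (fun k => (hv k).mono (hw₁.trans hw₂))
          (hy₁.mono hw₂))
        (.app (hF.mono (hw.trans (hw₁.trans hw₂))) (fun k => (hv k).mono (hw₁.trans hw₂)) hy₂))
        (.eq (hy₁.mono hw₂) hy₂))

theorem Den.pol1 {m : ℕ} {F : ℕ} {A : M.S} {D : Dom} {R P : M.N → Prop} {r : Tm → Bld}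
    (hF : DenS w F A) (hD : DenD K w D R)
    (hr : ∀ x w' u, w.Ext w' → DenT w' u x → Den K w' (r u) (P x)) :
    Den K w (pol1 m F D r) (Pol1 m A R P) :=
  .and (.isOp hF hD) (.allVec m hD fun _ _ _ hw hv => .allIn (hD.mono hw) fun _ _ _ hw₁ hu =>
    .imp (.and (.conj m fun k => hr _ _ _ (hw.trans hw₁) ((hv k).mono hw₁))
      (.app (hF.mono (hw.trans hw₁)) (fun k => (hv k).mono hw₁) hu))
      (hr _ _ _ (hw.trans hw₁) hu))

theorem Den.pol2 {m : ℕ} {F : ℕ} {A : M.S} {D : Dom} {R : M.N → Prop} {P : M.N → M.N → Prop}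
    {r : Tm → Tm → Bld} (hF : DenS w F A) (hD : DenD K w D R)
    (hr : ∀ x y w' u v, w.Ext w' → DenT w' u x → DenT w' v y → Den K w' (r u v) (P x y)) :
    Den K w (pol2 m F D r) (Pol2 m A R P) :=
  .and (.isOp hF hD) (.allVec m hD fun _ _ _ hw hv => .allVec m (hD.mono hw) fun _ _ _ hw₁ hv' =>
    .allIn (hD.mono (hw.trans hw₁)) fun _ _ _ hw₂ hu =>
    .allIn (hD.mono (hw.trans (hw₁.trans hw₂))) fun _ _ _ hw₃ hu' =>
      have e₁ := hw₁.trans (hw₂.trans hw₃)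
      have e₂ := hw₂.trans hw₃
      .imp (.and (.conj m fun k => hr _ _ _ _ _ (hw.trans e₁) ((hv k).mono e₁) ((hv' k).mono e₂))
        (.and (.app (hF.mono (hw.trans e₁)) (fun k => (hv k).mono e₁) (hu.mono hw₃))
          (.app (hF.mono (hw.trans e₁)) (fun k => (hv' k).mono e₂) hu')))
        (hr _ _ _ _ _ (hw.trans e₁) (hu.mono hw₃) hu'))

theorem Den.isCong {m : ℕ} {F : ℕ} {A : M.S} {D : Dom} {R : M.N → Prop} {P : M.N → M.N → Prop}
    {r : Tm → Tm → Bld} (hF : DenS w F A) (hD : DenD K w D R)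
    (hr : ∀ x y w' u v, w.Ext w' → DenT w' u x → DenT w' v y → Den K w' (r u v) (P x y)) :
    Den K w (isCong m D F r) (IsCong m R A P) :=
  .and (.pol2 hF hD hr) <|
  .and (.allIn hD fun _ _ _ hw hu => hr _ _ _ _ _ hw hu hu) <|
  .and (.allIn hD fun _ _ _ hw hu => .allIn (hD.mono hw) fun _ _ _ hw₁ hu' =>
    .iff (hr _ _ _ _ _ (hw.trans hw₁) (hu.mono hw₁) hu')
      (hr _ _ _ _ _ (hw.trans hw₁) hu' (hu.mono hw₁))) <|
  .allIn hD fun _ _ _ hw hu => .allIn (hD.mono hw) fun _ _ _ hw₁ hu₁ =>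
    .allIn (hD.mono (hw.trans hw₁)) fun _ _ _ hw₂ hu₂ =>
      have e₁ := hw₁.trans hw₂
      .imp (.and (hr _ _ _ _ _ (hw.trans e₁) (hu.mono e₁) (hu₁.mono hw₂))
        (hr _ _ _ _ _ (hw.trans e₁) (hu₁.mono hw₂) hu₂))
        (hr _ _ _ _ _ (hw.trans e₁) (hu.mono e₁) hu₂)

end Operations

/-! ## Meaning of the formulas about instances -/

/-- The values of the set variables of an instance. -/
structure InstVal (M : Str.{u}) : Type u where
  A : M.S
  VX : M.S
  EX : M.S
  VA : M.S
  EA : M.S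

/-- The instance `Θ` has the value `I`. -/
def DenI (w : World M) (Θ : Inst) (I : InstVal M) : Prop :=
  DenS w Θ.A I.A ∧ DenS w Θ.VX I.VX ∧ DenS w Θ.EX I.EX ∧ DenS w Θ.VA I.VA ∧ DenS w Θ.EA I.EA

theorem DenI.mono {w w' : World M} (h : w.Ext w') {Θ : Inst} {I : InstVal M} (hΘ : DenI w Θ I) :
    DenI w' Θ I :=
  ⟨hΘ.1.mono h, hΘ.2.1.mono h, hΘ.2.2.1.mono h, hΘ.2.2.2.1.mono h, hΘ.2.2.2.2.mono h⟩

/-- The number of variables. -/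
def InstVal.n (I : InstVal M) : M.N := M.len I.VX

/-- The size of the universe. -/
def InstVal.l (I : InstVal M) : M.N := M.len I.A

theorem DenT.instN {w : World M} {Θ : Inst} {I : InstVal M} (hΘ : DenI w Θ I) : DenT w Θ.n I.n := .len hΘ.2.1

theorem DenT.instL {w : World M} {Θ : Inst} {I : InstVal M} (hΘ : DenI w Θ I) : DenT w Θ.l I.l := .len hΘ.1

section Digraphs

variable [IsV1Model M]

/-- `H` is the graph of a map from `R` to `S`. -/
def IsMap (R S : M.N → Prop) (H : M.S) : Prop :=
  (∀ i, R i → ∃ j, S j ∧ pair i j ∈ H) ∧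
    ∀ i, R i → ∀ j₁, S j₁ → ∀ j₂, S j₂ → pair i j₁ ∈ H ∧ pair i j₂ ∈ H → j₁ = j₂

/-- `H` is the graph of a homomorphism from `(R, E)` to `(S, F)`. -/
def IsHom (R : M.N → Prop) (E : M.S) (S : M.N → Prop) (F H : M.S) : Prop :=
  IsMap R S H ∧ ∀ i₁, R i₁ → ∀ i₂, R i₂ → ∀ j₁, S j₁ → ∀ j₂, S j₂ →
    pair i₁ i₂ ∈ E ∧ pair i₁ j₁ ∈ H ∧ pair i₂ j₂ ∈ H → pair j₁ j₂ ∈ F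

/-- `({0, …, t}, E)` is an undirected path. -/
def IsPath (t : M.N) (E : M.S) : Prop :=
  (∀ i < t, pair i (i + 1) ∈ E ∨ pair (i + 1) i ∈ E) ∧
    ∀ i < t + 1, ∀ j < t + 1, pair i j ∈ E → j = i + 1 ∨ i = j + 1

/-- `({0, …, s}, E)` is an undirected cycle. -/
def IsCycle (s : M.N) (E : M.S) : Prop :=
  (pair 0 s ∈ E ∨ pair s 0 ∈ E) ∧ (∀ i < s, pair i (i + 1) ∈ E ∨ pair (i + 1) i ∈ E) ∧
    ∀ i < s + 1, ∀ j < s + 1, pair i j ∈ E →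
      j = i + 1 ∨ i = j + 1 ∨ (i = 0 ∧ j = s) ∨ (i = s ∧ j = 0)

namespace InstVal

variable (I : InstVal M)

/-- The domain of `i`. -/
def D (i a : M.N) : Prop := a < I.l ∧ pair i a ∈ I.VA

/-- `H` is a homomorphism from `({0, …, t - 1}, E)` to the input digraph. -/
def HomX (t : M.N) (E H : M.S) : Prop := IsHom (· < t) E (· ∈ I.VX) I.EX H

/-- `H'` is a homomorphism from `({0, …, t - 1}, E)` to the target digraph over `H`. -/
def HomA (t : M.N) (E H H' : M.S) : Prop :=
  IsHom (· < t) E (· ∈ I.VA) I.EA H' ∧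
    ∀ k < I.n, ∀ p < t, pair p k ∈ H → ∃ c, I.D k c ∧ pair p (pair k c) ∈ H'

/-- Every closed walk along a cycle can be realized with every initial value. -/
def CycleRealizable : Prop :=
  ∀ k < I.n, ∀ a, I.D k a → ∀ t < I.n * I.l, ∀ s < t, s + 1 = t →
    ∀ E, M.len E ≤ (1 + 1 + 1 + 1) * (t * t) → ∀ H, M.len H ≤ dbl t I.n →
      IsCycle s E ∧ I.HomX t E H ∧ pair 0 k ∈ H →
        ∃ H', M.len H' ≤ dbl t (dbl I.n I.l) ∧ I.HomA t E H H' ∧ pair 0 (pair k a) ∈ H'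

/-- `a` and `b` are linked. -/
def Linked (a b i j : M.N) : Prop :=
  ∃ t < I.n * I.l, ∃ E, M.len E ≤ (1 + 1 + 1 + 1) * (t * t) ∧ ∃ H, M.len H ≤ dbl t I.n ∧
    IsPath t E ∧ I.HomX (t + 1) E H ∧ pair 0 i ∈ H ∧ pair t j ∈ H ∧
      ∃ H', M.len H' ≤ dbl t (dbl I.n I.l) ∧ I.HomA (t + 1) E H H' ∧
        pair 0 (pair i a) ∈ H' ∧ pair t (pair j b) ∈ H'

end InstVal

variable {w : World M} {K : Fml → Prop} [BoundedClosed K]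

theorem Den.isMap {D D' : Dom} {R S : M.N → Prop} {X : ℕ} {H : M.S} (hD : DenD K w D R)
    (hD' : DenD K w D' S) (hX : DenS w X H) : Den K w (isMap D D' X) (IsMap R S H) :=
  .and (.allIn hD fun _ _ _ hw hi => .exIn (hD'.mono hw) fun _ _ _ hw₁ hj =>
    .mem2 (hX.mono (hw.trans hw₁)) (hi.mono hw₁) hj) <|
  .allIn hD fun _ _ _ hw hi => .allIn (hD'.mono hw) fun _ _ _ hw₁ hj₁ =>
    .allIn (hD'.mono (hw.trans hw₁)) fun _ _ _ hw₂ hj₂ =>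
      have e₁ := hw₁.trans hw₂
      .imp (.and (.mem2 (hX.mono (hw.trans e₁)) (hi.mono e₁) (hj₁.mono hw₂))
        (.mem2 (hX.mono (hw.trans e₁)) (hi.mono e₁) hj₂)) (.eq (hj₁.mono hw₂) hj₂)

theorem Den.isHom {D D' : Dom} {R S : M.N → Prop} {X Y Z : ℕ} {E F H : M.S} (hD : DenD K w D R)
    (hY : DenS w Y E) (hD' : DenD K w D' S) (hZ : DenS w Z F) (hX : DenS w X H) :
    Den K w (isHom D Y D' Z X) (IsHom R E S F H) :=
  .and (.isMap hD hD' hX) <|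
  .allIn hD fun _ _ _ hw hi₁ => .allIn (hD.mono hw) fun _ _ _ hw₁ hi₂ =>
    .allIn (hD'.mono (hw.trans hw₁)) fun _ _ _ hw₂ hj₁ =>
    .allIn (hD'.mono (hw.trans (hw₁.trans hw₂))) fun _ _ _ hw₃ hj₂ =>
      have e₂ := hw₂.trans hw₃
      have e₁ := hw₁.trans e₂
      have e := hw.trans e₁
      .imp (.and (.mem2 (hY.mono e) (hi₁.mono e₁) (hi₂.mono e₂))
        (.and (.mem2 (hX.mono e) (hi₁.mono e₁) (hj₁.mono hw₃)) (.mem2 (hX.mono e) (hi₂.mono e₂) hj₂)))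
        (.mem2 (hZ.mono e) (hj₁.mono hw₃) hj₂)

theorem Den.isPath {t : Tm} {a : M.N} {X : ℕ} {E : M.S} (ht : DenT w t a) (hX : DenS w X E) :
    Den K w (isPath t X) (IsPath a E) :=
  .and (.allLt ht fun _ _ _ hw hi => .or (.mem2 (hX.mono hw) hi (hi.add (.one _)))
    (.mem2 (hX.mono hw) (hi.add (.one _)) hi)) <|
  .allLt (ht.add (.one _)) fun _ _ _ hw hi => .allLt ((ht.mono hw).add (.one _))
    fun _ _ _ hw₁ hj => .imp (.mem2 (hX.mono (hw.trans hw₁)) (hi.mono hw₁) hj)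
      (.or (.eq hj ((hi.mono hw₁).add (.one _))) (.eq (hi.mono hw₁) (hj.add (.one _))))

theorem Den.isCycle {s : Tm} {a : M.N} {X : ℕ} {E : M.S} (hs : DenT w s a) (hX : DenS w X E) :
    Den K w (isCycle s X) (IsCycle a E) :=
  .and (.or (.mem2 hX (.zero _) hs) (.mem2 hX hs (.zero _))) <|
  .and (.allLt hs fun _ _ _ hw hi => .or (.mem2 (hX.mono hw) hi (hi.add (.one _)))
    (.mem2 (hX.mono hw) (hi.add (.one _)) hi)) <|
  .allLt (hs.add (.one _)) fun _ _ _ hw hi => .allLt ((hs.mono hw).add (.one _))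
    fun _ _ _ hw₁ hj =>
      have hi := hi.mono hw₁
      have hs := hs.mono (hw.trans hw₁)
      .imp (.mem2 (hX.mono (hw.trans hw₁)) hi hj)
      (.or (.eq hj (hi.add (.one _))) (.or (.eq hi (hj.add (.one _)))
        (.or (.and (.eq hi (.zero _)) (.eq hj hs)) (.and (.eq hi hs) (.eq hj (.zero _))))))

section Instances

variable {Θ : Inst} {I : InstVal M}

theorem DenD.instD (hΘ : DenI w Θ I) {i : Tm} {a : M.N} (hi : DenT w i a) :
    DenD K w (Θ.D i) (I.D a) :=
  ⟨I.l, fun x => pair a x ∈ I.VA, .instL hΘ,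
    fun _ _ _ hw hu => .mem2 (hΘ.mono hw).2.2.2.1 (hi.mono hw) hu, fun _ => Iff.rfl⟩

theorem Den.edge (hΘ : DenI w Θ I) {i j s t : Tm} {i' j' a b : M.N} (hi : DenT w i i')
    (hj : DenT w j j') (hs : DenT w s a) (ht : DenT w t b) :
    Den K w (Θ.edge i j s t) (pair (pair i' a) (pair j' b) ∈ I.EA) := by
  refine (Den.exLt (p := fun u => ∃ v < M.len I.EA, u = pair i' a ∧ v = pair j' b ∧
    pair u v ∈ I.EA) (.len hΘ.2.2.2.2) fun u w' x hw hx =>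
      .exLt (.len (hΘ.mono hw).2.2.2.2) fun v w'' y hw' hy =>
      have e := hw.trans hw'
      .and (.isPair (hx.mono hw') (hi.mono e) (hs.mono e)) (.and (.isPair hy (hj.mono e)
        (ht.mono e)) (.mem2 (hΘ.mono e).2.2.2.2 (hx.mono hw') hy))).congr ?_
  constructor
  · rintro ⟨u, -, v, -, rfl, rfl, h⟩
    exact h
  · exact fun h => ⟨_, (le_pair_left _ _).trans_lt (lt_len_of_mem h), _,
      lt_len_of_pair_mem h, rfl, rfl, h⟩

theorem Den.homX (hΘ : DenI w Θ I) {t : Tm} {a : M.N} {X Y : ℕ} {E H : M.S} (ht : DenT w t a)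
    (hX : DenS w X E) (hY : DenS w Y H) : Den K w (Θ.homX t X Y) (I.HomX a E H) :=
  .isHom (.below ht) hX (.setDom hΘ.2.1) hΘ.2.2.1 hY

theorem Den.homA (hΘ : DenI w Θ I) {t : Tm} {a : M.N} {X Y Z : ℕ} {E H H' : M.S}
    (ht : DenT w t a) (hX : DenS w X E) (hY : DenS w Y H) (hZ : DenS w Z H') :
    Den K w (Θ.homA t X Y Z) (I.HomA a E H H') :=
  .and (.isHom (.below ht) hX (.setDom hΘ.2.2.2.1) hΘ.2.2.2.2 hZ) <|
  .allLt (.instN hΘ) fun _ _ _ hw hk => .allLt (ht.mono hw) fun _ _ _ hw₁ hp =>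
    .imp (.mem2 (hY.mono (hw.trans hw₁)) hp (hk.mono hw₁))
      (.exIn (.instD (hΘ.mono (hw.trans hw₁)) (hk.mono hw₁)) fun _ _ _ hw₂ hc =>
        .memAt (hZ.mono (hw.trans (hw₁.trans hw₂))) (hp.mono hw₂) (hk.mono (hw₁.trans hw₂)) hc)

theorem Den.linked (hΘ : DenI w Θ I) {x y i j : Tm} {a b i' j' : M.N} (hx : DenT w x a)
    (hy : DenT w y b) (hi : DenT w i i') (hj : DenT w j j') :
    Den AnyFml w (Θ.linked x y i j) (I.Linked a b i' j') :=
  .exLt ((DenT.instN hΘ).mul (.instL hΘ)) fun _ _ _ w₁ ht =>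
  .exSetLe (.fourSq ht) fun _ _ _ w₂ hE =>
  .exSetLe ((ht.mono w₂).dblPair (.instN (hΘ.mono (w₁.trans w₂)))) fun _ _ _ w₃ hH =>
    have e₂ := w₂.trans w₃
    have e := w₁.trans e₂
    have hE := hE.mono w₃
    have ht := ht.mono e₂
    .and (.isPath ht hE) <| .and (.homX (hΘ.mono e) (ht.add (.one _)) hE hH) <|
    .and (.mem2 hH (.zero _) (hi.mono e)) <| .and (.mem2 hH ht (hj.mono e)) <|
    .exSetLe (ht.dblPair ((DenT.instN (hΘ.mono e)).dblPair (.instL (hΘ.mono e))))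
      fun _ _ _ w₄ hH' =>
        have e := e.trans w₄
        have ht := ht.mono w₄
        .and (.homA (hΘ.mono e) (ht.add (.one _)) (hE.mono w₄) (hH.mono w₄) hH') <|
        .and (.memAt hH' (.zero _) (hi.mono e) (hx.mono e)) (.memAt hH' ht (hj.mono e) (hy.mono e))

theorem den_cycleRealizable (hΘ : DenI w Θ I) :
    Den AnyFml w (Bld.allLt Θ.n fun k => allIn (Θ.D k) fun a => Bld.allLt (Θ.n * Θ.l) fun t =>
      Bld.allLt t fun s => Bld.eq (s + 1) t ⇾ Bld.allSetLe (fourSq t) fun E =>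
        Bld.allSetLe (dblPair t Θ.n) fun H => (isCycle s E ⩓ Θ.homX t E H ⩓ mem2 H 0 k) ⇾
          Bld.exSetLe (dblPair t (dblPair Θ.n Θ.l)) fun H' => Θ.homA t E H H' ⩓ memAt H' 0 k a)
      I.CycleRealizable :=
  .allLt (.instN hΘ) fun _ _ _ w₁ hk => .allIn (.instD (hΘ.mono w₁) hk) fun _ _ _ w₂ ha =>
  .allLt ((DenT.instN (hΘ.mono (w₁.trans w₂))).mul (.instL (hΘ.mono (w₁.trans w₂))))
    fun _ _ _ w₃ ht =>
  .allLt ht fun _ _ _ w₄ hs => .imp (.eq (hs.add (.one _)) (ht.mono w₄)) <|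
  .allSetLe (.fourSq (ht.mono w₄)) fun _ _ _ w₅ hE =>
    have e₃ := w₄.trans w₅
    have e₂ := w₃.trans e₃
    have e₁ := w₂.trans e₂
    have e := w₁.trans e₁
    .allSetLe ((ht.mono e₃).dblPair (.instN (hΘ.mono e))) fun _ _ _ w₆ hH =>
    have hE := hE.mono w₆
    have ht := ht.mono (e₃.trans w₆)
    have hk := hk.mono (e₁.trans w₆)
    have e := e.trans w₆
    .imp (.and (.isCycle (hs.mono (w₅.trans w₆)) hE) (.and (.homX (hΘ.mono e) ht hE hH)
      (.mem2 hH (.zero _) hk))) <|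
    .exSetLe (ht.dblPair ((DenT.instN (hΘ.mono e)).dblPair (.instL (hΘ.mono e))))
      fun _ _ _ w₇ hH' =>
        .and (.homA (hΘ.mono (e.trans w₇)) (ht.mono w₇) (hE.mono w₇) (hH.mono w₇) hH')
          (.memAt hH' (.zero _) (hk.mono w₇) (ha.mono (e₂.trans (w₆.trans w₇))))

end Instances

end Digraphs

/-! ## Reduction to a statement about the elements of a model -/

/-- The hypotheses on an instance used in the proof that linkedness is a congruence. -/
structure IsCycleConsistentInst [IsV1Model M] (m : ℕ) (I : InstVal M) (Ω Γ₁ Γ₂ : M.S) : Prop where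
  full : ∀ a < I.l, a ∈ I.A
  pol1 : ∀ s < M.len Γ₁, Pol1 m Ω (· ∈ I.A) fun a => pair s a ∈ Γ₁
  pol2 : ∀ s < M.len Γ₂, Pol2 m Ω (· ∈ I.A) fun a b => pair (pair s a) b ∈ Γ₂
  vars : ∀ i < I.n, i ∈ I.VX
  edges : ∀ i < I.n, ∀ j < I.n, ∃ s < M.len Γ₂, ∀ a < I.l, ∀ b < I.l,
    pair (pair i a) (pair j b) ∈ I.EA ↔ pair (pair s a) b ∈ Γ₂
  doms : ∀ i < I.n, ∃ s < M.len Γ₁, ∀ a < I.l, pair i a ∈ I.VA ↔ pair s a ∈ Γ₁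
  cycles : I.CycleRealizable

/-- The eight outer set quantifiers receive the indices 0 to 7. Each needed hypothesis is translated
by `Den` from formula to proposition, and the conclusion in the opposite direction. -/
theorem models_linkedCongruence [IsV1Model M] {m : ℕ}
    (h : ∀ (I : InstVal M) (Ω Γ₁ Γ₂ : M.S), IsCycleConsistentInst m I Ω Γ₁ Γ₂ →
      ∀ i < I.n, IsCong m (I.D i) Ω fun a b => I.Linked a b i i) :
    M.Models (linkedCongruence m) := by
  intro e E A Ω Γ₁ Γ₂ VX EX VA EA
  let w : World M := (((((((World.mk 0 0 e E).pushS A).pushS Ω).pushS Γ₁).pushS Γ₂).pushS VX).pushS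
    EX).pushS VA |>.pushS EA
  let I : InstVal M := ⟨A, VX, EX, VA, EA⟩
  have hd : ∀ X B, X < 8 → w.E X = B → DenS w X B := fun X B h h' => ⟨h, h'⟩
  have hA : DenS w 0 A := hd 0 A (by decide) rfl
  have hΩ : DenS w 1 Ω := hd 1 Ω (by decide) rfl
  have hΓ₁ : DenS w 2 Γ₁ := hd 2 Γ₁ (by decide) rfl
  have hΓ₂ : DenS w 3 Γ₂ := hd 3 Γ₂ (by decide) rfl
  have hI : DenI w ⟨0, 4, 5, 6, 7⟩ I := ⟨hA, hd 4 VX (by decide) rfl, hd 5 EX (by decide) rfl,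
    hd 6 VA (by decide) rfl, hd 7 EA (by decide) rfl⟩
  have hr : w.Ext w := .refl w
  refine Fml.holds_imp.2 ?_
  rintro ⟨⟨hfull, -⟩, ⟨hpol1, hpol2⟩, ⟨⟨hvars, -⟩, hedges, hdoms⟩, -, hcyc⟩
  have hinst : IsCycleConsistentInst m I Ω Γ₁ Γ₂ :=
    { full := (Den.allLt (K := AnyFml) (.len hA) (fun _ _ _ hw hu => .mem hu (hA.mono hw)) w hr).2.1
        hfull
      pol1 := (Den.allLt (K := AnyFml) (.len hΓ₁) (fun _ _ _ hw hs => .pol1 (hΩ.mono hw)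
        (.setDom (hA.mono hw)) fun _ _ _ hw₁ hu => .mem2 (hΓ₁.mono (hw.trans hw₁)) (hs.mono hw₁) hu)
        w hr).2.1 hpol1
      pol2 := (Den.allLt (K := AnyFml) (.len hΓ₂) (fun _ _ _ hw hs => .pol2 (hΩ.mono hw)
        (.setDom (hA.mono hw)) fun _ _ _ _ _ hw₁ hu hv =>
          .mem3 (hΓ₂.mono (hw.trans hw₁)) (hs.mono hw₁) hu hv) w hr).2.1 hpol2
      vars := (Den.allLt (K := AnyFml) (.instN hI)
        (fun _ _ _ hw hu => .mem hu (hI.mono hw).2.1) w hr).2.1 hvars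
      edges := (Den.allLt (K := AnyFml) (.instN hI) (fun _ _ _ w₁ hi => .allLt (.instN (hI.mono w₁))
        fun _ _ _ w₂ hj => .exLt (.len (hΓ₂.mono (w₁.trans w₂))) fun _ _ _ w₃ hs =>
        .allLt (.instL (hI.mono (w₁.trans (w₂.trans w₃)))) fun _ _ _ w₄ ha =>
        .allLt (.instL (hI.mono (w₁.trans (w₂.trans (w₃.trans w₄))))) fun _ _ _ w₅ hb =>
          have e₃ := w₄.trans w₅
          have e₂ := w₃.trans e₃
          have e₁ := w₂.trans e₂
          .iff (.edge (hI.mono (w₁.trans e₁)) (hi.mono e₁) (hj.mono e₂) (ha.mono w₅) hb)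
            (.mem3 (hΓ₂.mono (w₁.trans e₁)) (hs.mono e₃) (ha.mono w₅) hb)) w hr).2.1 hedges
      doms := (Den.allLt (K := AnyFml) (.instN hI) (fun _ _ _ w₁ hi =>
        .exLt (.len (hΓ₁.mono w₁)) fun _ _ _ w₂ hs =>
        .allLt (.instL (hI.mono (w₁.trans w₂))) fun _ _ _ w₃ ha =>
          .iff (.mem2 (hI.mono (w₁.trans (w₂.trans w₃))).2.2.2.1 (hi.mono (w₂.trans w₃)) ha)
            (.mem2 (hΓ₁.mono (w₁.trans (w₂.trans w₃))) (hs.mono w₃) ha)) w hr).2.1 hdoms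
      cycles := (den_cycleRealizable hI w hr).2.1 hcyc }
  exact (Den.allLt (K := AnyFml) (.instN hI) (fun _ _ _ hw hi => .isCong (hΩ.mono hw)
    (.instD (hI.mono hw) hi) fun _ _ _ _ _ hw₁ hu hv =>
      .linked (hI.mono (hw.trans hw₁)) hu hv (hi.mono hw₁) (hi.mono hw₁)) w hr).2.2
    (h I Ω Γ₁ Γ₂ hinst)


/-! ## Walks in the target digraph -/

namespace InstVal

variable [IsV1Model M] (I : InstVal M)

/-- The target vertices `⟨i, a⟩` and `⟨j, b⟩` are joined by an edge over an input edge. -/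
def Step (i a j b : M.N) : Prop :=
  (pair i j ∈ I.EX ∧ pair (pair i a) (pair j b) ∈ I.EA) ∨
    (pair j i ∈ I.EX ∧ pair (pair j b) (pair i a) ∈ I.EA)

/-- The functions coded by `H` and `C` form a walk of length `t`. -/
def Walk (t : M.N) (H C : M.S) : Prop :=
  (∀ p ≤ t, ev H p < I.n ∧ I.D (ev H p) (ev C p)) ∧
    ∀ p < t, I.Step (ev H p) (ev C p) (ev H (p + 1)) (ev C (p + 1))

/-- There is a walk of length `t` from `⟨i, a⟩` to `⟨j, b⟩`. -/
def Conn (t i a j b : M.N) : Prop :=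
  ∃ H C, I.Walk t H C ∧ ev H 0 = i ∧ ev C 0 = a ∧ ev H t = j ∧ ev C t = b

variable {I}

theorem Step.symm {i a j b : M.N} (h : I.Step i a j b) : I.Step j b i a := Or.symm h

/-- Besides coding the two functions, it bounds the lengths of the codes; `Conn` itself carries no
such bounds, and Σ₁ induction over walks needs them. -/
theorem exists_walk {t : M.N} {h c : M.N → M.N} (hh : DefF fun g : PUnit.{u + 1} × M.N => h g.2)
    (hc : DefF fun g : PUnit.{u + 1} × M.N => c g.2)
    (hd : ∀ p ≤ t, h p < I.n ∧ I.D (h p) (c p))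
    (hs : ∀ p < t, I.Step (h p) (c p) (h (p + 1)) (c (p + 1))) :
    ∃ H C, M.len H ≤ dbl t I.n ∧ M.len C ≤ dbl t I.l ∧ I.Walk t H C ∧
      (∀ p ≤ t, ev H p = h p) ∧ ∀ p ≤ t, ev C p = c p := by
  obtain ⟨H, hH, -, hHh⟩ := exists_code_fun hh t I.n fun p hp => (hd p hp).1
  obtain ⟨C, hC, -, hCc⟩ := exists_code_fun hc t I.l fun p hp => (hd p hp).2.1
  refine ⟨H, C, hH, hC, ⟨fun p hp => ?_, fun p hp => ?_⟩, hHh, hCc⟩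
  · rw [hHh p hp, hCc p hp]
    exact hd p hp
  · have hp' := add_one_le_iff'.2 hp
    rw [hHh p hp.le, hCc p hp.le, hHh _ hp', hCc _ hp']
    exact hs p hp

theorem conn_of_fun {t : M.N} {h c : M.N → M.N} (hh : DefF fun g : PUnit.{u + 1} × M.N => h g.2)
    (hc : DefF fun g : PUnit.{u + 1} × M.N => c g.2)
    (hd : ∀ p ≤ t, h p < I.n ∧ I.D (h p) (c p))
    (hs : ∀ p < t, I.Step (h p) (c p) (h (p + 1)) (c (p + 1))) :
    I.Conn t (h 0) (c 0) (h t) (c t) :=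
  let ⟨H, C, _, _, hw, hH, hC⟩ := exists_walk hh hc hd hs
  ⟨H, C, hw, hH _ zero_le, hC _ zero_le, hH _ le_rfl, hC _ le_rfl⟩

theorem conn_refl {i a : M.N} (hi : i < I.n) (ha : I.D i a) : I.Conn 0 i a i a :=
  conn_of_fun (h := fun _ => i) (c := fun _ => a) (.const i) (.const a) (fun _ _ => ⟨hi, ha⟩)
    fun _ hp => (not_lt_zero hp).elim

theorem Walk.conn_take {t p : M.N} {H C : M.S} (hw : I.Walk t H C) (hp : p ≤ t) :
    I.Conn p (ev H 0) (ev C 0) (ev H p) (ev C p) :=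
  ⟨H, C, ⟨fun q hq => hw.1 q (hq.trans hp), fun q hq => hw.2 q (hq.trans_le hp)⟩, rfl, rfl, rfl, rfl⟩

theorem Walk.conn_drop {q r : M.N} {H C : M.S} (hw : I.Walk (q + r) H C) :
    I.Conn r (ev H q) (ev C q) (ev H (q + r)) (ev C (q + r)) := by
  have h := conn_of_fun (I := I) (t := r) (h := fun x => ev H (q + x)) (c := fun x => ev C (q + x))
    (.ev (.const H) (.add (.const q) .v0)) (.ev (.const C) (.add (.const q) .v0))
    (fun p hp => hw.1 _ (add_le_add_right hp q)) fun p hp => by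
      rw [← add_assoc]
      exact hw.2 _ (add_lt_add_right hp q)
  rwa [add_zero] at h

/-- Read the walk backwards through `x ↦ t - x`; a step does not depend on the direction of
traversal. -/
theorem Conn.symm {t i a j b : M.N} (h : I.Conn t i a j b) : I.Conn t j b i a := by
  obtain ⟨H, C, hw, rfl, rfl, rfl, rfl⟩ := h
  have h := conn_of_fun (I := I) (t := t) (h := fun x => ev H (t - x)) (c := fun x => ev C (t - x))
    (.ev (.const H) (.sub (.const t) .v0)) (.ev (.const C) (.sub (.const t) .v0))
    (fun p _ => hw.1 _ tsub_le_self) fun p hp => by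
      obtain ⟨r, rfl⟩ := exists_add_of_le' (add_one_le_iff'.2 hp)
      rw [add_tsub_cancel_left, show p + 1 + r - p = r + 1 by
        rw [add_assoc, add_tsub_cancel_left, add_comm]]
      exact (hw.2 r (lt_of_lt_of_le (lt_add_one_iff'.2 le_rfl)
        (by rw [add_assoc, add_comm 1]; exact le_add_self))).symm
  rwa [tsub_zero, tsub_self] at h

theorem Conn.trans {t₁ t₂ i a j b k c : M.N} (h₁ : I.Conn t₁ i a j b) (h₂ : I.Conn t₂ j b k c) :
    I.Conn (t₁ + t₂) i a k c := by
  obtain ⟨H₁, C₁, hw₁, rfl, rfl, rfl, rfl⟩ := h₁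
  obtain ⟨H₂, C₂, hw₂, hH, hC, rfl, rfl⟩ := h₂
  -- From `t₁` on, the glued function follows the second walk. At the seam the first branch is the
  -- one evaluated, and the two agree there because the walks meet.
  have glue : ∀ {F₁ F₂ : M.S}, ev F₂ 0 = ev F₁ t₁ → ∀ y,
      (if t₁ + y ≤ t₁ then ev F₁ (t₁ + y) else ev F₂ (t₁ + y - t₁)) = ev F₂ y := by
    intro F₁ F₂ hF y
    split
    · next hy =>
      have hy0 : y = 0 := by simpa using hy
      rw [hy0, add_zero, hF]
    · rw [add_tsub_cancel_left]
  have h := conn_of_fun (I := I) (t := t₁ + t₂)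
    (h := fun x => if x ≤ t₁ then ev H₁ x else ev H₂ (x - t₁))
    (c := fun x => if x ≤ t₁ then ev C₁ x else ev C₂ (x - t₁))
    (.ite (.le .v0 (.const t₁)) (.ev (.const H₁) .v0) (.ev (.const H₂) (.sub .v0 (.const t₁))))
    (.ite (.le .v0 (.const t₁)) (.ev (.const C₁) .v0) (.ev (.const C₂) (.sub .v0 (.const t₁))))
    (fun p hp => ?_) (fun p hp => ?_)
  · simpa only [glue hH, glue hC, zero_le, if_true] using h
  · rcases le_total p t₁ with hp₁ | hp₁
    · simpa only [hp₁, if_true] using hw₁.1 p hp₁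
    · obtain ⟨y, rfl⟩ := exists_add_of_le' hp₁
      simpa only [glue hH, glue hC] using hw₂.1 y (le_of_add_le_add_left hp)
  · rcases lt_or_ge p t₁ with hp₁ | hp₁
    · simpa only [hp₁.le, add_one_le_iff'.2 hp₁, if_true] using hw₁.2 p hp₁
    · obtain ⟨y, rfl⟩ := exists_add_of_le' hp₁
      simp only [glue hH, glue hC, add_assoc]
      exact hw₂.2 y (lt_of_add_lt_add_left hp)

/-- A walk with at least `n l` steps can be shortened. -/
theorem Conn.exists_lt {t i a j b : M.N} (h : I.Conn t i a j b) (ht : I.n * I.l ≤ t) :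
    ∃ t' < t, I.Conn t' i a j b := by
  obtain ⟨H, C, hw, rfl, rfl, rfl, rfl⟩ := h
  -- Number the vertex `⟨x, y⟩` by `x l + y`. Since `y < l` this is injective with values below `n
  -- l`, a tighter bound than the pairing function would give.
  have hlt : ∀ {x y x' y' : M.N}, x < x' → y < I.l → x * I.l + y < x' * I.l + y' := by
    intro x y x' y' hx hy
    calc x * I.l + y < x * I.l + I.l := by gcongr
      _ = (x + 1) * I.l := by ring
      _ ≤ x' * I.l := mul_le_mul_left (add_one_le_iff'.2 hx) _
      _ ≤ _ := le_self_add
  have hb : ∀ p ≤ I.n * I.l, ev H p * I.l + ev C p < I.n * I.l := fun p hp => by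
    have := hw.1 p (hp.trans ht)
    simpa using hlt (y' := 0) this.1 this.2.1
  obtain ⟨G, -, -, hG⟩ := exists_code_fun (f := fun p => ev H p * I.l + ev C p)
    (.add (.mul (.ev (.const H) .v0) (.const _)) (.ev (.const C) .v0)) _ _ hb
  obtain ⟨p, q, hpq, hq, he⟩ := exists_ne_ev_eq (G := G) fun p hp => (hG p hp).symm ▸ hb p hp
  rw [hG p (hpq.le.trans hq), hG q hq] at he
  have hp := (hw.1 p ((hpq.le.trans hq).trans ht)).2.1
  have hq' := (hw.1 q (hq.trans ht)).2.1
  have hH : ev H p = ev H q := by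
    by_contra hne
    rcases lt_or_gt_of_ne hne with h | h
    · exact (hlt h hp).ne he
    · exact (hlt h hq').ne he.symm
  have hC : ev C p = ev C q := by
    rw [hH] at he
    exact add_left_cancel he
  obtain ⟨r, rfl⟩ := exists_add_of_le' (hq.trans ht)
  -- The walk visits the same vertex at `p` and `q`, so the part before `p` joins the part after
  -- `q`; the total `p + r` is smaller than `q + r`.
  refine ⟨p + r, by gcongr, (hw.conn_take ((hpq.le.trans le_self_add))).trans ?_⟩
  rw [hH, hC]
  exact hw.conn_drop

/-- If no connecting walk were shorter than `n l`, every one could be shortened again, contradicting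
that its length is a number of the model. -/
theorem Conn.exists_lt_mul {t i a j b : M.N} (h : I.Conn t i a j b) :
    ∃ t' < I.n * I.l, I.Conn t' i a j b := by
  by_contra hcon
  -- Codes are replaced by ones whose length is bounded in terms of the initial `t`, so that the set
  -- quantifiers in the induction below are bounded.
  have recode : ∀ {t'}, t' ≤ t → I.Conn t' i a j b → ∃ H, M.len H ≤ dbl t I.n ∧ ∃ C,
      M.len C ≤ dbl t I.l ∧ I.Walk t' H C ∧ ev H 0 = i ∧ ev C 0 = a ∧ ev H t' = j ∧
        ev C t' = b := by
    rintro t' ht' ⟨H, C, hw, rfl, rfl, rfl, rfl⟩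
    obtain ⟨H', C', hH', hC', hw', hH, hC⟩ := exists_walk (I := I) (t := t') (h := ev H)
      (c := ev C) (.ev (.const H) .v0) (.ev (.const C) .v0) hw.1 hw.2
    exact ⟨H', hH'.trans (dbl_mono ht' le_rfl), C', hC'.trans (dbl_mono ht' le_rfl), hw',
      hH _ zero_le, hC _ zero_le, hH _ le_rfl, hC _ le_rfl⟩
  -- The induction variable counts the steps saved: after `x` rounds the length `t'` satisfies `t' +
  -- x ≤ t`, which fails at `x = t + 1`.
  have key := induction_of_def (Q := fun x => ∃ H, M.len H ≤ dbl t I.n ∧ ∃ C,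
      M.len C ≤ dbl t I.l ∧ ∃ t' ≤ t, t' + x ≤ t ∧ I.Walk t' H C ∧ ev H 0 = i ∧ ev C 0 = a ∧
        ev H t' = j ∧ ev C t' = b)
    (.exSetLeT (.const _) (.exSetLeT (.const _) (.sigma1 (.exLe (.const t)
      (.and (.le (.add .v0 .v3) (.const t)) (.and (.and
        (.allLe .v0 (.and (.lt (.ev .v3 .v0) (.const _))
          (.and (.lt (.ev .v2 .v0) (.const _)) (.mem (.pair (.ev .v3 .v0) (.ev .v2 .v0)) (.const _)))))
        (.allLt .v0 (.or
          (.and (.mem (.pair (.ev .v3 .v0) (.ev .v3 (.add .v0 (.const 1)))) (.const _))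
            (.mem (.pair (.pair (.ev .v3 .v0) (.ev .v2 .v0))
              (.pair (.ev .v3 (.add .v0 (.const 1))) (.ev .v2 (.add .v0 (.const 1))))) (.const _)))
          (.and (.mem (.pair (.ev .v3 (.add .v0 (.const 1))) (.ev .v3 .v0)) (.const _))
            (.mem (.pair (.pair (.ev .v3 (.add .v0 (.const 1))) (.ev .v2 (.add .v0 (.const 1))))
              (.pair (.ev .v3 .v0) (.ev .v2 .v0))) (.const _))))))
        (.and (.eq (.ev .v2 (.const 0)) (.const i)) (.and (.eq (.ev .v1 (.const 0)) (.const a))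
          (.and (.eq (.ev .v2 .v0) (.const j)) (.eq (.ev .v1 .v0) (.const b)))))))))))
    ?_ ?_ (t + 1)
  · obtain ⟨H, -, C, -, t', -, ht', -⟩ := key
    exact absurd (le_add_self.trans ht') (not_le.2 (lt_add_one_iff'.2 le_rfl))
  · obtain ⟨H, hH, C, hC, hw⟩ := recode le_rfl h
    exact ⟨H, hH, C, hC, t, le_rfl, (add_zero t).le, hw⟩
  · rintro x ⟨H, -, C, -, t', ht', htx, hw⟩
    have hc : I.Conn t' i a j b := ⟨H, C, hw⟩
    obtain ⟨t'', hlt, hc'⟩ := hc.exists_lt (not_lt.1 fun hlt => hcon ⟨t', hlt, hc⟩)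
    obtain ⟨H', hH', C', hC', hw'⟩ := recode (hlt.le.trans ht') hc'
    refine ⟨H', hH', C', hC', t'', hlt.le.trans ht', ?_, hw'⟩
    calc t'' + (x + 1) = t'' + 1 + x := by ring
      _ ≤ t' + x := add_le_add_left (add_one_le_iff'.2 hlt) x
      _ ≤ t := htx

end InstVal


/-! ## Linkedness and walks -/

section Homomorphisms

variable [IsV1Model M]

theorem IsGraph.isHom {G E F : M.S} {t : M.N} {S : M.N → Prop} (hG : IsGraph G t)
    (hS : ∀ p ≤ t, S (ev G p))
    (hE : ∀ p ≤ t, ∀ q ≤ t, pair p q ∈ E → pair (ev G p) (ev G q) ∈ F) :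
    IsHom (· < t + 1) E S F G := by
  simp only [IsHom, IsMap, lt_add_one_iff']
  refine ⟨⟨fun p hp => ⟨_, hS p hp, (hG p hp _).2 rfl⟩, fun p hp y _ z _ h => ?_⟩,
    fun p hp q hq y _ z _ h => ?_⟩
  · rw [(hG p hp y).1 h.1, (hG p hp z).1 h.2]
  · rw [(hG p hp y).1 h.2.1, (hG q hq z).1 h.2.2]
    exact hE p hp q hq h.1

namespace InstVal

variable {I : InstVal M}

/-- Along `P`, the function coded by `H` is a walk of length `t` in the input digraph. -/
def Path (I : InstVal M) (t : M.N) (P H : M.S) : Prop :=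
  (∀ p ≤ t, ev H p < I.n) ∧ (∀ p < t, pair p (p + 1) ∈ P ∨ pair (p + 1) p ∈ P) ∧
    (∀ p < t, pair p (p + 1) ∈ P → pair (ev H p) (ev H (p + 1)) ∈ I.EX) ∧
    ∀ p < t, pair (p + 1) p ∈ P → pair (ev H (p + 1)) (ev H p) ∈ I.EX

/-- The function coded by `C` realizes the walk `H` along `P` in the target digraph. -/
def Lift (I : InstVal M) (t : M.N) (P H C : M.S) : Prop :=
  (∀ p ≤ t, I.D (ev H p) (ev C p)) ∧
    (∀ p < t, pair p (p + 1) ∈ P →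
      pair (pair (ev H p) (ev C p)) (pair (ev H (p + 1)) (ev C (p + 1))) ∈ I.EA) ∧
    ∀ p < t, pair (p + 1) p ∈ P →
      pair (pair (ev H (p + 1)) (ev C (p + 1))) (pair (ev H p) (ev C p)) ∈ I.EA

/-- Forgets the prescribed edge directions. Walks are convenient to join and shorten, whereas
applying `Ω` requires several realizations with common directions. -/
theorem Path.walk {t : M.N} {P H C : M.S} (hP : I.Path t P H) (hC : I.Lift t P H C) :
    I.Walk t H C :=
  ⟨fun p hp => ⟨hP.1 p hp, hC.1 p hp⟩, fun p hp => (hP.2.1 p hp).imp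
    (fun h => ⟨hP.2.2.1 p hp h, hC.2.1 p hp h⟩) fun h => ⟨hP.2.2.2 p hp h, hC.2.2 p hp h⟩⟩

/-- A homomorphism is single-valued only among vertices of the target, so the set `H` may contain
stray pairs and `ev H` need not read it correctly. `G` is a cleaned-up code. -/
theorem HomX.exists_code {t : M.N} {E H : M.S} (h : I.HomX (t + 1) E H)
    (hV : ∀ i < I.n, i ∈ I.VX) :
    ∃ G, ∀ p ≤ t, ev G p < I.n ∧ pair p (ev G p) ∈ H ∧ ∀ i < I.n, pair p i ∈ H → i = ev G p := by
  obtain ⟨⟨h1, h2⟩, -⟩ := h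
  simp only [lt_add_one_iff'] at h1 h2
  obtain ⟨G, -, -, hG⟩ := BA.exists_code (Q := fun p i => pair p i ∈ H)
    (.mem (.pair .v1 .v0) (.const H)) t I.n fun p hp => by
      obtain ⟨i, hi, hpi⟩ := h1 p hp
      exact ⟨i, lt_len_of_mem hi, hpi, fun j hj hpj => h2 p hp j (hV j hj) i hi ⟨hpj, hpi⟩⟩
  exact ⟨G, fun p hp => ⟨(hG p hp).1, (hG p hp).2, fun i hi hpi =>
    h2 p hp i (hV i hi) _ (hV _ (hG p hp).1) ⟨hpi, (hG p hp).2⟩⟩⟩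

theorem HomX.edge {t : M.N} {E H : M.S} (h : I.HomX (t + 1) E H) (hV : ∀ i < I.n, i ∈ I.VX)
    {p q i j : M.N} (hp : p ≤ t) (hq : q ≤ t) (hi : i < I.n) (hj : j < I.n) (hpq : pair p q ∈ E)
    (hpi : pair p i ∈ H) (hqj : pair q j ∈ H) : pair i j ∈ I.EX :=
  h.2 p (lt_add_one_iff'.2 hp) q (lt_add_one_iff'.2 hq) i (hV i hi) j (hV j hj) ⟨hpq, hpi, hqj⟩

/-- Being over `H` fixes the first component of each image vertex, so only the second has to be
coded, by `C`. -/
theorem HomA.exists_code {t : M.N} {E H H' G : M.S} (h : I.HomA (t + 1) E H H')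
    (hG : ∀ p ≤ t, ev G p < I.n ∧ pair p (ev G p) ∈ H) :
    ∃ C, (∀ p ≤ t, I.D (ev G p) (ev C p) ∧
      ∀ c, I.D (ev G p) c → pair p (pair (ev G p) c) ∈ H' → c = ev C p) ∧
      ∀ p ≤ t, ∀ q ≤ t, pair p q ∈ E →
        pair (pair (ev G p) (ev C p)) (pair (ev G q) (ev C q)) ∈ I.EA := by
  obtain ⟨⟨⟨-, h2⟩, h3⟩, h4⟩ := h
  simp only [lt_add_one_iff'] at h2 h3 h4
  have uniq : ∀ p ≤ t, ∀ c, I.D (ev G p) c ∧ pair p (pair (ev G p) c) ∈ H' →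
      ∀ c', I.D (ev G p) c' ∧ pair p (pair (ev G p) c') ∈ H' → c' = c :=
    fun p hp c hc c' hc' => (pair_inj (h2 p hp _ hc'.1.2 _ hc.1.2 ⟨hc'.2, hc.2⟩)).2
  obtain ⟨C, -, -, hC⟩ := BA.exists_code
    (Q := fun p c => I.D (ev G p) c ∧ pair p (pair (ev G p) c) ∈ H')
    (.and (.and (.lt .v0 (.const _)) (.mem (.pair (.ev (.const G) .v1) .v0) (.const _)))
      (.mem (.pair .v1 (.pair (.ev (.const G) .v1) .v0)) (.const H'))) t I.l fun p hp => by
      obtain ⟨c, hc, hpc⟩ := h4 _ (hG p hp).1 p hp (hG p hp).2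
      exact ⟨c, hc.1, ⟨hc, hpc⟩, fun c' _ hc' => uniq p hp c ⟨hc, hpc⟩ c' hc'⟩
  refine ⟨C, fun p hp => ⟨(hC p hp).2.1, fun c hc hpc => uniq p hp _ (hC p hp).2 c ⟨hc, hpc⟩⟩,
    fun p hp q hq hpq => ?_⟩
  exact h3 p hp q hq _ (hC p hp).2.1.2 _ (hC q hq).2.1.2 ⟨hpq, (hC p hp).2.2, (hC q hq).2.2⟩

/-- Retains the edge set `P`, not just a walk: the other arguments of `Ω` must be lifted along the
same edges in the same directions. -/
theorem path_of_linked {a b i j : M.N} (hV : ∀ i < I.n, i ∈ I.VX) (hi : i < I.n) (hj : j < I.n)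
    (ha : I.D i a) (hb : I.D j b) (h : I.Linked a b i j) :
    ∃ t < I.n * I.l, ∃ P H C, I.Path t P H ∧ I.Lift t P H C ∧
      ev H 0 = i ∧ ev H t = j ∧ ev C 0 = a ∧ ev C t = b := by
  obtain ⟨t, ht, P, -, H, -, hP, hX, h0, h1, H', -, hA, h2, h3⟩ := h
  obtain ⟨G, hG⟩ := hX.exists_code hV
  obtain ⟨C, hC, hCE⟩ := hA.exists_code fun p hp => ⟨(hG p hp).1, (hG p hp).2.1⟩
  have e0 := (hG 0 zero_le).2.2 i hi h0
  have e1 := (hG t le_rfl).2.2 j hj h1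
  have edge : ∀ p ≤ t, ∀ q ≤ t, pair p q ∈ P → pair (ev G p) (ev G q) ∈ I.EX :=
    fun p hp q hq hpq => hX.edge hV hp hq (hG p hp).1 (hG q hq).1 hpq (hG p hp).2.1 (hG q hq).2.1
  refine ⟨t, ht, P, G, C, ⟨fun p hp => (hG p hp).1, hP.1,
    fun p hp => edge _ hp.le _ (add_one_le_iff'.2 hp),
    fun p hp => edge _ (add_one_le_iff'.2 hp) _ hp.le⟩, ⟨fun p hp => (hC p hp).1,
    fun p hp => hCE _ hp.le _ (add_one_le_iff'.2 hp),
    fun p hp => hCE _ (add_one_le_iff'.2 hp) _ hp.le⟩, e0.symm, e1.symm, ?_, ?_⟩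
  · exact ((hC 0 zero_le).2 a (e0 ▸ ha) (e0 ▸ h2)).symm
  · exact ((hC t le_rfl).2 b (e1 ▸ hb) (e1 ▸ h3)).symm

/-- The path receives an edge in a given direction exactly when both the input edge and the target
edge exist in that direction. Both codes are then homomorphisms by construction, and each step of
the walk provides at least one direction. -/
theorem Conn.linked {t i a j b : M.N} (hV : ∀ i < I.n, i ∈ I.VX) (h : I.Conn t i a j b)
    (ht : t < I.n * I.l) : I.Linked a b i j := by
  obtain ⟨H₀, C, ⟨hd, hs⟩, rfl, rfl, rfl, rfl⟩ := h
  obtain ⟨H, hH, hHg, hHe⟩ := exists_code_fun (f := ev H₀) (.ev (.const H₀) .v0) t I.n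
    fun p hp => (hd p hp).1
  obtain ⟨H', hH', hHg', hHe'⟩ := exists_code_fun (f := fun p => pair (ev H₀ p) (ev C p))
    (.pair (.ev (.const H₀) .v0) (.ev (.const C) .v0)) t (dbl I.n I.l)
    fun p hp => pair_lt_dbl (hd p hp).1.le (hd p hp).2.1
  obtain ⟨E, hE, hEz⟩ := exists_set_of_def (Q := fun z => ∃ p < t,
      (z = pair p (p + 1) ∧ pair (ev H₀ p) (ev H₀ (p + 1)) ∈ I.EX ∧
        pair (pair (ev H₀ p) (ev C p)) (pair (ev H₀ (p + 1)) (ev C (p + 1))) ∈ I.EA) ∨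
      (z = pair (p + 1) p ∧ pair (ev H₀ (p + 1)) (ev H₀ p) ∈ I.EX ∧
        pair (pair (ev H₀ (p + 1)) (ev C (p + 1))) (pair (ev H₀ p) (ev C p)) ∈ I.EA))
    (have h₀ := .ev (.const H₀) .v0
    have h₁ := .ev (.const H₀) (.add .v0 (.const 1))
    have c₀ := .ev (.const C) .v0
    have c₁ := .ev (.const C) (.add .v0 (.const 1))
    .exLt (.const t) (.or
      (.and (.eq .v1 (.pair .v0 (.add .v0 (.const 1)))) (.and (.mem (.pair h₀ h₁) (.const _))
        (.mem (.pair (.pair h₀ c₀) (.pair h₁ c₁)) (.const _))))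
      (.and (.eq .v1 (.pair (.add .v0 (.const 1)) .v0)) (.and (.mem (.pair h₁ h₀) (.const _))
        (.mem (.pair (.pair h₁ c₁) (.pair h₀ c₀)) (.const _)))))) ((1 + 1 + 1 + 1) * (t * t))
  have hEE : ∀ p q, pair p q ∈ E → (q = p + 1 ∨ p = q + 1) ∧ pair (ev H₀ p) (ev H₀ q) ∈ I.EX ∧
      pair (pair (ev H₀ p) (ev C p)) (pair (ev H₀ q) (ev C q)) ∈ I.EA := by
    intro p q hpq
    obtain ⟨r, -, ⟨he, h⟩ | ⟨he, h⟩⟩ := (hEz _ ((lt_len_of_mem hpq).trans_le hE)).1 hpq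
    · obtain ⟨rfl, rfl⟩ := pair_inj he
      exact ⟨.inl rfl, h⟩
    · obtain ⟨rfl, rfl⟩ := pair_inj he
      exact ⟨.inr rfl, h⟩
  refine ⟨t, ht, E, hE, H, hH, ⟨fun p hp => ?_, fun p _ q _ hpq => (hEE p q hpq).1⟩,
    hHg.isHom (fun p hp => ?_) (fun p hp q hq hpq => ?_), ?_, ?_, H', hH',
    ⟨hHg'.isHom (fun p hp => ?_) (fun p hp q hq hpq => ?_), fun k _ p hp hpk => ?_⟩, ?_, ?_⟩
  · have hp' := add_one_le_iff'.2 hp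
    rcases hs p hp with h | h
    · exact .inl ((hEz _ (pair_lt_fourSq hp.le hp' (.inl hp))).2 ⟨p, hp, .inl ⟨rfl, h⟩⟩)
    · exact .inr ((hEz _ (pair_lt_fourSq hp' hp.le (.inr hp))).2 ⟨p, hp, .inr ⟨rfl, h⟩⟩)
  · rw [hHe p hp]
    exact hV _ (hd p hp).1
  · rw [hHe p hp, hHe q hq]
    exact (hEE p q hpq).2.1
  · exact (hHg 0 zero_le _).2 (hHe 0 zero_le).symm
  · exact (hHg t le_rfl _).2 (hHe t le_rfl).symm
  · rw [hHe' p hp]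
    exact (hd p hp).2.2
  · rw [hHe' p hp, hHe' q hq]
    exact (hEE p q hpq).2.2
  · have hp := lt_add_one_iff'.1 hp
    have hk : k = ev H₀ p := ((hHg p hp k).1 hpk).trans (hHe p hp)
    subst hk
    exact ⟨ev C p, (hd p hp).2, (hHg' p hp _).2 (hHe' p hp).symm⟩
  · exact (hHg' 0 zero_le _).2 (hHe' 0 zero_le).symm
  · exact (hHg' t le_rfl _).2 (hHe' t le_rfl).symm

/-- In a cycle-consistent instance, a closed walk can be realized as a closed walk from any element
of the domain. -/
theorem Path.exists_closed_lift {t i a : M.N} {P H : M.S} (hV : ∀ i < I.n, i ∈ I.VX)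
    (hI : I.CycleRealizable) (hP : I.Path t P H) (ht : t < I.n * I.l) (h0 : ev H 0 = i)
    (h1 : ev H t = i) (ha : I.D i a) :
    ∃ C, I.Lift t P H C ∧ ev C 0 = a ∧ ev C t = a := by
  -- A cycle has length at least 1, so the walk of length 0 is lifted directly by the constant `a`.
  rcases eq_zero_or_eq_add_one t with rfl | ⟨s, rfl⟩
  · obtain ⟨C, -, -, hC⟩ := exists_code_fun (f := fun _ => a) (.const a) 0 I.l fun _ _ => ha.1
    refine ⟨C, ⟨fun p hp => ?_, fun p hp => (not_lt_zero hp).elim,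
      fun p hp => (not_lt_zero hp).elim⟩, hC 0 le_rfl, hC 0 le_rfl⟩
    have hp0 : p = 0 := le_antisymm hp zero_le
    rw [hC p hp, hp0, h0]
    exact ha
  have hss : s < s + 1 := lt_add_one_iff'.2 le_rfl
  -- Cyclic successor on `{0, …, s}`: the end `s + 1` is identified with 0, which `H` does not
  -- notice because it takes the value `i` at both.
  obtain ⟨nx, hnx⟩ : ∃ nx : M.N → M.N, nx = fun p => if p = s then 0 else p + 1 := ⟨_, rfl⟩
  have hnxs : nx s = 0 := by simp [hnx]
  have hnxne : ∀ {p}, p ≠ s → nx p = p + 1 := fun h => by simp [hnx, h]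
  have hnxle : ∀ {p}, p ≤ s → nx p ≤ s := fun {p} hp => by
    rcases eq_or_ne p s with rfl | hne
    · exact hnxs ▸ zero_le
    · exact hnxne hne ▸ add_one_le_iff'.2 (lt_of_le_of_ne hp hne)
  have hHnx : ∀ p, ev H (nx p) = ev H (p + 1) := fun p => by
    rcases eq_or_ne p s with rfl | hne
    · rw [hnxs, h0, h1]
    · rw [hnxne hne]
  obtain ⟨G, hG, hGg, hGe⟩ := exists_code_fun (f := ev H) (.ev (.const H) .v0) (s + 1) I.n hP.1
  -- The cycle inherits the directions of `P`, with each edge between `p` and `p + 1` transported to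
  -- one between `p` and `nx p`.
  obtain ⟨E, hE, hEz⟩ := exists_set_of_def (Q := fun z => ∃ p ≤ s,
      (pair p (p + 1) ∈ P ∧ z = pair p (nx p)) ∨ (pair (p + 1) p ∈ P ∧ z = pair (nx p) p))
    (have n₀ : DefF (fun g : (PUnit.{u + 1} × M.N) × M.N => nx g.2) :=
      hnx ▸ .ite (.eq .v0 (.const s)) (.const 0) (.add .v0 (.const 1))
    .exLe (.const s) (.or
      (.and (.mem (.pair .v0 (.add .v0 (.const 1))) (.const P)) (.eq .v1 (.pair .v0 n₀)))
      (.and (.mem (.pair (.add .v0 (.const 1)) .v0) (.const P)) (.eq .v1 (.pair n₀ .v0)))))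
    ((1 + 1 + 1 + 1) * ((s + 1) * (s + 1)))
  have hEE : ∀ p q, pair p q ∈ E → ∃ r ≤ s, (pair r (r + 1) ∈ P ∧ p = r ∧ q = nx r) ∨
      (pair (r + 1) r ∈ P ∧ p = nx r ∧ q = r) := by
    intro p q hpq
    obtain ⟨r, hr, ⟨h, he⟩ | ⟨h, he⟩⟩ := (hEz _ ((lt_len_of_mem hpq).trans_le hE)).1 hpq
    · exact ⟨r, hr, .inl ⟨h, pair_inj he⟩⟩
    · exact ⟨r, hr, .inr ⟨h, pair_inj he⟩⟩
  have hE₁ : ∀ p ≤ s, pair p (p + 1) ∈ P → pair p (nx p) ∈ E := fun p hp h =>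
    (hEz _ (pair_lt_fourSq (hp.trans hss.le) ((hnxle hp).trans hss.le)
      (.inl (lt_add_one_iff'.2 hp)))).2 ⟨p, hp, .inl ⟨h, rfl⟩⟩
  have hE₂ : ∀ p ≤ s, pair (p + 1) p ∈ P → pair (nx p) p ∈ E := fun p hp h =>
    (hEz _ (pair_lt_fourSq ((hnxle hp).trans hss.le) (hp.trans hss.le)
      (.inr (lt_add_one_iff'.2 hp)))).2 ⟨p, hp, .inr ⟨h, rfl⟩⟩
  have hcyc : IsCycle s E := by
    refine ⟨?_, fun p hp => ?_, fun p _ q _ hpq => ?_⟩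
    · rw [← hnxs]
      exact ((hP.2.1 s hss).imp (hE₁ s le_rfl) (hE₂ s le_rfl)).symm
    · rw [← hnxne hp.ne]
      exact (hP.2.1 p (hp.trans hss)).imp (hE₁ p hp.le) (hE₂ p hp.le)
    · obtain ⟨r, hr, ⟨-, rfl, rfl⟩ | ⟨-, rfl, rfl⟩⟩ := hEE p q hpq
      · rcases eq_or_ne p s with rfl | hne
        · exact .inr (.inr (.inr ⟨rfl, hnxs⟩))
        · exact .inl (hnxne hne)
      · rcases eq_or_ne q s with rfl | hne
        · exact .inr (.inr (.inl ⟨hnxs, rfl⟩))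
        · exact .inr (.inl (hnxne hne))
  have hGs : ∀ p ≤ s, ev G p = ev H p := fun p hp => hGe p (hp.trans hss.le)
  have hi : i < I.n := h0 ▸ hP.1 0 zero_le
  have hX : I.HomX (s + 1) E G := by
    refine IsGraph.isHom (fun p hp => hGg p (hp.trans hss.le)) (fun p hp => ?_)
      fun p hp q hq hpq => ?_
    · rw [hGs p hp]
      exact hV _ (hP.1 p (hp.trans hss.le))
    · rw [hGs p hp, hGs q hq]
      obtain ⟨r, hr, ⟨h, rfl, rfl⟩ | ⟨h, rfl, rfl⟩⟩ := hEE p q hpq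
      · rw [hHnx]
        exact hP.2.2.1 p (lt_add_one_iff'.2 hp) h
      · rw [hHnx]
        exact hP.2.2.2 q (lt_add_one_iff'.2 hq) h
  obtain ⟨H', -, hA, hA0⟩ := hI i hi a ha (s + 1) ht s hss rfl E hE G hG
    ⟨hcyc, hX, (hGg 0 zero_le _).2 (by rw [hGe 0 zero_le, h0])⟩
  obtain ⟨C₀, hC₀, hCE⟩ := hA.exists_code fun p hp => ⟨by
    rw [hGs p hp]
    exact hP.1 p (hp.trans hss.le), (hGg p (hp.trans hss.le) _).2 rfl⟩
  have hG0 : ev G 0 = i := (hGs 0 zero_le).trans h0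
  have hC00 : ev C₀ 0 = a := ((hC₀ 0 zero_le).2 a (hG0 ▸ ha) (hG0 ▸ hA0)).symm
  -- Cut the cycle open again: the lift on `{0, …, s}` is extended by the value `a` at `s + 1`,
  -- consistent with its value at 0.
  obtain ⟨C, -, -, hC⟩ := exists_code_fun (f := fun p => if p = s + 1 then a else ev C₀ p)
    (.ite (.eq .v0 (.const _)) (.const a) (.ev (.const C₀) .v0)) (s + 1) I.l fun p hp => by
      split
      · exact ha.1
      · next hne => exact (hC₀ p (lt_add_one_iff'.1 (lt_of_le_of_ne hp hne))).1.1
  have hCs : ∀ p ≤ s, ev C p = ev C₀ p := fun p hp => by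
    rw [hC p (hp.trans hss.le), if_neg (hp.trans_lt hss).ne]
  have hCt : ev C (s + 1) = a := by rw [hC _ le_rfl, if_pos rfl]
  have hCnx : ∀ p ≤ s, ev C (p + 1) = ev C₀ (nx p) := fun p hp => by
    rcases eq_or_ne p s with rfl | hne
    · rw [hnxs, hC00, hCt]
    · rw [hnxne hne, hCs _ (add_one_le_iff'.2 (lt_of_le_of_ne hp hne))]
  refine ⟨C, ⟨fun p hp => ?_, fun p hp h => ?_, fun p hp h => ?_⟩,
    (hCs 0 zero_le).trans hC00, hCt⟩
  · rcases eq_or_ne p (s + 1) with rfl | hne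
    · rw [h1, hCt]
      exact ha
    · have hp := lt_add_one_iff'.1 (lt_of_le_of_ne hp hne)
      rw [hCs p hp, ← hGs p hp]
      exact (hC₀ p hp).1
  · have hp := lt_add_one_iff'.1 hp
    have := hCE p hp _ (hnxle hp) (hE₁ p hp h)
    rwa [hGs p hp, hGs _ (hnxle hp), hHnx, ← hCs p hp, ← hCnx p hp] at this
  · have hp := lt_add_one_iff'.1 hp
    have := hCE _ (hnxle hp) p hp (hE₂ p hp h)
    rwa [hGs p hp, hGs _ (hnxle hp), hHnx, ← hCs p hp, ← hCnx p hp] at this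

end InstVal

end Homomorphisms


/-! ## Linkedness is a congruence -/

section Congruence

variable [IsV1Model M]

theorem DefF.foldl_pair {Γ : Type u} [Ctx M Γ] (L : List (Γ → M.N)) (hL : ∀ f ∈ L, DefF f)
    {z : Γ → M.N} (hz : DefF z) : DefF fun g => (L.map (· g)).foldl BA.pair (z g) := by
  induction L generalizing z with
  | nil => exact hz
  | cons f L ih =>
    exact ih (fun f hf => hL f (List.mem_cons_of_mem _ hf)) (hz.pair (hL f List.mem_cons_self))

/-- The tuple is a fixed finite iteration of `pair`, since the arity is standard; hence application
of `Ω` is Σ₀ and can be used in comprehension. -/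
theorem def_app {Γ : Type u} [Ctx M Γ] {m : ℕ} (F : M.S) {f : Fin m → Γ → M.N} {y : Γ → M.N}
    (hf : ∀ k, DefF (f k)) (hy : DefF y) : Def0 M fun g => App F (fun k => f k g) (y g) := by
  cases m with
  | zero =>
    simp only [App, List.ofFn_zero, List.nil_append, tuple]
    exact .mem hy (.const F)
  | succ m =>
    have h := Def.mem (DefF.foldl_pair ((List.ofFn fun k : Fin m => f k.succ) ++ [y])
      (by simpa [List.mem_ofFn, or_imp, forall_and, hy] using fun k : Fin m => hf k.succ) (hf 0)) (.const F)
    simp only [List.map_append, List.map_ofFn, List.map_cons, List.map_nil] at h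
    simp only [App, List.ofFn_succ, List.cons_append, tuple]
    exact h

variable {m : ℕ} {I : InstVal M} {Ω Γ₁ Γ₂ : M.S}

namespace IsCycleConsistentInst

variable (h : IsCycleConsistentInst m I Ω Γ₁ Γ₂)
include h

-- Closure of domains and edge relations under the operation

theorem mem_A {i a : M.N} (ha : I.D i a) : a ∈ I.A := h.full a ha.1

/-- The domain of `i` is a unary relation of the language, and preservation of that relation
includes that `Ω` is an operation on the universe. -/
theorem isOp_A {i : M.N} (hi : i < I.n) : IsOp m Ω (· ∈ I.A) :=
  let ⟨s, hs, _⟩ := h.doms i hi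
  (h.pol1 s hs).1

theorem app_unique {i : M.N} (hi : i < I.n) {v : Fin m → M.N} (hv : ∀ k, v k ∈ I.A) {y z : M.N}
    (hy : y ∈ I.A) (hz : z ∈ I.A) (hvy : App Ω v y) (hvz : App Ω v z) : y = z :=
  (h.isOp_A hi v hv).2 y hy z hz ⟨hvy, hvz⟩

theorem D_of_app {i : M.N} (hi : i < I.n) {v : Fin m → M.N} (hv : ∀ k, I.D i (v k)) {y : M.N}
    (hy : y ∈ I.A) (hvy : App Ω v y) : I.D i y := by
  obtain ⟨s, hs, hsD⟩ := h.doms i hi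
  have hyl : y < I.l := lt_len_of_mem hy
  exact ⟨hyl, (hsD y hyl).2 ((h.pol1 s hs).2 v (fun k => h.mem_A (hv k)) y hy
    ⟨fun k => (hsD _ (hv k).1).1 (hv k).2, hvy⟩)⟩

theorem edge_of_app {i j : M.N} (hi : i < I.n) (hj : j < I.n) {v v' : Fin m → M.N}
    (hv : ∀ k, I.D i (v k)) (hv' : ∀ k, I.D j (v' k))
    (hE : ∀ k, pair (pair i (v k)) (pair j (v' k)) ∈ I.EA) {y y' : M.N} (hy : y ∈ I.A)
    (hy' : y' ∈ I.A) (hvy : App Ω v y) (hvy' : App Ω v' y') :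
    pair (pair i y) (pair j y') ∈ I.EA := by
  obtain ⟨s, hs, hsE⟩ := h.edges i hi j hj
  exact (hsE y (lt_len_of_mem hy) y' (lt_len_of_mem hy')).2 ((h.pol2 s hs).2 v
    (fun k => h.mem_A (hv k)) v' (fun k => h.mem_A (hv' k)) y hy y' hy'
    ⟨fun k => (hsE _ (hv k).1 _ (hv' k).1).1 (hE k), hvy, hvy'⟩)

theorem isOp_D {i : M.N} (hi : i < I.n) : IsOp m Ω (I.D i) := by
  intro v hv
  obtain ⟨⟨y, hy, hvy⟩, -⟩ := h.isOp_A hi v fun k => h.mem_A (hv k)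
  exact ⟨⟨y, h.D_of_app hi hv hy hvy, hvy⟩, fun y₁ h₁ y₂ h₂ e =>
    h.app_unique hi (fun k => h.mem_A (hv k)) (h.mem_A h₁) (h.mem_A h₂) e.1 e.2⟩

/-- Applying `Ω` to realizations of one walk in the input digraph gives a realization. -/
theorem exists_lift_app {t : M.N} {P H : M.S} {C : Fin m → M.S} (hP : I.Path t P H)
    (hC : ∀ k, I.Lift t P H (C k)) :
    ∃ C', I.Lift t P H C' ∧ ∀ p ≤ t, App Ω (fun k => ev (C k) p) (ev C' p) := by
  have hA : ∀ p ≤ t, ∀ k, ev (C k) p ∈ I.A := fun p hp k => h.mem_A ((hC k).1 p hp)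
  -- Comprehension turns the position-by-position values of `Ω` into one coded function.
  obtain ⟨C', -, -, hC'⟩ := exists_code (Q := fun p y => App Ω (fun k => ev (C k) p) y)
    (def_app Ω (fun k => .ev (.const (C k)) .v1) .v0) t I.l fun p hp => by
      obtain ⟨⟨y, hy, hvy⟩, huniq⟩ := h.isOp_A (hP.1 p hp) _ (hA p hp)
      exact ⟨y, lt_len_of_mem hy, hvy, fun z hz hvz => huniq z (h.full z hz) y hy ⟨hvz, hvy⟩⟩
  have hCA : ∀ p ≤ t, ev C' p ∈ I.A := fun p hp => h.full _ (hC' p hp).1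
  refine ⟨C', ⟨fun p hp => h.D_of_app (hP.1 p hp) (fun k => (hC k).1 p hp) (hCA p hp) (hC' p hp).2,
    fun p hp hpP => ?_, fun p hp hpP => ?_⟩, fun p hp => (hC' p hp).2⟩
  · have hp' := add_one_le_iff'.2 hp
    exact h.edge_of_app (hP.1 p hp.le) (hP.1 _ hp') (fun k => (hC k).1 p hp.le)
      (fun k => (hC k).1 _ hp') (fun k => (hC k).2.1 p hp hpP) (hCA p hp.le) (hCA _ hp')
      (hC' p hp.le).2 (hC' _ hp').2
  · have hp' := add_one_le_iff'.2 hp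
    exact h.edge_of_app (hP.1 _ hp') (hP.1 p hp.le) (fun k => (hC k).1 _ hp')
      (fun k => (hC k).1 p hp.le) (fun k => (hC k).2.2 p hp hpP) (hCA _ hp') (hCA p hp.le)
      (hC' _ hp').2 (hC' p hp.le).2

-- The congruence properties

theorem linked_refl {i a : M.N} (hi : i < I.n) (ha : I.D i a) : I.Linked a a i i :=
  (I.conn_refl hi ha).linked h.vars (mul_pos (zero_le.trans_lt hi) (zero_le.trans_lt ha.1))

theorem conn_of_linked {i a b : M.N} (hi : i < I.n) (ha : I.D i a) (hb : I.D i b)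
    (hl : I.Linked a b i i) : ∃ t < I.n * I.l, I.Conn t i a i b := by
  obtain ⟨t, ht, P, H, C, hP, hC, h0, h1, h2, h3⟩ :=
    InstVal.path_of_linked h.vars hi hi ha hb hl
  exact ⟨t, ht, H, C, hP.walk hC, h0, h2, h1, h3⟩

theorem linked_symm {i a b : M.N} (hi : i < I.n) (ha : I.D i a) (hb : I.D i b)
    (hl : I.Linked a b i i) : I.Linked b a i i :=
  let ⟨_, ht, hc⟩ := h.conn_of_linked hi ha hb hl
  hc.symm.linked h.vars ht

/-- The concatenated walk may have `n l` or more steps, so it is shortened before being converted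
back. -/
theorem linked_trans {i a b c : M.N} (hi : i < I.n) (ha : I.D i a) (hb : I.D i b) (hc : I.D i c)
    (hab : I.Linked a b i i) (hbc : I.Linked b c i i) : I.Linked a c i i :=
  let ⟨_, _, h₁⟩ := h.conn_of_linked hi ha hb hab
  let ⟨_, _, h₂⟩ := h.conn_of_linked hi hb hc hbc
  let ⟨_, ht, h₃⟩ := (h₁.trans h₂).exists_lt_mul
  h₃.linked h.vars ht

/-- Replacing one argument of `Ω` by a linked one gives a linked value. -/
theorem linked_app_update {i : M.N} (hi : i < I.n) {v : Fin m → M.N} (hv : ∀ k, I.D i (v k))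
    (j : Fin m) {b : M.N} (hb : I.D i b) (hl : I.Linked (v j) b i i) {y y' : M.N} (hy : y ∈ I.A)
    (hy' : y' ∈ I.A) (hvy : App Ω v y) (hvy' : App Ω (Function.update v j b) y') :
    I.Linked y y' i i := by
  obtain ⟨t, ht, P, H, C, hP, hC, h0, h1, h2, h3⟩ :=
    InstVal.path_of_linked h.vars hi hi (hv j) hb hl
  -- Coordinate `j` follows the linking path from `v j` to `b`; every other coordinate uses
  -- cycle-consistency to return to its starting value over the same walk.
  have hex : ∀ k, ∃ C, I.Lift t P H C ∧ ev C 0 = v k ∧ ev C t = Function.update v j b k := by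
    intro k
    rcases eq_or_ne k j with rfl | hne
    · exact ⟨C, hC, h2, by rw [h3, Function.update_self]⟩
    · rw [Function.update_of_ne hne]
      exact hP.exists_closed_lift h.vars h.cycles ht h0 h1 (hv k)
  choose C' hC' h2' h3' using hex
  obtain ⟨C'', hC'', hApp⟩ := h.exists_lift_app hP hC'
  have e0 : ev C'' 0 = y := by
    have := hApp 0 zero_le
    rw [funext h2'] at this
    exact h.app_unique hi (fun k => h.mem_A (hv k)) (h.mem_A (hC''.1 0 zero_le)) hy this hvy
  have e1 : ev C'' t = y' := by
    have h4 := hApp t le_rfl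
    have h5 : ∀ k, Function.update v j b k ∈ I.A := fun k =>
      h3' k ▸ h.mem_A ((hC' k).1 t le_rfl)
    rw [show (fun k => ev (C' k) t) = Function.update v j b from funext h3'] at h4
    exact h.app_unique hi h5 (h.mem_A (hC''.1 t le_rfl)) hy' h4 hvy'
  exact InstVal.Conn.linked h.vars ⟨H, C'', hP.walk hC'', h0, e0, h1, e1⟩ ht

/-- Hybrid argument: pass from `v` to `v'` through the vectors whose first `j` entries are already
replaced, and chain the links by transitivity. The induction on `j` is outside the model, so it
needs no definability. -/
theorem linked_app {i : M.N} (hi : i < I.n) {v v' : Fin m → M.N} (hv : ∀ k, I.D i (v k))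
    (hv' : ∀ k, I.D i (v' k)) (hl : ∀ k, I.Linked (v k) (v' k) i i) {y y' : M.N}
    (hy : I.D i y) (hy' : I.D i y') (hvy : App Ω v y) (hvy' : App Ω v' y') :
    I.Linked y y' i i := by
  have key : ∀ j ≤ m, ∀ z, I.D i z → App Ω (fun k => if k.val < j then v' k else v k) z →
      I.Linked y z i i := by
    intro j
    induction j with
    | zero =>
      intro _ z hz hvz
      simp only [Nat.not_lt_zero, if_false] at hvz
      rw [h.app_unique hi (fun k => h.mem_A (hv k)) (h.mem_A hz) (h.mem_A hy) hvz hvy]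
      exact h.linked_refl hi hy
    | succ j ih =>
      intro hj z hz hvz
      have hu : ∀ k : Fin m, I.D i (if k.val < j then v' k else v k) := fun k => by
        split
        · exact hv' k
        · exact hv k
      obtain ⟨⟨x, hx, hux⟩, -⟩ := h.isOp_D hi _ hu
      refine h.linked_trans hi hy hx hz (ih (by omega) x hx hux) ?_
      -- Consecutive hybrid vectors differ only at position `j`, where the old one still has `v j`.
      refine h.linked_app_update hi hu ⟨j, hj⟩ (hv' ⟨j, hj⟩) (by simpa using hl ⟨j, hj⟩)
        (h.mem_A hx) (h.mem_A hz) hux ?_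
      convert hvz using 1
      funext k
      rcases eq_or_ne k ⟨j, hj⟩ with rfl | hne
      · simp
      · have hkj : k.val ≠ j := fun e => hne (Fin.ext e)
        rw [Function.update_of_ne hne]
        exact if_congr (by omega) rfl rfl
  exact key m le_rfl y' hy' (by simpa using hvy')

theorem isCong_linked {i : M.N} (hi : i < I.n) :
    IsCong m (I.D i) Ω fun a b => I.Linked a b i i :=
  ⟨⟨h.isOp_D hi, fun _ hv _ hv' _ hb _ hb' e => h.linked_app hi hv hv' e.1 hb hb' e.2.1 e.2.2⟩,
    fun _ ha => h.linked_refl hi ha,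
    fun _ ha _ hb => ⟨h.linked_symm hi ha hb, h.linked_symm hi hb ha⟩,
    fun _ ha _ hb _ hc e => h.linked_trans hi ha hb hc e.1 e.2⟩

end IsCycleConsistentInst

end Congruence

end BA

theorem mainTheorem4 (m : ℕ) (hm : 2 ≤ m) :
    BA.Proves.{u} BA.V1 (BA.linkedCongruence m) := by
  intro M hM
  have : BA.IsV1Model M := ⟨hM⟩
  exact BA.models_linkedCongruence fun _ _ _ _ h _ hi => h.isCong_linked hi
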